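/- Let $K$ be a field, $A$ a unital associative $K$-algebra, and $S$ an inverse monoid with set of idempotents $E(S)$ and natural partial order $s\le t\iff s=et$ for some $e\in E(S)$. Let $\theta$ be a unital action of $S$ on $A$: a monoid homomorphism $s\mapsto\theta_s$ from $S$ to the symmetric inverse monoid of partial bijections of $A$ (so $\theta_1=\mathrm{id}_A$) such that $\operatorname{ran}\theta_s=1_sA$ for a central idempotent $1_s\in A$, and $\theta_s:1_{s^{-1}}A\to 1_sA$ is an isomorphism of $K$-algebras, for every $s\in S$. Let $L=\bigoplus_{s\in S}1_sA\,\delta_s$ be the $K$-algebra with product $a\delta_s\cdot b\delta_t=a\theta_s(1_{s^{-1}}b)\delta_{st}$, and let the crossed product $A\rtimes_\theta S$ be the quotient of $L$ by the two-sided ideal generated by all $a\delta_s-a\delta_t$ with $s\le t$ and $a\in 1_sA$; write $\overline{a\delta_s}$ for the class of $a\delta_s$. For a $K$-algebra $R$ put $R^e=R\otimes_K R^{\mathrm{op}}$; $R$-bimodules are identified with left $R^e$-modules by $(a\otimes b)x=axb$, $R$ is a right $R^e$-module by $x(a\otimes b)=bxa$, and $H_n(R,M)=\operatorname{Tor}^{R^e}_n(R,M)$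 is the Hochschild homology of $R$ with values in an $R$-bimodule $M$. An $A\rtimes_\theta S$-bimodule $M$ is an $A$-bimodule through $a\mapsto\overline{a\delta_1}$, and $A\otimes_{A^e}M$ is a left module over the semigroup algebra $KS$ by $$s\cdot(a\otimes x)=\theta_s(1_{s^{-1}}a)\otimes \overline{1_s\delta_s}\,x\,\overline{1_{s^{-1}}\delta_{s^{-1}}}.$$ This defines a right exact functor $F_1=A\otimes_{A^e}-$ from $(A\rtimes_\theta S)^e$-modules to left $KS$-modules, with left derived functors $L_qF_1$. Let $KE(S)$ be the free $K$-module on $E(S)$, a right $KS$-module by $e\cdot s=s^{-1}es$, and for a left $KS$-module $V$ put $H_n(S,V)=\operatorname{Tor}_n^{KS}(KE(S),V)$. Then for every $A\rtimes_\theta S$-bimodule $M$ there is a first quadrant homology spectral sequence of $K$-modules, with differentials $d^r:E^r_{p,q}\to E^r_{p-r,q+r-1}$ for $r\ge2$, $$E^2_{p,q}=H_p\bigl(S,(L_qF_1)M\bigr)\Rightarrow H_{p+q}(A\rtimes_\theta S,M).$$ That is, $E^2_{p,q}\cong H_p(S,(L_qF_1)M)$ for all $p,q\ge 0$, and each $H_n(A\rtimes_\theta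 S,M)$ has a filtration by $K$-submodules $0=\Phi_{-1}\subseteq\Phi_0\subseteq\dots\subseteq\Phi_n=H_n(A\rtimes_\theta S,M)$ with $\Phi_p/\Phi_{p-1}\cong E^\infty_{p,n-p}$ for $0\le p\le n$, where $E^\infty_{p,q}$ is the common value of $E^r_{p,q}$ for all $r\ge 2$ with $r>\max(p,q+1)$. -/

import Mathlib

universe u

open CategoryTheory

noncomputable section

open TensorProduct MulOpposite

set_option linter.unusedSectionVars false

/-! ### Inverse monoids -/

/-- An inverse monoid: a monoid in which every `s` has a unique generalized inverse `s⁻¹`. -/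
class InverseMonoid (S : Type*) extends Monoid S, Inv S where
  mul_inv_mul_self : ∀ s : S, s * s⁻¹ * s = s
  inv_mul_inv_self : ∀ s : S, s⁻¹ * s * s⁻¹ = s⁻¹
  inv_unique : ∀ s t : S, s * t * s = s → t * s * t = t → t = s⁻¹

namespace InverseMonoid

section

variable {S : Type*} [InverseMonoid S]

lemma inv_of_idem {e : S} (he : e * e = e) : e⁻¹ = e :=
  (inv_unique e e (by rw [he, he]) (by rw [he, he])).symm

lemma idem_mul_idem {e f : S} (he : e * e = e) (hf : f * f = f) :
    (e * f) * (e * f) = e * f := by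
  have h1 := mul_inv_mul_self (e * f)
  have h2 := inv_mul_inv_self (e * f)
  set x := (e * f)⁻¹ with hx
  have h3 : f * x * e = x := by
    apply inv_unique
    · calc e * f * (f * x * e) * (e * f) = e * (f * f) * x * (e * e) * f := by
            simp only [mul_assoc]
        _ = e * f * x * (e * f) := by rw [he, hf]; simp only [mul_assoc]
        _ = e * f := h1
    · calc f * x * e * (e * f) * (f * x * e) = f * x * (e * e) * (f * f) * x * e := by
            simp only [mul_assoc]
        _ = f * (x * (e * f) * x) * e := by rw [he, hf]; simp only [mul_assoc]
        _ = f * x * e := by rw [h2]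
  have h4 : x * x = x := by
    calc x * x = (f * x * e) * (f * x * e) := by rw [h3]
      _ = f * (x * (e * f) * x) * e := by simp only [mul_assoc]
      _ = x := by rw [h2, h3]
  have h5 : e * f = x := by
    rw [inv_unique x (e * f) h2 h1, inv_of_idem h4]
  rw [h5, h4]

/-- Idempotents of an inverse monoid commute. -/
lemma idem_comm {e f : S} (he : e * e = e) (hf : f * f = f) : e * f = f * e := by
  have h1 := idem_mul_idem he hf
  have h2 := idem_mul_idem hf he
  have h3 : f * e = (e * f)⁻¹ := by
    apply inv_unique
    · calc e * f * (f * e) * (e * f) = e * (f * f) * (e * e) * f := by simp only [mul_assoc]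
        _ = (e * f) * (e * f) := by rw [he, hf]; simp only [mul_assoc]
        _ = e * f := h1
    · calc f * e * (e * f) * (f * e) = f * (e * e) * (f * f) * e := by simp only [mul_assoc]
        _ = (f * e) * (f * e) := by rw [he, hf]; simp only [mul_assoc]
        _ = f * e := h2
  rw [h3, inv_of_idem h1]

lemma mul_inv_idem (s : S) : (s * s⁻¹) * (s * s⁻¹) = s * s⁻¹ := by
  rw [← mul_assoc, mul_inv_mul_self]

lemma inv_mul_idem (s : S) : (s⁻¹ * s) * (s⁻¹ * s) = s⁻¹ * s := by
  rw [← mul_assoc, inv_mul_inv_self]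

lemma mul_inv_rev' (s t : S) : (s * t)⁻¹ = t⁻¹ * s⁻¹ := by
  have hc := idem_comm (inv_mul_idem s) (mul_inv_idem t)
  symm
  apply inv_unique
  · calc s * t * (t⁻¹ * s⁻¹) * (s * t) = s * ((t * t⁻¹) * (s⁻¹ * s)) * t := by
          simp only [mul_assoc]
      _ = (s * s⁻¹ * s) * (t * t⁻¹ * t) := by rw [← hc]; simp only [mul_assoc]
      _ = s * t := by rw [mul_inv_mul_self, mul_inv_mul_self]
  · calc t⁻¹ * s⁻¹ * (s * t) * (t⁻¹ * s⁻¹) = t⁻¹ * ((s⁻¹ * s) * (t * t⁻¹)) * s⁻¹ := by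
          simp only [mul_assoc]
      _ = (t⁻¹ * t * t⁻¹) * (s⁻¹ * s * s⁻¹) := by rw [hc]; simp only [mul_assoc]
      _ = t⁻¹ * s⁻¹ := by rw [inv_mul_inv_self, inv_mul_inv_self]

lemma inv_one' : (1 : S)⁻¹ = 1 := inv_of_idem (mul_one 1)

lemma conj_idem (s : S) {e : S} (he : e * e = e) :
    (s⁻¹ * e * s) * (s⁻¹ * e * s) = s⁻¹ * e * s := by
  calc (s⁻¹ * e * s) * (s⁻¹ * e * s) = s⁻¹ * (e * (s * s⁻¹)) * e * s := by
        simp only [mul_assoc]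
    _ = (s⁻¹ * s * s⁻¹) * (e * e) * s := by
        rw [idem_comm he (mul_inv_idem s)]; simp only [mul_assoc]
    _ = s⁻¹ * e * s := by rw [inv_mul_inv_self, he]

/-- The natural partial order: `s ≤ t` iff `s = e t` for some idempotent `e`. -/
def NatLE (s t : S) : Prop := ∃ e : S, e * e = e ∧ s = e * t

end

/-- The set `E(S)` of idempotents of `S`. -/
abbrev Idem (S : Type*) [InverseMonoid S] : Type _ := {e : S // e * e = e}

end InverseMonoid

open InverseMonoid

/-! ### Unital actions -/

/-- A unital action of an inverse monoid `S` on a `K`-algebra `A`: a homomorphism `θ` of monoids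
from `S` to the symmetric inverse monoid of all partial bijections `A ≃. A`
(`θ (s t)` is `θ t` followed by `θ s` on the largest possible domain), such that the range of
`θ s` is the ideal `1ₛ A` for a central idempotent `1ₛ = unit s`, and `θ s` is an isomorphism of
algebras from its domain onto its range. (The domain of `θ s` is the range of `θ s⁻¹`,
i.e. the ideal generated by `unit s⁻¹`; see `UnitalAction.mem_dom_iff`.) -/
structure UnitalAction (K A S : Type*) [CommRing K] [Ring A] [Algebra K A]
    [InverseMonoid S] where
  θ : S → (A ≃. A)
  θ_one : θ 1 = PEquiv.refl A
  θ_mul : ∀ s t, θ (s * t) = (θ t).trans (θ s)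
  unit : S → A
  unit_central : ∀ s a, unit s * a = a * unit s
  unit_idem : ∀ s, unit s * unit s = unit s
  mem_range_iff : ∀ s b, (∃ a, θ s a = some b) ↔ ∃ c, b = unit s * c
  apply_add : ∀ s a a' b b', θ s a = some b → θ s a' = some b' → θ s (a + a') = some (b + b')
  apply_mul : ∀ s a a' b b', θ s a = some b → θ s a' = some b' → θ s (a * a') = some (b * b')
  apply_smul : ∀ s (k : K) a b, θ s a = some b → θ s (k • a) = some (k • b)

namespace UnitalAction

variable {K A S : Type u} [CommRing K] [Ring A] [Algebra K A] [InverseMonoid S]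
  (α : UnitalAction K A S)

lemma mul_apply (s t : S) (a : A) : α.θ (s * t) a = (α.θ t a).bind (α.θ s) := by
  rw [α.θ_mul]; rfl

lemma inj {s : S} {a a' b : A} (h : α.θ s a = some b) (h' : α.θ s a' = some b) : a = a' := by
  rw [← PEquiv.eq_some_iff] at h h'
  exact Option.some_injective _ (h.symm.trans h')

lemma inv_aux {s t : S} (hst : s * t * s = s) {a b : A} (h : α.θ s a = some b) :
    α.θ t b = some a := by
  have h1 : α.θ (s * t * s) a = some b := by rw [hst, h]
  rw [mul_apply, h, Option.bind_some, mul_apply, Option.bind_eq_some_iff] at h1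
  obtain ⟨a', ha', hb⟩ := h1
  rw [ha', α.inj hb h]

/-- `θ s⁻¹` is the inverse partial bijection of `θ s`. -/
lemma inv_apply_iff (s : S) (a b : A) : α.θ s⁻¹ b = some a ↔ α.θ s a = some b :=
  ⟨α.inv_aux (inv_mul_inv_self s), α.inv_aux (mul_inv_mul_self s)⟩

lemma unit_mul_of_range {s : S} {a b : A} (h : α.θ s a = some b) : α.unit s * b = b := by
  obtain ⟨c, rfl⟩ := (α.mem_range_iff s b).1 ⟨a, h⟩
  rw [← mul_assoc, α.unit_idem]

/-- The domain of `θ s` is the ideal generated by the central idempotent `unit s⁻¹`. -/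
lemma mem_dom_iff (s : S) (a : A) : (∃ b, α.θ s a = some b) ↔ ∃ c, a = α.unit s⁻¹ * c := by
  rw [← α.mem_range_iff]
  exact exists_congr fun b => (α.inv_apply_iff s a b).symm

lemma unit_mul_of_dom {s : S} {a b : A} (h : α.θ s a = some b) : α.unit s⁻¹ * a = a :=
  α.unit_mul_of_range ((α.inv_apply_iff s a b).2 h)

/-- `s · a = θ s (1_{s⁻¹} a)`, see `UnitalAction.apply_unit_mul`; the default value in `getD` is
never used. -/
def actFun (s : S) (a : A) : A := (α.θ s (α.unit s⁻¹ * a)).getD 0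

lemma apply_unit_mul (s : S) (a : A) : α.θ s (α.unit s⁻¹ * a) = some (α.actFun s a) := by
  obtain ⟨b, hb⟩ := (α.mem_dom_iff s (α.unit s⁻¹ * a)).2 ⟨a, rfl⟩
  rw [actFun, hb]; rfl

lemma actFun_eq {s : S} {a b : A} (h : α.θ s (α.unit s⁻¹ * a) = some b) : α.actFun s a = b := by
  rw [actFun, h]; rfl

lemma actFun_eq_of_dom {s : S} {a b : A} (h : α.θ s a = some b) : α.actFun s a = b :=
  α.actFun_eq (by rw [α.unit_mul_of_dom h, h])

lemma actFun_mul (s : S) (a b : A) : α.actFun s (a * b) = α.actFun s a * α.actFun s b := by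
  apply α.actFun_eq
  have h := α.apply_mul _ _ _ _ _ (α.apply_unit_mul s a) (α.apply_unit_mul s b)
  rwa [α.unit_central s⁻¹ b, ← mul_assoc, mul_assoc (α.unit s⁻¹) a b, α.unit_central s⁻¹ (a * b),
    mul_assoc, α.unit_idem, ← α.unit_central] at h

lemma unit_mul_actFun (s : S) (a : A) : α.unit s * α.actFun s a = α.actFun s a :=
  α.unit_mul_of_range (α.apply_unit_mul s a)

lemma actFun_unit_one (s : S) : α.actFun s 1 = α.unit s := by
  obtain ⟨x, hx⟩ := (α.mem_range_iff s (α.unit s)).2 ⟨1, (mul_one _).symm⟩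
  have h1 : α.actFun s x = α.unit s := α.actFun_eq_of_dom hx
  have h2 := α.actFun_mul s 1 x
  rw [one_mul, h1] at h2
  rw [h2, ← α.unit_central, α.unit_mul_actFun]

lemma unit_one : α.unit 1 = 1 := by
  obtain ⟨c, hc⟩ := (α.mem_range_iff 1 1).1 ⟨1, by rw [α.θ_one]; rfl⟩
  calc α.unit 1 = α.unit 1 * 1 := (mul_one _).symm
    _ = 1 := by rw [hc, ← mul_assoc, α.unit_idem]

lemma actFun_one (a : A) : α.actFun 1 a = a := by
  apply α.actFun_eq_of_dom
  rw [α.θ_one]; rfl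

lemma actFun_actFun (s t : S) (a : A) : α.actFun (s * t) a = α.actFun s (α.actFun t a) := by
  have key : ∀ {x y : A}, α.θ (s * t) x = some y → α.actFun s (α.actFun t x) = y := by
    intro x y h
    rw [mul_apply, Option.bind_eq_some_iff] at h
    obtain ⟨z, hz, hy⟩ := h
    rw [α.actFun_eq_of_dom hz, α.actFun_eq_of_dom hy]
  have h1 := key (α.apply_unit_mul (s * t) a)
  have h2 : α.actFun s (α.actFun t (α.unit (s * t)⁻¹)) = α.unit (s * t) := by
    have h := α.apply_unit_mul (s * t) 1
    rw [mul_one, α.actFun_unit_one] at h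
    exact key h
  rw [actFun_mul, actFun_mul, h2] at h1
  rw [← h1]
  have h3 : ∃ w, α.θ (s * t) w = some (α.actFun s (α.actFun t a)) := by
    obtain ⟨w, hw⟩ := (α.mem_range_iff t (α.unit s⁻¹ * α.actFun t a)).2
      ⟨α.unit s⁻¹ * α.actFun t a, by
        rw [← mul_assoc, α.unit_central t, mul_assoc, α.unit_mul_actFun]⟩
    exact ⟨w, by rw [mul_apply, hw, Option.bind_some, α.apply_unit_mul]⟩
  obtain ⟨w, hw⟩ := h3
  exact α.unit_mul_of_range hw

/-- The left `KS`-module structure on `A`: `s · a = θ s (1_{s⁻¹} a)`. -/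
def act : S →* Module.End K A where
  toFun s :=
    { toFun := α.actFun s
      map_add' := fun a b => α.actFun_eq (by
        rw [mul_add]
        exact α.apply_add _ _ _ _ _ (α.apply_unit_mul s a) (α.apply_unit_mul s b))
      map_smul' := fun k a => α.actFun_eq (by
        rw [mul_smul_comm]
        exact α.apply_smul _ _ _ _ (α.apply_unit_mul s a)) }
  map_one' := by ext a; exact α.actFun_one a
  map_mul' s t := by ext a; exact α.actFun_actFun s t a

lemma apply_unit_mul' (s : S) (a : A) : α.θ s (α.unit s⁻¹ * a) = some (α.act s a) :=
  α.apply_unit_mul s a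

lemma act_mul (s : S) (a b : A) : α.act s (a * b) = α.act s a * α.act s b := α.actFun_mul s a b

lemma unit_mul_act (s : S) (a : A) : α.unit s * α.act s a = α.act s a := α.unit_mul_actFun s a

lemma act_one (s : S) : α.act s 1 = α.unit s := α.actFun_unit_one s

lemma act_act (s t : S) (a : A) : α.act s (α.act t a) = α.act (s * t) a :=
  (α.actFun_actFun s t a).symm

lemma act_unit (s t : S) : α.act s (α.unit t) = α.unit (s * t) := by
  rw [← act_one, act_act, act_one]

lemma act_inv_act (s : S) (a : A) : α.act s⁻¹ (α.act s a) = α.unit s⁻¹ * a :=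
  α.actFun_eq_of_dom ((α.inv_apply_iff s _ _).2 (α.apply_unit_mul s a))

/-! ### The algebra `L(A, θ, S)` -/

/-- The bilinear product on finitely supported functions `S →₀ A` with
`(a δ_s) (b δ_t) = a θ_s(1_{s⁻¹} b) δ_{st}`. -/
def lmul : (S →₀ A) →ₗ[K] (S →₀ A) →ₗ[K] (S →₀ A) :=
  Finsupp.lsum K fun s => LinearMap.flip (Finsupp.lsum K fun t => LinearMap.flip
    (((LinearMap.mul K A).compl₂ (α.act s)).compr₂ (Finsupp.lsingle (s * t))))

lemma lmul_single (s t : S) (a b : A) :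
    α.lmul (Finsupp.single s a) (Finsupp.single t b) = Finsupp.single (s * t) (a * α.act s b) := by
  simp [lmul]

lemma lmul_assoc (x y z : S →₀ A) : α.lmul (α.lmul x y) z = α.lmul x (α.lmul y z) := by
  induction x using Finsupp.induction_linear with
  | zero => simp
  | add x x' h h' => simp [h, h']
  | single s a =>
    induction y using Finsupp.induction_linear with
    | zero => simp
    | add y y' h h' => simp [h, h']
    | single t b =>
      induction z using Finsupp.induction_linear with
      | zero => simp
      | add z z' h h' => simp only [map_add, h, h']
      | single r c =>
        rw [lmul_single, lmul_single, lmul_single, lmul_single, act_mul, act_act, mul_assoc,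
          mul_assoc]

/-- The underlying `K`-module of `L(A, θ, S) = ⨁ₛ 1ₛA δₛ`, realized as the finitely supported
functions `f : S →₀ A` with `f s ∈ 1ₛA` for all `s`; `Finsupp.single s a` is `a δₛ`. -/
def lSubmodule : Submodule K (S →₀ A) where
  carrier := {f | ∀ s, α.unit s * f s = f s}
  add_mem' := fun {f g} hf hg s => by rw [Finsupp.add_apply, mul_add, hf, hg]
  zero_mem' := fun s => by simp
  smul_mem' := fun k _ hf s => by rw [Finsupp.smul_apply, mul_smul_comm, hf]

lemma single_mem {s : S} {a : A} (h : α.unit s * a = a) :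
    Finsupp.single s a ∈ α.lSubmodule := by
  classical
  intro t
  rw [Finsupp.single_apply]
  split_ifs with hst
  · rw [← hst, h]
  · rw [mul_zero]

lemma lmul_mem (f : S →₀ A) {g : S →₀ A} (hg : g ∈ α.lSubmodule) :
    α.lmul f g ∈ α.lSubmodule := by
  rw [← f.sum_single, ← g.sum_single, Finsupp.sum, Finsupp.sum, map_sum α.lmul,
    LinearMap.sum_apply]
  refine Submodule.sum_mem _ fun s _ => ?_
  rw [map_sum]
  refine Submodule.sum_mem _ fun t _ => ?_
  rw [lmul_single]
  apply α.single_mem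
  have h : α.act s (g t) = α.unit (s * t) * α.act s (g t) := by
    conv_lhs => rw [← hg t, act_mul, act_unit]
  rw [h, ← mul_assoc, ← mul_assoc, α.unit_central, mul_assoc (f s), α.unit_idem, mul_assoc]

lemma one_lmul (f : S →₀ A) : α.lmul (Finsupp.single 1 1) f = f := by
  induction f using Finsupp.induction_linear with
  | zero => simp
  | add f g h h' => rw [map_add, h, h']
  | single t b =>
    rw [lmul_single, one_mul, one_mul]
    congr 1
    exact α.actFun_one b

lemma lmul_one {f : S →₀ A} (hf : f ∈ α.lSubmodule) : α.lmul f (Finsupp.single 1 1) = f := by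
  conv_lhs => rw [← f.sum_single, Finsupp.sum, map_sum, LinearMap.sum_apply]
  conv_rhs => rw [← f.sum_single, Finsupp.sum]
  refine Finset.sum_congr rfl fun s _ => ?_
  rw [lmul_single, mul_one, act_one, ← α.unit_central, hf s]

/-- The `K`-algebra `L(A, θ, S)`. -/
def L : Type u := α.lSubmodule

instance : AddCommGroup α.L := inferInstanceAs (AddCommGroup α.lSubmodule)

instance : Module K α.L := inferInstanceAs (Module K α.lSubmodule)

instance : Ring α.L :=
  { (inferInstance : AddCommGroup α.L) with
    mul := fun x y => ⟨α.lmul x.1 y.1, α.lmul_mem x.1 y.2⟩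
    one := ⟨Finsupp.single 1 1, α.single_mem (by rw [α.unit_one, mul_one])⟩
    mul_assoc := fun x y z => Subtype.ext (α.lmul_assoc x.1 y.1 z.1)
    one_mul := fun x => Subtype.ext (α.one_lmul x.1)
    mul_one := fun x => Subtype.ext (α.lmul_one x.2)
    left_distrib := fun x y z => Subtype.ext ((α.lmul x.1).map_add y.1 z.1)
    right_distrib := fun x y z => Subtype.ext (LinearMap.map_add₂ α.lmul x.1 y.1 z.1)
    zero_mul := fun x => Subtype.ext (LinearMap.map_zero₂ α.lmul x.1)
    mul_zero := fun x => Subtype.ext ((α.lmul x.1).map_zero) }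

instance : Algebra K α.L :=
  Algebra.ofModule (fun k x y => Subtype.ext (LinearMap.map_smul₂ α.lmul k x.1 y.1))
    (fun k x y => Subtype.ext ((α.lmul x.1).map_smul k y.1))

/-- The element `a δₛ` of `L(A, θ, S)`, for `a ∈ 1ₛA`. -/
def δ (s : S) (a : A) (h : α.unit s * a = a) : α.L := ⟨Finsupp.single s a, α.single_mem h⟩

lemma δ_mul_δ (s t : S) (a b : A) (ha : α.unit s * a = a) (hb : α.unit t * b = b)
    (hab : α.unit (s * t) * (a * α.act s b) = a * α.act s b) :
    α.δ s a ha * α.δ t b hb = α.δ (s * t) (a * α.act s b) hab :=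
  Subtype.ext (α.lmul_single s t a b)

lemma δ_congr {s t : S} {a b : A} (ha : α.unit s * a = a) (hb : α.unit t * b = b)
    (h : s = t) (h' : a = b) : α.δ s a ha = α.δ t b hb := by
  subst h h'; rfl

/-! ### The crossed product -/

/-- The set of all `a δ_s - a δ_t` with `s ≤ t` and `a ∈ 1ₛA` (then also `a ∈ 1ₜA`). -/
def crossedRel : Set α.L :=
  {x | ∃ (s t : S) (a : A) (hs : α.unit s * a = a) (ht : α.unit t * a = a),
    NatLE s t ∧ x = α.δ s a hs - α.δ t a ht}

/-- If `s ≤ t` then `1ₛA ⊆ 1ₜA`, so that the condition on `t` in `crossedRel` is automatic. -/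
lemma unit_mul_of_natLE {s t : S} (h : NatLE s t) {a : A} (ha : α.unit s * a = a) :
    α.unit t * a = a := by
  obtain ⟨e, he, rfl⟩ := h
  have h1 : e * t = t * (t⁻¹ * e * t) := by
    calc e * t = e * (t * t⁻¹) * t := by rw [mul_assoc e, mul_inv_mul_self]
      _ = t * (t⁻¹ * e * t) := by
        rw [idem_comm he (mul_inv_idem t)]; simp only [mul_assoc]
  have h2 : α.unit t * α.unit (e * t) = α.unit (e * t) := by
    rw [h1, ← act_unit, unit_mul_act]
  rw [← ha, ← mul_assoc, h2]

/-- The crossed product `A ⋊_θ S`: the quotient of `L(A, θ, S)` by the two-sided ideal generated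
by `crossedRel`. -/
abbrev CrossedProduct : Type u := α.L ⧸ (TwoSidedIdeal.span α.crossedRel).asIdeal

/-- The quotient map `L(A, θ, S) → A ⋊_θ S`. -/
def toCrossed : α.L →ₐ[K] α.CrossedProduct :=
  Ideal.Quotient.mkₐ K (TwoSidedIdeal.span α.crossedRel).asIdeal

/-- The algebra homomorphism `A → A ⋊_θ S`, `a ↦ a δ₁`. -/
def ι : A →ₐ[K] α.CrossedProduct :=
  α.toCrossed.comp <| AlgHom.ofLinearMap
    { toFun := fun a => α.δ 1 a (by rw [α.unit_one, one_mul])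
      map_add' := fun a b => Subtype.ext (Finsupp.single_add 1 a b)
      map_smul' := fun k a => Subtype.ext (Finsupp.smul_single k 1 a).symm }
    rfl
    (fun a b => Subtype.ext (by
      refine Eq.trans ?_ (α.lmul_single 1 1 a b).symm
      rw [mul_one, map_one]; rfl))

/-- The monoid homomorphism `Γ : S → A ⋊_θ S`, `s ↦ 1ₛ δₛ`. -/
def Γ : S →* α.CrossedProduct :=
  (α.toCrossed : α.L →* α.CrossedProduct).comp
    { toFun := fun s => α.δ s (α.unit s) (α.unit_idem s)
      map_one' := Subtype.ext (by
        change Finsupp.single (1 : S) (α.unit 1) = Finsupp.single 1 1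
        rw [α.unit_one])
      map_mul' := fun s t => Subtype.ext (by
        refine Eq.trans ?_ (α.lmul_single s t _ _).symm
        change Finsupp.single (s * t) (α.unit (s * t)) = _
        rw [act_unit, ← act_unit, unit_mul_act]) }


lemma Γ_mul_ι (s : S) (a : A) : α.Γ s * α.ι a = α.ι (α.act s a) * α.Γ s := by
  refine congrArg α.toCrossed (Subtype.ext ?_ :
    α.δ s (α.unit s) (α.unit_idem s) * α.δ 1 a (by rw [α.unit_one, one_mul]) =
      α.δ 1 (α.act s a) (by rw [α.unit_one, one_mul]) * α.δ s (α.unit s) (α.unit_idem s))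
  refine (α.lmul_single s 1 _ _).trans (Eq.trans ?_ (α.lmul_single 1 s _ _).symm)
  rw [mul_one, one_mul, act_unit, one_mul, α.unit_central]

lemma Γ_inv_mul_ι_act (s : S) (a : A) : α.Γ s⁻¹ * α.ι (α.act s a) = α.ι a * α.Γ s⁻¹ := by
  rw [Γ_mul_ι, act_inv_act, α.unit_central, map_mul, mul_assoc]
  congr 1
  refine congrArg α.toCrossed (Subtype.ext ?_ :
    α.δ 1 (α.unit s⁻¹) (by rw [α.unit_one, one_mul]) * α.δ s⁻¹ (α.unit s⁻¹) (α.unit_idem s⁻¹) =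
      α.δ s⁻¹ (α.unit s⁻¹) (α.unit_idem s⁻¹))
  refine (α.lmul_single 1 s⁻¹ _ _).trans ?_
  rw [one_mul, act_unit, one_mul, α.unit_idem]; rfl

end UnitalAction

/-! ### Tensor products over a noncommutative algebra, Tor, and Hochschild homology -/

section BalancedTensor

variable (K R : Type u) [CommRing K] [Ring R] (X : Type u) [AddCommGroup X] [Module K X]
  [Module Rᵐᵒᵖ X] [SMulCommClass K Rᵐᵒᵖ X] (Y : Type u) [AddCommGroup Y] [Module R Y]

/-- The relations `x r ⊗ y = x ⊗ r y`. -/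
def balancedRel : Submodule K (X ⊗[ℤ] Y) :=
  Submodule.span K {z | ∃ (x : X) (r : R) (y : Y), z = (op r • x) ⊗ₜ[ℤ] y - x ⊗ₜ[ℤ] (r • y)}

/-- The tensor product `X ⊗_R Y` of a `K`-`R`-bimodule `X` (its right `R`-module structure is a
`Rᵐᵒᵖ`-module structure) and a left `R`-module `Y`, as a `K`-module. -/
abbrev BalancedTensor : Type u := (X ⊗[ℤ] Y) ⧸ balancedRel K R X Y

variable {X Y}

/-- The pure tensor `x ⊗_R y`. -/
def BalancedTensor.mk (x : X) (y : Y) : BalancedTensor K R X Y :=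
  Submodule.Quotient.mk (x ⊗ₜ[ℤ] y)

namespace BalancedTensor

lemma mk_smul (x : X) (r : R) (y : Y) : mk K R (op r • x) y = mk K R x (r • y) :=
  (Submodule.Quotient.eq _).2 (Submodule.subset_span ⟨x, r, y, rfl⟩)

lemma add_mk (x x' : X) (y : Y) : mk K R (x + x') y = mk K R x y + mk K R x' y := by
  rw [mk, TensorProduct.add_tmul]; rfl

lemma mk_add (x : X) (y y' : Y) : mk K R x (y + y') = mk K R x y + mk K R x y' := by
  rw [mk, TensorProduct.tmul_add]; rfl

lemma zero_mk (y : Y) : mk K R (0 : X) y = 0 := by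
  rw [mk, TensorProduct.zero_tmul]; rfl

lemma mk_zero (x : X) : mk K R x (0 : Y) = 0 := by
  rw [mk, TensorProduct.tmul_zero]; rfl

variable {K R}

lemma induction {p : BalancedTensor K R X Y → Prop} (z : BalancedTensor K R X Y)
    (hmk : ∀ x y, p (mk K R x y)) (hadd : ∀ z w, p z → p w → p (z + w)) : p z := by
  obtain ⟨z, rfl⟩ := Submodule.Quotient.mk_surjective _ z
  induction z using TensorProduct.induction_on with
  | zero =>
    have h := hmk (0 : X) (0 : Y)
    rw [zero_mk] at h
    exact h
  | tmul x y => exact hmk x y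
  | add z w hz hw => exact hadd _ _ hz hw

variable {R' : Type u} [Ring R'] {X' : Type u} [AddCommGroup X'] [Module K X']
  [Module R'ᵐᵒᵖ X'] [SMulCommClass K R'ᵐᵒᵖ X'] {Y' : Type u} [AddCommGroup Y'] [Module R' Y']

/-- The map `x ⊗ y ↦ f x ⊗ g y`, for `f` and `g` such that this is balanced. -/
def map (f : X →ₗ[K] X') (g : Y →+ Y')
    (h : ∀ x (r : R) y, mk K R' (f (op r • x)) (g y) = mk K R' (f x) (g (r • y))) :
    BalancedTensor K R X Y →ₗ[K] BalancedTensor K R' X' Y' :=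
  Submodule.mapQ _ _ (TensorProduct.AlgebraTensorModule.map f g.toIntLinearMap) (by
    rw [balancedRel, Submodule.span_le]
    rintro _ ⟨x, r, y, rfl⟩
    rw [SetLike.mem_coe, Submodule.mem_comap, map_sub]
    exact (Submodule.Quotient.eq _).1 (h x r y))

lemma map_mk (f : X →ₗ[K] X') (g : Y →+ Y')
    (h : ∀ x (r : R) y, mk K R' (f (op r • x)) (g y) = mk K R' (f x) (g (r • y)))
    (x : X) (y : Y) : map f g h (mk K R x y) = mk K R' (f x) (g y) := rfl

lemma hom_ext {P : Type*} [AddCommGroup P] [Module K P] {f g : BalancedTensor K R X Y →ₗ[K] P}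
    (h : ∀ x y, f (mk K R x y) = g (mk K R x y)) : f = g := by
  refine LinearMap.ext fun z => ?_
  induction z using BalancedTensor.induction with
  | hmk x y => exact h x y
  | hadd z w hz hw => rw [map_add, map_add, hz, hw]

end BalancedTensor

variable (X)

/-- The functor `X ⊗_R - : R-Mod → K-Mod`. -/
def tensorFunctor : ModuleCat.{u} R ⥤ ModuleCat.{u} K where
  obj Y := ModuleCat.of K (BalancedTensor K R X Y)
  map g := ModuleCat.ofHom (BalancedTensor.map LinearMap.id g.hom.toAddMonoidHom (fun x r y => by
    change BalancedTensor.mk K R (op r • x) (g.hom y) = BalancedTensor.mk K R x (g.hom (r • y))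
    rw [BalancedTensor.mk_smul, map_smul]))
  map_id Y := by
    ext1
    exact BalancedTensor.hom_ext fun x y => rfl
  map_comp f g := by
    ext1
    exact BalancedTensor.hom_ext fun x y => rfl

instance : (tensorFunctor K R X).Additive where
  map_add {Y Z f g} := by
    ext1
    exact BalancedTensor.hom_ext fun x y => BalancedTensor.mk_add K R x (f.hom y) (g.hom y)

/-- `Tor_n^R(X, -)`, the `n`-th left derived functor of `X ⊗_R -`. -/
def torFunctor (n : ℕ) : ModuleCat.{u} R ⥤ ModuleCat.{u} K :=
  (tensorFunctor K R X).leftDerived n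

end BalancedTensor

section Hochschild

variable (K R : Type u) [CommRing K] [Ring R] [Algebra K R]

/-- The enveloping algebra `R^e = R ⊗_K R^op`; a `K`-`R`-bimodule is a left `R^e`-module through
`(a ⊗ b) x = a x b`. -/
abbrev Env : Type u := R ⊗[K] Rᵐᵒᵖ

lemma envRight_commute (a : R) (b : Rᵐᵒᵖ) :
    Commute ((AlgHom.opComm.symm (Algebra.lsmul K K R : Rᵐᵒᵖ →ₐ[K] Module.End K R)) a)
      ((AlgHom.op (Algebra.lmul K R)) b) :=
  congrArg op (LinearMap.ext fun x => by simp [mul_assoc])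

/-- The right `R^e`-action on `R`, `x (a ⊗ b) = b x a`; see `op_tmul_smul`. -/
def envRightAction : (Env K R)ᵐᵒᵖ →ₐ[K] Module.End K R :=
  AlgHom.opComm (Algebra.TensorProduct.lift
    (AlgHom.opComm.symm (Algebra.lsmul K K R : Rᵐᵒᵖ →ₐ[K] Module.End K R))
    (AlgHom.op (Algebra.lmul K R))
    (envRight_commute K R))

instance envRightModule : Module (Env K R)ᵐᵒᵖ R :=
  Module.compHom R (envRightAction K R).toRingHom

lemma env_op_smul_def (r : (Env K R)ᵐᵒᵖ) (x : R) : r • x = envRightAction K R r x := rfl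

lemma op_tmul_smul (a b x : R) : op (a ⊗ₜ[K] op b) • x = b * x * a := by
  rw [env_op_smul_def]
  have h : envRightAction K R (op (a ⊗ₜ[K] op b)) =
      unop ((AlgHom.opComm.symm (Algebra.lsmul K K R : Rᵐᵒᵖ →ₐ[K] Module.End K R)) a *
        (AlgHom.op (Algebra.lmul K R)) (op b)) :=
    congrArg unop (Algebra.TensorProduct.lift_tmul _ _ (envRight_commute K R) a (op b))
  rw [h, mul_assoc]
  rfl

instance : SMulCommClass K (Env K R)ᵐᵒᵖ R where
  smul_comm k r x := ((envRightAction K R r).map_smul k x).symm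

/-- The Hochschild homology `H_n(R, M) = Tor_n^{R^e}(R, M)`. -/
def hochschildHomology (n : ℕ) (M : ModuleCat.{u} (Env K R)) : ModuleCat.{u} K :=
  (torFunctor K (Env K R) R n).obj M

end Hochschild

/-! ### Homology of an inverse monoid -/

section InverseMonoidHomology

variable (K S : Type u) [CommRing K] [InverseMonoid S]

/-- The free `K`-module `KE(S)` on the idempotents of `S`. -/
abbrev KE : Type u := Idem S →₀ K

/-- The right action of `KS` on `KE(S)`, `e · s = s⁻¹ e s`. -/
def trivialAction : (MonoidAlgebra K S)ᵐᵒᵖ →ₐ[K] Module.End K (KE K S) :=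
  AlgHom.opComm (MonoidAlgebra.lift K _ S
    { toFun := fun s => op (Finsupp.lmapDomain K K
        (fun e : Idem S => (⟨s⁻¹ * e.1 * s, conj_idem s e.2⟩ : Idem S)))
      map_one' := by
        apply unop_injective
        ext e : 1
        ext
        simp [inv_one']
      map_mul' := fun s t => by
        apply unop_injective
        ext e : 1
        ext
        simp [mul_inv_rev', mul_assoc] })

instance trivialModule : Module (MonoidAlgebra K S)ᵐᵒᵖ (KE K S) :=
  Module.compHom (KE K S) (trivialAction K S).toRingHom

lemma trivial_op_smul_def (r : (MonoidAlgebra K S)ᵐᵒᵖ) (x : KE K S) :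
    r • x = trivialAction K S r x := rfl

lemma op_of_smul_single (s : S) (e : Idem S) :
    op (MonoidAlgebra.of K S s) • (Finsupp.single e 1 : KE K S) =
      Finsupp.single ⟨s⁻¹ * e.1 * s, conj_idem s e.2⟩ 1 := by
  rw [trivial_op_smul_def]
  simp [trivialAction]

instance : SMulCommClass K (MonoidAlgebra K S)ᵐᵒᵖ (KE K S) where
  smul_comm k r x := ((trivialAction K S r).map_smul k x).symm

/-- The homology `H_n(S, V) = Tor_n^{KS}(KE(S), V)` of `S` with values in a `KS`-module `V`. -/
def inverseMonoidHomology (n : ℕ) (V : ModuleCat.{u} (MonoidAlgebra K S)) : ModuleCat.{u} K :=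
  (torFunctor K (MonoidAlgebra K S) (KE K S) n).obj V

end InverseMonoidHomology

/-! ### The functor `F₁ = A ⊗_{A^e} -` -/

namespace UnitalAction

variable {K A S : Type u} [CommRing K] [Ring A] [Algebra K A] [InverseMonoid S]
  (α : UnitalAction K A S)

/-- The algebra homomorphism `A^e → (A ⋊_θ S)^e` induced by `A → A ⋊_θ S`. -/
def envMap : Env K A →ₐ[K] Env K α.CrossedProduct :=
  Algebra.TensorProduct.map α.ι (AlgHom.op α.ι)

/-- Restriction of scalars: an `A ⋊_θ S`-bimodule as an `A`-bimodule. -/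
abbrev restrict (M : ModuleCat.{u} (Env K α.CrossedProduct)) : ModuleCat.{u} (Env K A) :=
  (ModuleCat.restrictScalars α.envMap.toRingHom).obj M

/-- The homomorphism `S → (A ⋊_θ S)^e`, `s ↦ Γ s ⊗ Γ s⁻¹`; through it `S` acts on an
`A ⋊_θ S`-bimodule `M` by `s · x = (1ₛ δₛ) x (1_{s⁻¹} δ_{s⁻¹})`. -/
def conj : S →* Env K α.CrossedProduct where
  toFun s := α.Γ s ⊗ₜ[K] op (α.Γ s⁻¹)
  map_one' := by rw [inv_one', map_one]; rfl
  map_mul' s t := by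
    rw [Algebra.TensorProduct.tmul_mul_tmul, ← op_mul, ← map_mul, ← map_mul, mul_inv_rev']

lemma conj_mul_envMap (s : S) (a b : A) :
    α.conj s * α.envMap (a ⊗ₜ op b) = α.envMap (α.act s a ⊗ₜ op (α.act s b)) * α.conj s := by
  change (α.Γ s ⊗ₜ[K] op (α.Γ s⁻¹)) * (α.ι a ⊗ₜ[K] op (α.ι b)) =
    (α.ι (α.act s a) ⊗ₜ[K] op (α.ι (α.act s b))) * (α.Γ s ⊗ₜ[K] op (α.Γ s⁻¹))
  rw [Algebra.TensorProduct.tmul_mul_tmul, Algebra.TensorProduct.tmul_mul_tmul, ← op_mul,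
    ← op_mul, Γ_mul_ι, Γ_inv_mul_ι_act]

/-- The map `x ↦ s · x` on an `A ⋊_θ S`-bimodule `M`. -/
def conjHom (M : ModuleCat.{u} (Env K α.CrossedProduct)) (s : S) :
    α.restrict M →+ α.restrict M :=
  DistribSMul.toAddMonoidHom M (α.conj s)

lemma conjHom_apply (M : ModuleCat.{u} (Env K α.CrossedProduct)) (s : S) (x : α.restrict M) :
    α.conjHom M s x = (α.conj s • (show M from x) : M) := rfl

lemma conjHom_one (M : ModuleCat.{u} (Env K α.CrossedProduct)) (x : α.restrict M) :
    α.conjHom M 1 x = x := by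
  rw [conjHom_apply, map_one, one_smul]

lemma conjHom_mul (M : ModuleCat.{u} (Env K α.CrossedProduct)) (s t : S) (x : α.restrict M) :
    α.conjHom M (s * t) x = α.conjHom M s (α.conjHom M t x) := by
  rw [conjHom_apply, map_mul, mul_smul]; rfl

lemma conjHom_smul (M : ModuleCat.{u} (Env K α.CrossedProduct)) (s : S) (a b : A)
    (x : α.restrict M) : α.conjHom M s ((a ⊗ₜ[K] op b : Env K A) • x) =
      (α.act s a ⊗ₜ[K] op (α.act s b) : Env K A) • α.conjHom M s x := by
  have h2 : α.conj s • (α.envMap (a ⊗ₜ[K] op b) • (show M from x)) =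
      α.envMap (α.act s a ⊗ₜ[K] op (α.act s b)) • (α.conj s • (show M from x)) := by
    rw [← mul_smul, ← mul_smul, ← conj_mul_envMap]
  exact h2

/-- The underlying `K`-module of `A ⊗_{A^e} M`. -/
abbrev F₁Obj (M : ModuleCat.{u} (Env K α.CrossedProduct)) : Type u :=
  BalancedTensor K (Env K A) A (α.restrict M)

/-- The endomorphism `a ⊗ x ↦ s · a ⊗ s · x` of `A ⊗_{A^e} M`. -/
def diagMap (M : ModuleCat.{u} (Env K α.CrossedProduct)) (s : S) :
    α.F₁Obj M →ₗ[K] α.F₁Obj M :=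
  BalancedTensor.map (α.act s) (α.conjHom M s) (fun x r y => by
    induction r using TensorProduct.induction_on with
    | zero =>
      have h1 : op (0 : Env K A) • x = 0 := zero_smul (Env K A)ᵐᵒᵖ x
      have h2 : (0 : Env K A) • y = 0 := zero_smul (Env K A) y
      rw [h1, h2, map_zero, map_zero, BalancedTensor.zero_mk, BalancedTensor.mk_zero]
    | add r r' h h' =>
      rw [MulOpposite.op_add, add_smul, add_smul, map_add, map_add, BalancedTensor.add_mk,
        BalancedTensor.mk_add, h, h']
    | tmul a b =>
      rw [← op_unop b, op_tmul_smul, act_mul, act_mul, conjHom_smul, ← BalancedTensor.mk_smul,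
        op_tmul_smul])

/-- The action of `S` on `A ⊗_{A^e} M` by `s · (a ⊗ x) = s · a ⊗ s · x`. -/
def diagAction (M : ModuleCat.{u} (Env K α.CrossedProduct)) :
    S →* Module.End K (α.F₁Obj M) where
  toFun := α.diagMap M
  map_one' := BalancedTensor.hom_ext fun a x => by
    change BalancedTensor.mk K (Env K A) (α.act 1 a) (α.conjHom M 1 x) = _
    rw [map_one, conjHom_one]; rfl
  map_mul' s t := BalancedTensor.hom_ext fun a x => by
    change BalancedTensor.mk K (Env K A) (α.act (s * t) a) (α.conjHom M (s * t) x) = _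
    rw [map_mul, conjHom_mul]; rfl

instance diagModule (M : ModuleCat.{u} (Env K α.CrossedProduct)) :
    Module (MonoidAlgebra K S) (α.F₁Obj M) :=
  Module.compHom (α.F₁Obj M) (MonoidAlgebra.lift K _ S (α.diagAction M)).toRingHom

lemma diag_smul_def (M : ModuleCat.{u} (Env K α.CrossedProduct)) (r : MonoidAlgebra K S)
    (z : α.F₁Obj M) : r • z = MonoidAlgebra.lift K _ S (α.diagAction M) r z := rfl

lemma of_smul_mk (M : ModuleCat.{u} (Env K α.CrossedProduct)) (s : S) (a : A)
    (x : α.restrict M) :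
    MonoidAlgebra.of K S s • (BalancedTensor.mk K (Env K A) a x : α.F₁Obj M) =
      BalancedTensor.mk K (Env K A) (α.act s a) (α.conjHom M s x) := by
  rw [diag_smul_def, MonoidAlgebra.lift_of]; rfl

/-- The homomorphism of `A`-bimodules underlying a homomorphism of `A ⋊_θ S`-bimodules. -/
abbrev restrictMap {M N : ModuleCat.{u} (Env K α.CrossedProduct)} (f : M ⟶ N) :
    α.restrict M ⟶ α.restrict N :=
  (ModuleCat.restrictScalars α.envMap.toRingHom).map f

lemma restrictMap_conjHom {M N : ModuleCat.{u} (Env K α.CrossedProduct)} (f : M ⟶ N) (s : S)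
    (x : α.restrict M) :
    (α.restrictMap f).hom (α.conjHom M s x) = α.conjHom N s ((α.restrictMap f).hom x) :=
  f.hom.map_smul (α.conj s) (show M from x)

/-- The `K`-linear map `a ⊗ x ↦ a ⊗ f x` from `A ⊗_{A^e} M` to `A ⊗_{A^e} N` induced by a
homomorphism `f` of bimodules. -/
def F₁MapAux {M N : ModuleCat.{u} (Env K α.CrossedProduct)} (f : M ⟶ N) :
    α.F₁Obj M →ₗ[K] α.F₁Obj N :=
  ((tensorFunctor K (Env K A) A).map (α.restrictMap f)).hom

lemma F₁MapAux_mk {M N : ModuleCat.{u} (Env K α.CrossedProduct)} (f : M ⟶ N) (a : A)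
    (x : α.restrict M) : α.F₁MapAux f (BalancedTensor.mk K (Env K A) a x) =
      BalancedTensor.mk K (Env K A) a ((α.restrictMap f).hom x) := rfl

lemma F₁MapAux_of_smul {M N : ModuleCat.{u} (Env K α.CrossedProduct)} (f : M ⟶ N)
    (s : S) (z : α.F₁Obj M) :
    α.F₁MapAux f (α.diagAction M s z) = α.diagAction N s (α.F₁MapAux f z) := by
  refine LinearMap.congr_fun (f := α.F₁MapAux f ∘ₗ α.diagAction M s)
    (g := α.diagAction N s ∘ₗ α.F₁MapAux f) (BalancedTensor.hom_ext fun a x => ?_) z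
  change BalancedTensor.mk K (Env K A) (α.act s a) ((α.restrictMap f).hom (α.conjHom M s x)) =
    BalancedTensor.mk K (Env K A) (α.act s a) (α.conjHom N s ((α.restrictMap f).hom x))
  rw [restrictMap_conjHom]

lemma F₁MapAux_smul {M N : ModuleCat.{u} (Env K α.CrossedProduct)} (f : M ⟶ N)
    (r : MonoidAlgebra K S) (z : α.F₁Obj M) :
    α.F₁MapAux f (r • z) = r • α.F₁MapAux f z := by
  rw [diag_smul_def, diag_smul_def]
  induction r using MonoidAlgebra.induction_on with
  | of s => rw [MonoidAlgebra.lift_of, MonoidAlgebra.lift_of, F₁MapAux_of_smul]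
  | add r r' h h' => rw [map_add, map_add, LinearMap.add_apply, LinearMap.add_apply, map_add, h, h']
  | smul k r h =>
    rw [map_smul, map_smul, LinearMap.smul_apply, LinearMap.smul_apply, map_smul, h]

/-- The `KS`-linear map `A ⊗_{A^e} M → A ⊗_{A^e} N` induced by a homomorphism of bimodules. -/
def F₁Map {M N : ModuleCat.{u} (Env K α.CrossedProduct)} (f : M ⟶ N) :
    α.F₁Obj M →ₗ[MonoidAlgebra K S] α.F₁Obj N where
  toFun := α.F₁MapAux f
  map_add' := map_add _
  map_smul' := α.F₁MapAux_smul f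

lemma F₁Map_ext {M N : ModuleCat.{u} (Env K α.CrossedProduct)}
    {f g : α.F₁Obj M →ₗ[MonoidAlgebra K S] α.F₁Obj N}
    (h : ∀ (a : A) (x : α.restrict M),
      f (BalancedTensor.mk K (Env K A) a x) = g (BalancedTensor.mk K (Env K A) a x)) : f = g := by
  refine LinearMap.ext fun z => ?_
  induction z using BalancedTensor.induction with
  | hmk x y => exact h x y
  | hadd z w hz hw => rw [map_add, map_add, hz, hw]

/-- The functor `F₁ = A ⊗_{A^e} - : (A ⋊_θ S)^e-Mod → KS-Mod`. -/
def F₁ : ModuleCat.{u} (Env K α.CrossedProduct) ⥤ ModuleCat.{u} (MonoidAlgebra K S) where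
  obj M := ModuleCat.of (MonoidAlgebra K S) (α.F₁Obj M)
  map f := ModuleCat.ofHom (α.F₁Map f)
  map_id _ := ModuleCat.hom_ext (α.F₁Map_ext fun _ _ => rfl)
  map_comp _ _ := ModuleCat.hom_ext (α.F₁Map_ext fun _ _ => rfl)

instance : α.F₁.Additive where
  map_add {_ _ f g} := ModuleCat.hom_ext (α.F₁Map_ext fun a x =>
    BalancedTensor.mk_add K (Env K A) a ((α.restrictMap f).hom x) ((α.restrictMap g).hom x))

end UnitalAction

/-! ### First quadrant homology spectral sequences -/

/-- A first quadrant homology spectral sequence `(E^r, d^r)`, `r ≥ 2`, of `K`-modules, with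
differentials `d^r : E^r_{p,q} → E^r_{p-r,q+r-1}`. -/
abbrev FirstQuadrantHomologySS (K : Type u) [CommRing K] :=
  SpectralSequence (ModuleCat.{u} K)
    (fun r : ℤ => ComplexShape.spectralSequenceNat (⟨-r, r - 1⟩ : ℤ × ℤ)) 2

/-- Convergence `E^2_{p,q} ⇒ H_{p+q}`: every `H n` has a filtration
`0 = Φ_{-1} ⊆ Φ_0 ⊆ ⋯ ⊆ Φ_n = H n` with `Φ_p / Φ_{p-1} ≅ E^∞_{p,q}` for `p + q = n`. As no
nonzero differential enters or leaves `E^r_{p,q}` when `r > max p (q + 1)`, the limit term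
`E^∞_{p,q}` is `E^r_{p,q}` for any such `r`. -/
def FirstQuadrantHomologySS.ConvergesTo {K : Type u} [CommRing K]
    (E : FirstQuadrantHomologySS K) (H : ℕ → ModuleCat.{u} K) : Prop :=
  ∃ Φ : (n : ℕ) → ℤ → Submodule K (H n),
    (∀ n, Monotone (Φ n)) ∧
    (∀ n p, p < 0 → Φ n p = ⊥) ∧
    (∀ (n : ℕ) (p : ℤ), (n : ℤ) ≤ p → Φ n p = ⊤) ∧
    ∀ (p q : ℕ) (r : ℤ) (hr : 2 ≤ r), (p : ℤ) < r → (q : ℤ) + 1 < r →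
      Nonempty ((E.page r hr).X (p, q) ≃ₗ[K]
        (↥(Φ (p + q) p) ⧸ (Φ (p + q) (p - 1)).submoduleOf (Φ (p + q) p)))

end

/-! Write B for the crossed product. The theorem is a Grothendieck spectral sequence for a composite
functor, and it rests on three facts.

The composite is the right one (`compIso`): KE(S) ⊗_{KS} (A ⊗_{A^e} M) ≅ B ⊗_{B^e} M, naturally in
M. Both sides are quotients of M. The module A ⊗_{A^e} M is M modulo commutators with A. The right
module KE(S) is generated by 1, and 1·s = s⁻¹s = 1·(s⁻¹s), so tensoring with it identifies the
action of s with that of s⁻¹s. As `Γ e` lies in the image of A for idempotent e (`Γ_idem`), this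
imposes exactly the missing relations `Γ s` x = x `Γ s` (`compUnit_Γ`), and B is generated by the
images of A and S.

The inner functor produces acyclic modules (`isZero_tor_F₁`): if P is projective, then
Tor^{KS}(KE(S), F₁P) vanishes in positive degrees. The commutative algebra K[E(S)] is spanned by
idempotents over a field, hence von Neumann regular (`exists_mul_mul_self`), so all its modules are
flat and induction to K[S] is exact. Induction preserves projectives, and KE(S) ⊗_{KS} (K[S]
⊗_{K[E(S)]} U) ≅ U because KE(S) restricts to the regular K[E(S)]-module (`indCompIso`). Hence
induced modules are acyclic. Finally F₁P is a retract of the module induced from P, on which e acts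
by `Γ e` ⊗ 1. The retraction is s ⊗ x ↦ s·(1 ⊗ x). Its section comes from the identity 1 ⊗ x(aδ_s) =
s⁻¹·(1 ⊗ (aδ_s)x) in F₁P: the right side lifts to the induced module, the lift extends to the free
bimodule on P (`freeTensor`), and a splitting of the free bimodule over P transports it to P.

The spectral sequence exists for any right exact F and any complex C of F-acyclic R-modules
(`FreeCover.exists_spectralSequence`). A functorial resolution replaces a Cartan–Eilenberg
resolution: with ΩV the kernel of R ⊗_K V → V, each functor V ↦ R ⊗_K Ω^p V is exact because K is a
field. Its values are projective, so V ↦ F(R ⊗ Ω^p V) is exact too. Therefore the double complex F(R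
⊗ Ω^p C_q) has column homology F(R ⊗ Ω^p H_q(C)) and second page (L_pF)(H_q(C)) (`nonempty_E_iso`).
Its rows resolve F(C_q) by acyclicity, so the total complex computes the homology of F(C)
(`nonempty_homology_iso_cycles`). The theorem is the case C = F₁Q for a projective resolution Q of
M. -/

noncomputable section

open TensorProduct MulOpposite

set_option linter.unusedSectionVars false

/-! ### The spectral sequence of a filtered differential module -/

/-- The homology of a short complex of modules as a quotient of a module mapping onto the kernel
of `S.g` modulo the range of `S.f`. -/
theorem CategoryTheory.ShortComplex.nonempty_homology_iso_quotient {K : Type u} [Ring K]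
    (S : ShortComplex (ModuleCat.{u} K)) {N : Type u} [AddCommGroup N] [Module K N]
    (φ : N →ₗ[K] S.X₂) (N' : Submodule K N) (h0 : ∀ n, S.g (φ n) = 0)
    (hs : ∀ x, S.g x = 0 → ∃ n y, x = φ n + S.f y)
    (hk : ∀ n, n ∈ N' ↔ ∃ y, S.f y = φ n) :
    Nonempty (S.homology ≅ ModuleCat.of K (N ⧸ N')) := by
  let ψ : N →ₗ[K] (LinearMap.ker S.g.hom ⧸ LinearMap.range S.moduleCatToCycles) :=
    (LinearMap.range S.moduleCatToCycles).mkQ ∘ₗ φ.codRestrict (LinearMap.ker S.g.hom) h0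
  have hψ : Function.Surjective ψ := by
    intro z
    obtain ⟨⟨x, hx⟩, rfl⟩ := Submodule.Quotient.mk_surjective _ z
    obtain ⟨n, y, rfl⟩ := hs x hx
    refine ⟨n, (Submodule.Quotient.eq _).2 ⟨-y, Subtype.ext ?_⟩⟩
    change S.f.hom (-y) = φ n - (φ n + S.f.hom y)
    rw [map_neg]; abel
  have hker : LinearMap.ker ψ = N' := by
    ext n
    rw [LinearMap.mem_ker, hk]
    refine (Submodule.Quotient.mk_eq_zero _).trans ⟨fun ⟨y, hy⟩ => ⟨y, congrArg Subtype.val hy⟩,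
      fun ⟨y, hy⟩ => ⟨y, Subtype.ext hy⟩⟩
  exact ⟨S.moduleCatHomologyIso ≪≫ ((Submodule.quotEquivOfEq _ _ hker.symm).trans
    (ψ.quotKerEquivOfSurjective hψ)).symm.toModuleIso⟩

/-- A module `T` with a differential `d` and submodules `fil p n` (the part of filtration `≤ p` in
degree `n`), lying in the first quadrant: `fil p n` vanishes for `p < 0` and is the whole degree
`n` part for `n ≤ p`. -/
structure FilteredDifferential (K : Type u) [CommRing K] (T : Type u) [AddCommGroup T]
    [Module K T] where
  d : T →ₗ[K] T
  d_d : ∀ x, d (d x) = 0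
  fil : ℤ → ℤ → Submodule K T
  mono : ∀ {p p' : ℤ} (n : ℤ), p ≤ p' → fil p n ≤ fil p' n
  d_mem : ∀ {p n : ℤ} {x : T}, x ∈ fil p n → d x ∈ fil p (n - 1)
  neg : ∀ {p : ℤ} (n : ℤ), p < 0 → fil p n = ⊥
  top : ∀ {p n : ℤ}, n ≤ p → fil p n = fil n n

namespace FilteredDifferential

variable {K : Type u} [CommRing K] {T : Type u} [AddCommGroup T] [Module K T]
  (D : FilteredDifferential K T)

/-- The elements of `fil p n` whose differential lies in `fil (p - r) (n - 1)`. -/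
def Z (r p n : ℤ) : Submodule K T := D.fil p n ⊓ (D.fil (p - r) (n - 1)).comap D.d

/-- The boundaries on the `r`-th page. -/
def B (r p n : ℤ) : Submodule K T :=
  D.Z (r - 1) (p - 1) n ⊔ (D.Z (r - 1) (p + r - 1) (n + 1)).map D.d

lemma mem_B {r p n : ℤ} {x : T} : x ∈ D.B r p n ↔
    ∃ y ∈ D.Z (r - 1) (p - 1) n, ∃ z ∈ D.Z (r - 1) (p + r - 1) (n + 1), x = y + D.d z := by
  rw [B, Submodule.mem_sup]
  constructor
  · rintro ⟨y, hy, _, ⟨z, hz, rfl⟩, rfl⟩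
    exact ⟨y, hy, z, hz, rfl⟩
  · rintro ⟨y, hy, z, hz, rfl⟩
    exact ⟨y, hy, _, ⟨z, hz, rfl⟩, rfl⟩

lemma Z_le_Z {r r' p p' : ℤ} (n : ℤ) (h : p' ≤ p) (h' : p' - r' ≤ p - r) :
    D.Z r' p' n ≤ D.Z r p n :=
  fun _ hx => ⟨D.mono n h hx.1, D.mono (n - 1) h' hx.2⟩

lemma eq_zero_of_mem_fil {p n : ℤ} (hp : p < 0) {x : T} (hx : x ∈ D.fil p n) : x = 0 := by
  rwa [D.neg n hp, Submodule.mem_bot] at hx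

/-- The filtration of degree `n` is stationary from `n` on, so even a smaller `p'` is allowed as
long as it is at least `n`. -/
lemma mem_fil_of_le {p p' n : ℤ} (hp : n ≤ p') {x : T} (hx : x ∈ D.fil p n) :
    x ∈ D.fil p' n := by
  rcases le_total p p' with h | h
  · exact D.mono n h hx
  · rwa [D.top hp, ← D.top (hp.trans h)]

/-- The term of filtration `p` and degree `n` on the `r`-th page. -/
abbrev E (r p n : ℤ) : Type u := ↥(D.Z r p n) ⧸ (D.B r p n).submoduleOf (D.Z r p n)

/-- The class of an element of `Z r p n` on the `r`-th page. -/
def E.mk (r p n : ℤ) : ↥(D.Z r p n) →ₗ[K] D.E r p n := Submodule.mkQ _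

lemma d_mem_Z {r p n p' n' : ℤ} (hp : p - r = p') (hn : n - 1 = n') {x : T}
    (hx : x ∈ D.Z r p n) : D.d x ∈ D.Z r p' n' := by
  subst hp hn
  refine ⟨hx.2, ?_⟩
  change D.d (D.d x) ∈ D.fil _ _
  rw [D.d_d]
  exact zero_mem _

lemma d_mem_B {r p n p' n' : ℤ} (hp : p - r = p') (hn : n - 1 = n') {x : T}
    (hx : x ∈ D.B r p n) : D.d x ∈ D.B r p' n' := by
  obtain ⟨y, hy, z, hz, rfl⟩ := D.mem_B.1 hx
  rw [map_add, D.d_d, add_zero]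
  refine Submodule.mem_sup_right ⟨y, ?_, rfl⟩
  subst hp hn
  rw [show p - r + r - 1 = p - 1 by ring, show n - 1 + 1 = n by ring]
  exact hy

/-- The differential of the `r`-th page. -/
def dE (r : ℤ) {p n p' n' : ℤ} (hp : p - r = p') (hn : n - 1 = n') :
    D.E r p n →ₗ[K] D.E r p' n' :=
  Submodule.mapQ _ _ (D.d.restrict fun _ hx => D.d_mem_Z hp hn hx)
    fun _ hx => D.d_mem_B hp hn hx

lemma dE_mk (r : ℤ) {p n p' n' : ℤ} (hp : p - r = p') (hn : n - 1 = n') (x : D.Z r p n) :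
    D.dE r hp hn (E.mk D r p n x) = E.mk D r p' n' ⟨D.d x, D.d_mem_Z hp hn x.2⟩ := rfl

lemma dE_dE (r : ℤ) {p n p' n' p'' n'' : ℤ} (hp : p - r = p') (hn : n - 1 = n')
    (hp' : p' - r = p'') (hn' : n' - 1 = n'') (x : D.E r p n) :
    D.dE r hp' hn' (D.dE r hp hn x) = 0 := by
  obtain ⟨x, rfl⟩ := Submodule.Quotient.mk_surjective _ x
  change D.dE r hp' hn' (D.dE r hp hn (E.mk D r p n x)) = 0
  rw [dE_mk, dE_mk]
  have h : (⟨D.d (D.d x), D.d_mem_Z hp' hn' (D.d_mem_Z hp hn x.2)⟩ : D.Z r p'' n'') = 0 :=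
    Subtype.ext (D.d_d x)
  exact (congrArg _ h).trans (map_zero _)

lemma mk_eq_zero_iff {r p n : ℤ} (x : D.Z r p n) : E.mk D r p n x = 0 ↔ (x : T) ∈ D.B r p n :=
  Submodule.Quotient.mk_eq_zero _

lemma mk_eq_mk_iff {r p n : ℤ} (x y : D.Z r p n) :
    E.mk D r p n x = E.mk D r p n y ↔ (x : T) - y ∈ D.B r p n :=
  Submodule.Quotient.eq _

/-- The `r`-th page. -/
def page (r : ℤ) : HomologicalComplex (ModuleCat.{u} K)
    (ComplexShape.spectralSequenceNat (⟨-r, r - 1⟩ : ℤ × ℤ)) :=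
  open scoped Classical in
  { X := fun pq => ModuleCat.of K (D.E r pq.1 (pq.1 + pq.2))
    d := fun a b => if h : (ComplexShape.spectralSequenceNat (⟨-r, r - 1⟩ : ℤ × ℤ)).Rel a b then
      ModuleCat.ofHom (D.dE r (by have := h.1; lia) (by have := h.1; have := h.2; lia)) else 0
    shape := fun a b h => dif_neg h
    d_comp_d' := fun a b c hab hbc => by
      rw [dif_pos hab, dif_pos hbc]
      exact ModuleCat.hom_ext (LinearMap.ext fun x => D.dE_dE r
        (by have := hab.1; lia) (by have := hab.1; have := hab.2; lia)
        (by have := hbc.1; lia) (by have := hbc.1; have := hbc.2; lia) x) }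

lemma page_d {r : ℤ} {a b : ℕ × ℕ}
    (h : (ComplexShape.spectralSequenceNat (⟨-r, r - 1⟩ : ℤ × ℤ)).Rel a b) :
    (D.page r).d a b =
      ModuleCat.ofHom (D.dE r (by have := h.1; lia) (by have := h.1; have := h.2; lia)) :=
  dif_pos h

lemma page_d_mk {r : ℤ} {a b : ℕ × ℕ}
    (h : (ComplexShape.spectralSequenceNat (⟨-r, r - 1⟩ : ℤ × ℤ)).Rel a b)
    (x : D.Z r a.1 (a.1 + a.2)) :
    (D.page r).d a b (E.mk D r a.1 (a.1 + a.2) x) =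
      E.mk D r b.1 (b.1 + b.2) ⟨D.d x, D.d_mem_Z (by have := h.1; lia)
        (by have := h.1; have := h.2; lia) x.2⟩ := by
  rw [page_d D h]; rfl

/-- A class killed by d^r has a representative in Z^{r+1}. If d x = u + d v as in the definition of
the boundaries, then v is itself a boundary on page r, and x - v has differential u, one filtration
step deeper. -/
lemma mem_Z_succ {r p n p' n' : ℤ} (hp : p - r = p') (hn : n - 1 = n') {x : T}
    (hx : x ∈ D.Z r p n) (hd : D.d x ∈ D.B r p' n') :
    ∃ y ∈ D.Z (r + 1) p n, x - y ∈ D.B r p n := by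
  obtain ⟨u, hu, v, hv, h⟩ := D.mem_B.1 hd
  subst hp hn
  rw [show p - r + r - 1 = p - 1 by ring, show n - 1 + 1 = n by ring] at hv
  refine ⟨x - v, ⟨sub_mem hx.1 (D.mono n (by lia) hv.1), ?_⟩, ?_⟩
  · change D.d (x - v) ∈ D.fil _ _
    rw [map_sub, h, add_sub_cancel_right]
    exact D.mono _ (by lia) hu.1
  · rw [sub_sub_cancel]
    exact Submodule.mem_sup_left hv

/-- Within Z^{r+1}, the boundaries of the next page are those of the present page together with the
image of d^r. -/
lemma mem_B_succ_iff {r p n : ℤ} {x : T} (hx : x ∈ D.Z (r + 1) p n) :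
    x ∈ D.B (r + 1) p n ↔ ∃ y ∈ D.Z r (p + r) (n + 1), x - D.d y ∈ D.B r p n := by
  constructor
  · intro h
    obtain ⟨u, hu, v, hv, rfl⟩ := D.mem_B.1 h
    refine ⟨v, D.Z_le_Z _ (by lia) (by lia) hv, ?_⟩
    rw [add_sub_cancel_right]
    exact Submodule.mem_sup_left (D.Z_le_Z _ (by lia) (by lia) hu)
  · rintro ⟨y, hy, h⟩
    obtain ⟨u, hu, v, hv, h⟩ := D.mem_B.1 h
    rw [sub_eq_iff_eq_add] at h
    -- A priori d u only has filtration p - r; being equal to d x, it has filtration p - r - 1,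
    -- which is what membership of u in the next page's boundaries requires.
    have h1 : D.d u = D.d x := by
      rw [h, map_add, map_add, D.d_d, D.d_d, add_zero, add_zero]
    refine D.mem_B.2 ⟨u, ⟨hu.1, ?_⟩, y + v, add_mem ?_ ⟨D.mono _ (by lia) hv.1, ?_⟩, ?_⟩
    · change D.d u ∈ D.fil _ _
      rw [h1]
      exact D.mono _ (by lia) hx.2
    · exact D.Z_le_Z _ (by lia) (by lia) hy
    · exact D.mono _ (by lia) hv.2
    · rw [h, map_add]; abel

/-- The target of d^r lies left of the first quadrant, where the filtration is zero, so the
differential of x vanishes. -/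
lemma Z_succ_eq_of_neg {r p n : ℤ} (h : p - r < 0) {x : T} (hx : x ∈ D.Z r p n) :
    x ∈ D.Z (r + 1) p n := by
  refine ⟨hx.1, ?_⟩
  have h1 := D.eq_zero_of_mem_fil h hx.2
  change D.d x ∈ D.fil _ _
  rw [h1]
  exact zero_mem _

/-- The source of d^r would lie below the first quadrant: in degree n + 1 the filtration is already
stationary at p + r - 1, so level p + r contributes no new boundaries. -/
lemma mem_B_succ_iff_of_le {r p n : ℤ} (h : n + 2 ≤ p + r) {x : T} (hx : x ∈ D.Z (r + 1) p n) :
    x ∈ D.B (r + 1) p n ↔ x ∈ D.B r p n := by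
  rw [D.mem_B_succ_iff hx]
  constructor
  · rintro ⟨y, hy, h'⟩
    rw [← sub_add_cancel x (D.d y)]
    refine add_mem h' (Submodule.mem_sup_right ⟨y, ⟨D.mem_fil_of_le (by lia) hy.1, ?_⟩, rfl⟩)
    exact D.mono _ (by lia) hy.2
  · intro h'
    exact ⟨0, zero_mem _, by rwa [map_zero, sub_zero]⟩

/-- The kernel of d^r is represented by Z^{r+1}. If the target leaves the first quadrant, the
differential is zero by shape, and Z^r already equals Z^{r+1}. -/
lemma page_d_next_mk (r : ℤ) (hr : 2 ≤ r) (a : ℕ × ℕ) (x : D.Z r a.1 (a.1 + a.2)) :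
    (D.page r).d a ((ComplexShape.spectralSequenceNat (⟨-r, r - 1⟩ : ℤ × ℤ)).next a)
      (E.mk D r a.1 (a.1 + a.2) x) = 0 ↔
        ∃ y ∈ D.Z (r + 1) a.1 (a.1 + a.2), (x : T) - y ∈ D.B r a.1 (a.1 + a.2) := by
  by_cases h : r ≤ a.1
  · have hrel : (ComplexShape.spectralSequenceNat (⟨-r, r - 1⟩ : ℤ × ℤ)).Rel a
        ((a.1 - r).toNat, (a.2 + r - 1).toNat) := ⟨by dsimp only; lia, by dsimp only; lia⟩
    have hp : (a.1 : ℤ) - r = ((a.1 - r).toNat : ℕ) := by lia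
    have hn : (a.1 + a.2 : ℤ) - 1 = ((a.1 - r).toNat : ℕ) + ((a.2 + r - 1).toNat : ℕ) := by lia
    rw [ComplexShape.next_eq' _ hrel, page_d_mk D hrel]
    refine (D.mk_eq_zero_iff _).trans ⟨fun h' => D.mem_Z_succ hp hn x.2 h', ?_⟩
    rintro ⟨y, hy, hxy⟩
    change D.d x ∈ D.B _ _ _
    rw [← sub_add_cancel (x : T) y, map_add]
    refine add_mem (D.d_mem_B hp hn hxy) (Submodule.mem_sup_left ⟨?_, ?_⟩)
    · exact D.mono _ (by lia) (hn ▸ hy.2)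
    · change D.d (D.d y) ∈ D.fil _ _
      rw [D.d_d]
      exact zero_mem _
  · rw [(D.page r).shape]
    · exact ⟨fun _ => ⟨x, D.Z_succ_eq_of_neg (by lia) x.2, by rw [sub_self]; exact zero_mem _⟩,
        fun _ => rfl⟩
    · intro hrel
      have h1 := hrel.1
      dsimp only at h1
      lia

/-- The image of d^r is B^{r+1} modulo B^r. If the source leaves the first quadrant, the
differential is zero by shape, and the two boundary modules agree on Z^{r+1}. -/
lemma page_d_prev (r : ℤ) (hr : 2 ≤ r) (a : ℕ × ℕ) (x : D.Z r a.1 (a.1 + a.2))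
    (hx : (x : T) ∈ D.Z (r + 1) a.1 (a.1 + a.2)) :
    (x : T) ∈ D.B (r + 1) a.1 (a.1 + a.2) ↔
      ∃ y, (D.page r).d ((ComplexShape.spectralSequenceNat (⟨-r, r - 1⟩ : ℤ × ℤ)).prev a) a y =
        E.mk D r a.1 (a.1 + a.2) x := by
  by_cases h : r ≤ a.2 + 1 ∧ 0 ≤ a.1 + r
  · have hrel : (ComplexShape.spectralSequenceNat (⟨-r, r - 1⟩ : ℤ × ℤ)).Rel
        ((a.1 + r).toNat, (a.2 + 1 - r).toNat) a := ⟨by dsimp only; lia, by dsimp only; lia⟩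
    have hp : (a.1 : ℤ) + r = ((a.1 + r).toNat : ℕ) := by lia
    have hn : (a.1 + a.2 : ℤ) + 1 = ((a.1 + r).toNat : ℕ) + ((a.2 + 1 - r).toNat : ℕ) := by lia
    rw [ComplexShape.prev_eq' _ hrel, D.mem_B_succ_iff hx]
    constructor
    · rintro ⟨y, hy, h'⟩
      rw [hp, hn] at hy
      refine ⟨E.mk D r _ _ ⟨y, hy⟩, ?_⟩
      refine (page_d_mk D hrel _).trans ((D.mk_eq_mk_iff _ _).2 ?_)
      rw [← neg_mem_iff, neg_sub]
      exact h'
    · rintro ⟨y, hy⟩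
      obtain ⟨y, rfl⟩ := Submodule.Quotient.mk_surjective _ y
      have hy' := (D.mk_eq_mk_iff _ _).1 ((page_d_mk D hrel y).symm.trans hy)
      rw [← neg_mem_iff, neg_sub] at hy'
      obtain ⟨y, hy0⟩ := y
      refine ⟨y, ?_, hy'⟩
      rw [hp, hn]
      exact hy0
  · rw [(D.page r).shape]
    · rw [D.mem_B_succ_iff_of_le (by lia) hx, ← mk_eq_zero_iff]
      exact ⟨fun h' => ⟨0, h'.symm⟩, fun ⟨_, h'⟩ => h'.symm⟩
    · intro hrel
      have h1 := hrel.1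
      have h2 := hrel.2
      dsimp only at h1 h2
      lia

/-- The inclusion of Z^{r+1} in Z^r induces a surjection onto the homology of page r, and the
elements it kills are those of B^{r+1}. -/
lemma nonempty_page_homology_iso (r : ℤ) (hr : 2 ≤ r) (a : ℕ × ℕ) :
    Nonempty ((D.page r).homology a ≅ (D.page (r + 1)).X a) := by
  have hle : D.Z (r + 1) a.1 (a.1 + a.2) ≤ D.Z r a.1 (a.1 + a.2) := D.Z_le_Z _ le_rfl (by lia)
  refine ShortComplex.nonempty_homology_iso_quotient ((D.page r).sc a)
    (E.mk D r a.1 (a.1 + a.2) ∘ₗ Submodule.inclusion hle) _ ?_ ?_ ?_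
  · intro x
    refine (D.page_d_next_mk r hr a (Submodule.inclusion hle x)).2 ⟨x, x.2, ?_⟩
    rw [Submodule.coe_inclusion, sub_self]
    exact zero_mem _
  · intro x hx
    obtain ⟨x, rfl⟩ := Submodule.Quotient.mk_surjective _ x
    obtain ⟨y, hy, h⟩ := (D.page_d_next_mk r hr a x).1 hx
    refine ⟨⟨y, hy⟩, 0, ?_⟩
    rw [map_zero, add_zero]
    exact (D.mk_eq_mk_iff x (Submodule.inclusion hle ⟨y, hy⟩)).2 h
  · intro x
    exact D.page_d_prev r hr a (Submodule.inclusion hle x) x.2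

/-- The spectral sequence of a filtered differential module. -/
def spectralSequence : FirstQuadrantHomologySS K where
  page r _ := D.page r
  iso r r' a hrr' hr := by
    subst hrr'
    exact (D.nonempty_page_homology_iso r hr a).some

/-- For such r the conditions in the boundaries no longer involve r: the first summand has
differential in negative filtration, so it consists of cycles, and the second ranges over all of
degree n + 1. -/
lemma mem_B_iff_of_lt {p n r : ℤ} (hp : p < r) (hn : n + 2 ≤ p + r) {x : T} :
    x ∈ D.B r p n ↔ ∃ y ∈ D.fil (p - 1) n, D.d y = 0 ∧
      ∃ z ∈ D.fil (n + 1) (n + 1), D.d z ∈ D.fil p n ∧ x = y + D.d z := by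
  have h1 : p + r - 1 - (r - 1) = p := by ring
  rw [mem_B]
  constructor
  · rintro ⟨y, hy, z, hz, rfl⟩
    refine ⟨y, hy.1, D.eq_zero_of_mem_fil (by lia) hy.2, z, D.mem_fil_of_le le_rfl hz.1, ?_, rfl⟩
    have h := hz.2
    rwa [h1, add_sub_cancel_right] at h
  · rintro ⟨y, hy, hy', z, hz, hz', rfl⟩
    refine ⟨y, ⟨hy, ?_⟩, z, ⟨D.mem_fil_of_le (by lia) hz, ?_⟩, rfl⟩
    · change D.d y ∈ D.fil _ _
      rw [hy']
      exact zero_mem _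
    · change D.d z ∈ D.fil _ _
      rwa [h1, add_sub_cancel_right]

/-! ### Limit terms and convergence. -/

/-- The cycles of filtration `≤ p` in degree `n`. -/
def cycles (p n : ℤ) : Submodule K T := D.fil p n ⊓ LinearMap.ker D.d

/-- The filtration on the homology in degree `n` by the images of the cycles. -/
def homologyFil {n : ℤ} {H : Type u} [AddCommGroup H] [Module K H] (ψ : D.cycles n n →ₗ[K] H)
    (p : ℤ) : Submodule K H :=
  ((D.cycles p n).submoduleOf (D.cycles n n)).map ψ

/-- In the stable range Z^r consists of the cycles of filtration p, which map onto the p-th step of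
the filtration of homology; those landing in the step below differ from a cycle of filtration p - 1
by a boundary. The index `n'` absorbs the cast of p + q, which would otherwise have to be rewritten
inside types. -/
lemma nonempty_E_equiv {n n' p r : ℤ} (hn' : n = n') (hp : p < r) (hn : n + 2 ≤ p + r) (hpn : p ≤ n) {H : Type u}
    [AddCommGroup H] [Module K H] (ψ : D.cycles n n →ₗ[K] H)
    (hk : ∀ x, ψ x = 0 ↔ ∃ y ∈ D.fil (n + 1) (n + 1), D.d y = x) :
    Nonempty (D.E r p n' ≃ₗ[K] (↥(D.homologyFil ψ p) ⧸
      (D.homologyFil ψ (p - 1)).submoduleOf (D.homologyFil ψ p))) := by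
  subst hn'
  have hZ : ∀ {x}, x ∈ D.Z r p n → x ∈ D.cycles p n :=
    fun hx => ⟨hx.1, D.eq_zero_of_mem_fil (by lia) hx.2⟩
  have hle : D.cycles p n ≤ D.cycles n n := inf_le_inf_right _ (D.mono _ hpn)
  let f : D.Z r p n →ₗ[K] D.homologyFil ψ p :=
    (ψ ∘ₗ Submodule.inclusion (fun _ hx => hle (hZ hx))).codRestrict _
      fun x => ⟨_, hZ x.2, rfl⟩
  have hf : ∀ x : D.Z r p n, (f x : H) = ψ ⟨x, hle (hZ x.2)⟩ := fun x => rfl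
  let g := ((D.homologyFil ψ (p - 1)).submoduleOf (D.homologyFil ψ p)).mkQ ∘ₗ f
  have hg : Function.Surjective g := by
    intro z
    obtain ⟨⟨_, x, hx, rfl⟩, rfl⟩ := Submodule.Quotient.mk_surjective _ z
    refine ⟨⟨x, hx.1, ?_⟩, rfl⟩
    change D.d x ∈ D.fil _ _
    rw [show D.d x = 0 from hx.2]
    exact zero_mem _
  have hker : LinearMap.ker g = (D.B r p n).submoduleOf (D.Z r p n) := by
    ext x
    rw [LinearMap.mem_ker]
    refine (Submodule.Quotient.mk_eq_zero _).trans ?_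
    change (f x : H) ∈ D.homologyFil ψ (p - 1) ↔ (x : T) ∈ D.B r p n
    rw [hf, D.mem_B_iff_of_lt hp hn]
    constructor
    · rintro ⟨y, hy, h⟩
      rw [← sub_eq_zero, ← map_sub, hk] at h
      obtain ⟨z, hz, h⟩ := h
      have h' : D.d z = y - x := h
      refine ⟨y, hy.1, hy.2, -z, neg_mem hz, ?_, ?_⟩
      · rw [map_neg, h', neg_sub]
        exact sub_mem (hZ x.2).1 (D.mono _ (by lia) hy.1)
      · rw [map_neg, h']; abel
    · rintro ⟨y, hy, hy', z, hz, hz', h⟩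
      refine ⟨⟨y, D.mono _ (by lia) hy, hy'⟩, ⟨hy, hy'⟩, ?_⟩
      rw [← sub_eq_zero, ← map_sub, hk]
      refine ⟨-z, neg_mem hz, ?_⟩
      change D.d (-z) = y - x
      rw [h, map_neg]; abel
  exact ⟨(Submodule.quotEquivOfEq _ _ hker.symm).trans (g.quotKerEquivOfSurjective hg)⟩

/-- The spectral sequence of a filtered differential module converges to its homology. -/
theorem convergesTo (H : ℕ → ModuleCat.{u} K) (ψ : ∀ n : ℕ, D.cycles n n →ₗ[K] H n)
    (hs : ∀ n, Function.Surjective (ψ n))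
    (hk : ∀ n x, ψ n x = 0 ↔ ∃ y ∈ D.fil (n + 1) (n + 1), D.d y = x) :
    D.spectralSequence.ConvergesTo H := by
  refine ⟨fun n => D.homologyFil (ψ n), ?_, ?_, ?_, ?_⟩
  · intro n p p' h
    exact Submodule.map_mono (Submodule.comap_mono (inf_le_inf_right _ (D.mono n h)))
  · intro n p hp
    rw [eq_bot_iff]
    rintro _ ⟨x, hx, rfl⟩
    have h : x = 0 := Subtype.ext (D.eq_zero_of_mem_fil hp hx.1)
    rw [h, map_zero]
    exact zero_mem _
  · intro n p hp
    rw [eq_top_iff]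
    rintro h -
    obtain ⟨x, rfl⟩ := hs n h
    exact ⟨x, ⟨D.mono n hp x.2.1, x.2.2⟩, rfl⟩
  · intro p q r _ hp hq
    exact D.nonempty_E_equiv (Nat.cast_add p q) hp (by push_cast; lia) (by push_cast; lia)
      (ψ (p + q)) (hk (p + q))

end FilteredDifferential

/-! ### First quadrant double complexes -/

lemma ChainComplex.exists_d_prev_iff {K : Type u} [Ring K] (W : ChainComplex (ModuleCat.{u} K) ℕ)
    (n : ℕ) (x : W.X n) : (∃ y, W.d ((ComplexShape.down ℕ).prev n) n y = x) ↔
      ∃ y, W.d (n + 1) n y = x := by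
  rw [ChainComplex.prev]

lemma ChainComplex.d_next_zero {K : Type u} [Ring K] (W : ChainComplex (ModuleCat.{u} K) ℕ)
    (x : W.X 0) : W.d 0 ((ComplexShape.down ℕ).next 0) x = 0 := by
  rw [W.shape _ _ (by simp)]; rfl

lemma ChainComplex.d_next_succ_eq_zero_iff {K : Type u} [Ring K]
    (W : ChainComplex (ModuleCat.{u} K) ℕ) (n : ℕ) (x : W.X (n + 1)) :
    W.d (n + 1) ((ComplexShape.down ℕ).next (n + 1)) x = 0 ↔ W.d (n + 1) n x = 0 := by
  rw [ChainComplex.next_nat_succ]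

/-- A first quadrant double complex of modules with commuting squares. -/
structure DoubleComplex (K : Type u) [CommRing K] where
  X : ℕ → ℕ → ModuleCat.{u} K
  h : ∀ p q, X (p + 1) q →ₗ[K] X p q
  v : ∀ p q, X p (q + 1) →ₗ[K] X p q
  h_h : ∀ p q x, h p q (h (p + 1) q x) = 0
  v_v : ∀ p q x, v p q (v p (q + 1) x) = 0
  h_v : ∀ p q x, h p q (v (p + 1) q x) = v p q (h p (q + 1) x)

namespace DoubleComplex

variable {K : Type u} [CommRing K] (D : DoubleComplex K)

/-- The product of all terms of a double complex. -/
abbrev Total : Type u := ∀ p q, D.X p q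

/-- The total differential. -/
def d : D.Total →ₗ[K] D.Total where
  toFun x p q := D.h p q (x (p + 1) q) + (p : ℤ).negOnePow • D.v p q (x p (q + 1))
  map_add' x y := by
    ext p q
    simp only [Pi.add_apply, map_add, smul_add]
    abel
  map_smul' k x := by
    ext p q
    simp only [Pi.smul_apply, map_smul, smul_add, RingHom.id_apply, smul_comm k]

lemma d_apply (x : D.Total) (p q : ℕ) :
    D.d x p q = D.h p q (x (p + 1) q) + (p : ℤ).negOnePow • D.v p q (x p (q + 1)) := rfl

lemma map_negOnePow_smul {M N : Type*} [AddCommGroup M] [AddCommGroup N] [Module K M] [Module K N]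
    (f : M →ₗ[K] N) (p : ℤ) (x : M) : f (p.negOnePow • x) = p.negOnePow • f x := by
  rw [Units.smul_def, Units.smul_def, map_zsmul]

lemma negOnePow_smul_negOnePow_smul {M : Type*} [AddCommGroup M] (p : ℤ) (x : M) :
    p.negOnePow • p.negOnePow • x = x := by
  rw [smul_smul, Int.units_mul_self, one_smul]

lemma d_d (x : D.Total) : D.d (D.d x) = 0 := by
  ext p q
  simp only [d_apply, map_add, map_negOnePow_smul, D.h_h, D.v_v, smul_zero, zero_add,
    add_zero, Pi.zero_apply, Nat.cast_add, Nat.cast_one, Int.negOnePow_succ, Units.neg_smul,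
    map_neg, D.h_v, neg_add_cancel]

/-- The elements of degree `n` with vanishing components in the columns after the `p`-th one. -/
def fil (p n : ℤ) : Submodule K D.Total where
  carrier := {x | ∀ i j : ℕ, ¬ ((i : ℤ) + j = n ∧ (i : ℤ) ≤ p) → x i j = 0}
  add_mem' := fun hx hy i j hij => by rw [Pi.add_apply, Pi.add_apply, hx i j hij, hy i j hij, add_zero]
  zero_mem' := fun _ _ _ => rfl
  smul_mem' := fun k x hx i j hij => by rw [Pi.smul_apply, Pi.smul_apply, hx i j hij, smul_zero]

lemma mem_fil {p n : ℤ} {x : D.Total} :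
    x ∈ D.fil p n ↔ ∀ i j : ℕ, ¬ ((i : ℤ) + j = n ∧ (i : ℤ) ≤ p) → x i j = 0 := Iff.rfl

/-- The total complex filtered by columns. -/
def filtered : FilteredDifferential K D.Total where
  d := D.d
  d_d := D.d_d
  fil := D.fil
  mono n h x hx i j hij := hx i j fun h' => hij ⟨h'.1, h'.2.trans h⟩
  d_mem {p n x} hx i j hij := by
    rw [d_apply, hx (i + 1) j fun h => hij (by lia), hx i (j + 1) fun h => hij (by lia), map_zero,
      map_zero, smul_zero, add_zero]
  neg n hp := by
    refine (Submodule.eq_bot_iff _).2 fun x hx => ?_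
    ext i j
    exact hx i j (by lia)
  top {p n} hn := by
    ext x
    rw [mem_fil, mem_fil]
    exact forall_congr' fun i => forall_congr' fun j => by
      rw [show ((i : ℤ) + j = n ∧ (i : ℤ) ≤ p) ↔ ((i : ℤ) + j = n ∧ (i : ℤ) ≤ n) by lia]

lemma mem_fil_of_column {p p' n : ℤ} {x : D.Total} (hx : x ∈ D.fil p n)
    (h : ∀ i j : ℕ, p' < i → x i j = 0) : x ∈ D.fil p' n := by
  intro i j hij
  by_cases hi : (i : ℤ) ≤ p'
  · exact hx i j fun h => hij ⟨h.1, hi⟩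
  · exact h i j (by lia)

lemma d_mem_fil {p n : ℤ} {x : D.Total} (hx : x ∈ D.fil p n) : D.d x ∈ D.fil p (n - 1) :=
  D.filtered.d_mem hx

/-- The element of the total complex with a single component. -/
def inc (p q : ℕ) : D.X p q →ₗ[K] D.Total :=
  LinearMap.single K (fun p => ∀ q, D.X p q) p ∘ₗ LinearMap.single K (fun q => D.X p q) q

lemma inc_self (p q : ℕ) (c : D.X p q) : D.inc p q c p q = c := by
  change (Pi.single p (Pi.single q c) : D.Total) p q = c
  rw [Pi.single_eq_same, Pi.single_eq_same]

lemma inc_of_ne {p q i j : ℕ} (c : D.X p q) (h : ¬ (i = p ∧ j = q)) : D.inc p q c i j = 0 := by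
  change (Pi.single p (Pi.single q c) : D.Total) i j = 0
  by_cases hi : i = p
  · subst hi
    rw [Pi.single_eq_same, Pi.single_eq_of_ne fun hj => h ⟨rfl, hj⟩]
  · rw [Pi.single_eq_of_ne hi]; rfl

lemma inc_mem_fil (p q : ℕ) (c : D.X p q) {P n : ℤ} (hp : p ≤ P) (hn : (p : ℤ) + q = n) :
    D.inc p q c ∈ D.fil P n :=
  fun _ _ hij => D.inc_of_ne c (by lia)

/-- The vertical cycles. -/
def IsCycle (p : ℕ) : ∀ q, D.X p q → Prop
  | 0, _ => True
  | q + 1, x => D.v p q x = 0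

variable {D}

lemma IsCycle.h {p q : ℕ} {x : D.X (p + 1) q} (hx : D.IsCycle (p + 1) q x) :
    D.IsCycle p q (D.h p q x) := by
  cases q with
  | zero => trivial
  | succ q =>
    change D.v p q _ = 0
    rw [← D.h_v, show D.v (p + 1) q x = 0 from hx, map_zero]

lemma IsCycle.d_inc {p q : ℕ} {x : D.X p q} (hx : D.IsCycle p q x) {i j : ℕ} (h : i + 1 ≠ p) :
    D.d (D.inc p q x) i j = 0 := by
  rw [d_apply, D.inc_of_ne x (by lia), map_zero, zero_add]
  by_cases hij : i = p ∧ j + 1 = q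
  · obtain ⟨rfl, rfl⟩ := hij
    rw [inc_self, show D.v i j x = 0 from hx, smul_zero]
  · rw [D.inc_of_ne x hij, map_zero, smul_zero]

lemma IsCycle.d_inc_succ {p q : ℕ} {x : D.X (p + 1) q} (hx : D.IsCycle (p + 1) q x) :
    D.d (D.inc (p + 1) q x) = D.inc p q (D.h p q x) := by
  ext i j
  by_cases hi : i = p
  · subst hi
    rw [d_apply, D.inc_of_ne (i := i) (j := j + 1) x (by lia), map_zero, smul_zero, add_zero]
    by_cases hj : j = q
    · subst hj
      rw [inc_self, inc_self]
    · rw [D.inc_of_ne x (by lia), D.inc_of_ne _ (by lia), map_zero]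
  · rw [hx.d_inc (by lia), D.inc_of_ne _ (by lia)]

lemma d_inc_of_ne {p q : ℕ} (w : D.X p (q + 1)) {i j : ℕ} (hi : i + 1 ≠ p) :
    D.d (D.inc p (q + 1) w) i j = (p : ℤ).negOnePow • D.inc p q (D.v p q w) i j := by
  rw [d_apply, D.inc_of_ne w (by lia), map_zero, zero_add]
  by_cases hij : i = p ∧ j = q
  · obtain ⟨rfl, rfl⟩ := hij
    rw [inc_self, inc_self]
  · rw [D.inc_of_ne w (by lia), D.inc_of_ne _ hij, map_zero, smul_zero, smul_zero]

/-- With column p + 1 empty, only the vertical differential of column p contributes to column p of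
the total differential. -/
lemma isCycle_of_d_eq_zero {p q : ℕ} {x : D.Total} (h0 : ∀ j, x (p + 1) j = 0)
    (h : ∀ j, D.d x p j = 0) : D.IsCycle p q (x p q) := by
  cases q with
  | zero => trivial
  | succ q =>
    have h1 := h q
    rw [d_apply, h0, map_zero, zero_add, smul_eq_zero_iff_eq] at h1
    exact h1

/-! ### The second page of a double complex. -/

/-- The second page in terms of the homology of the columns: `Zv p` are the cycles and `Y.X p` is
the homology in degree `q` of the `p`-th column. -/
theorem nonempty_homology_iso_E {q : ℕ} (Zv : ℕ → ModuleCat.{u} K) (j : ∀ p, Zv p →ₗ[K] D.X p q)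
    (hj : ∀ p, Function.Injective (j p)) (hjr : ∀ p x, (∃ z, j p z = x) ↔ D.IsCycle p q x)
    (Y : ChainComplex (ModuleCat.{u} K) ℕ) (κ : ∀ p, Zv p →ₗ[K] Y.X p)
    (hκ : ∀ p, Function.Surjective (κ p))
    (hκ0 : ∀ p z, κ p z = 0 ↔ ∃ w, D.v p q w = j p z)
    (hY : ∀ p z z', D.h p q (j (p + 1) z) = j p z' → Y.d (p + 1) p (κ (p + 1) z) = κ p z')
    (p : ℕ) : Nonempty (Y.homology p ≅ ModuleCat.of K (D.filtered.E 2 p (p + q))) := by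
  -- Column p + 1 of x is zero and d x lives in columns up to p - 2, so the leading component is a
  -- vertical cycle.
  have hcyc : ∀ {x : D.Total}, x ∈ D.filtered.Z 2 p (p + q) → D.IsCycle p q (x p q) :=
    fun {x} hx => isCycle_of_d_eq_zero (fun j => hx.1 (p + 1) j (by lia))
      (fun j => hx.2 p j (by lia))
  let e := LinearEquiv.ofInjective (j p) (hj p)
  let c : D.filtered.Z 2 p (p + q) →ₗ[K] Zv p := e.symm.toLinearMap ∘ₗ
    ((LinearMap.proj (R := K) (φ := fun q => D.X p q) q ∘ₗ
      LinearMap.proj (R := K) (φ := fun p => ∀ q, D.X p q) p) ∘ₗ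
        Submodule.subtype _).codRestrict (LinearMap.range (j p)) fun x => (hjr p _).2 (hcyc x.2)
  have hc : ∀ x, j p (c x) = (x : D.Total) p q :=
    fun x => congrArg Subtype.val (e.apply_symm_apply _)
  have hjc : ∀ p z, D.IsCycle p q (j p z) := fun p z => (hjr p _).1 ⟨z, rfl⟩
  refine ShortComplex.nonempty_homology_iso_quotient (Y.sc p) (κ p ∘ₗ c) _ ?_ ?_ ?_
  · intro x
    change Y.d p _ (κ p (c x)) = 0
    obtain - | p := p
    · exact Y.d_next_zero _
    rw [Y.d_next_succ_eq_zero_iff]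
    obtain ⟨z', hz'⟩ := (hjr p _).2 (hjc (p + 1) (c x)).h
    rw [hY p _ z' hz'.symm, hκ0, hz', hc]
    -- Here x has leading column p + 1. That d x has no component in column p says that the
    -- horizontal image of the leading component is a vertical boundary, up to sign.
    have h := x.2.2 p q (by push_cast; lia)
    change D.d x p q = 0 at h
    rw [d_apply, add_eq_zero_iff_eq_neg] at h
    refine ⟨-((p : ℤ).negOnePow • (x : D.Total) p (q + 1)), ?_⟩
    rw [h, map_neg, map_negOnePow_smul]
  · intro y hy
    obtain ⟨z, rfl⟩ := hκ p y
    -- It is enough to extend the vertical cycle z by components in lower columns to an element of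
    -- Z^2.
    suffices ∃ x ∈ D.filtered.Z 2 p (p + q), x p q = j p z by
      obtain ⟨x, hx, hxz⟩ := this
      refine ⟨⟨x, hx⟩, 0, ?_⟩
      rw [map_zero, add_zero]
      exact congrArg (κ p) (hj p (by rw [hc, ← hxz]))
    obtain - | p := p
    · refine ⟨D.inc 0 q (j 0 z), ⟨D.inc_mem_fil 0 q _ le_rfl rfl, ?_⟩, D.inc_self 0 q _⟩
      refine D.mem_fil_of_column (D.d_mem_fil (D.inc_mem_fil 0 q _ le_rfl rfl)) fun i j _ => ?_
      exact (hjc 0 z).d_inc (by lia)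
    · change Y.d (p + 1) _ _ = 0 at hy
      rw [Y.d_next_succ_eq_zero_iff] at hy
      obtain ⟨z', hz'⟩ := (hjr p _).2 (hjc (p + 1) z).h
      rw [hY p _ z' hz'.symm, hκ0, hz'] at hy
      obtain ⟨w, hw⟩ := hy
      -- The horizontal image of z is the vertical boundary of w. Placing w in column p, with the
      -- sign of the total differential removed, cancels column p of d z.
      have hmem : D.inc (p + 1) q (j (p + 1) z) - (p : ℤ).negOnePow • D.inc p (q + 1) w ∈
          D.fil (p + 1 : ℕ) ((p + 1 : ℕ) + q) := by
        rw [Units.smul_def]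
        exact sub_mem (D.inc_mem_fil _ _ _ le_rfl rfl) (zsmul_mem
          (D.inc_mem_fil _ _ _ (by lia) (by push_cast; ring)) _)
      refine ⟨_, ⟨hmem, D.mem_fil_of_column (D.d_mem_fil hmem) fun i k hi => ?_⟩, ?_⟩
      · change D.d (_ - _) i k = 0
        rw [map_sub, Pi.sub_apply, Pi.sub_apply, map_negOnePow_smul, IsCycle.d_inc_succ (hjc _ z),
          ← hw, Pi.smul_apply, Pi.smul_apply, d_inc_of_ne w (by lia),
          negOnePow_smul_negOnePow_smul, sub_self]
      · rw [Pi.sub_apply, Pi.sub_apply, inc_self, Pi.smul_apply, Pi.smul_apply,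
          D.inc_of_ne w (by lia), smul_zero, sub_zero]
  · intro x
    refine Iff.trans ?_ (Y.exists_d_prev_iff p (κ p (c x))).symm
    change (x : D.Total) ∈ D.filtered.B 2 p (p + q) ↔ _
    rw [FilteredDifferential.mem_B]
    constructor
    · rintro ⟨u, hu, y, hy, hxy⟩
      -- The first summand of the boundaries has no column p, so the leading component of x is that
      -- of d y.
      have hup : u p q = 0 := hu.1 p q (by lia)
      have hyc : D.IsCycle (p + 1) q (y (p + 1) q) :=
        isCycle_of_d_eq_zero (fun k => hy.1 (p + 1 + 1) k (by push_cast; lia))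
          (fun k => hy.2 (p + 1) k (by push_cast; lia))
      obtain ⟨z', hz'⟩ := (hjr _ _).2 hyc
      obtain ⟨z'', hz''⟩ := (hjr _ _).2 (hjc _ z').h
      refine ⟨κ (p + 1) z', ?_⟩
      rw [hY p z' z'' hz''.symm, eq_comm, ← sub_eq_zero, ← map_sub, hκ0]
      refine ⟨(p : ℤ).negOnePow • y p (q + 1), ?_⟩
      rw [map_sub, hc, hz'', hz', hxy, map_negOnePow_smul, Pi.add_apply, Pi.add_apply, hup,
        zero_add]
      change _ = D.d y p q - _
      rw [d_apply, add_sub_cancel_left]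
    · rintro ⟨y, hy⟩
      obtain ⟨z', rfl⟩ := hκ _ y
      obtain ⟨z'', hz''⟩ := (hjr _ _).2 (hjc _ z').h
      rw [hY p z' z'' hz''.symm, eq_comm, ← sub_eq_zero, ← map_sub, hκ0] at hy
      obtain ⟨w, hw⟩ := hy
      rw [map_sub, hc, hz''] at hw
      -- The leading component of x is a horizontal image of z' plus a vertical boundary of w, so
      -- the element with components z' and w has total differential agreeing with x in columns from
      -- p on. Subtracting this differential leaves filtration p - 1, the other summand of the
      -- boundaries.
      have hmem : D.inc (p + 1) q (j (p + 1) z') + (p : ℤ).negOnePow • D.inc p (q + 1) w ∈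
          D.fil (p + 2 - 1) (p + q + 1) := by
        rw [Units.smul_def]
        exact add_mem (D.inc_mem_fil _ _ _ (by lia) (by push_cast; ring)) (zsmul_mem
          (D.inc_mem_fil _ _ _ (by lia) (by push_cast; ring)) _)
      have hd : ∀ i k : ℕ, p ≤ i → D.d (D.inc (p + 1) q (j (p + 1) z') +
          (p : ℤ).negOnePow • D.inc p (q + 1) w) i k = D.inc p q ((x : D.Total) p q) i k := by
        intro i k hi
        rw [map_add, Pi.add_apply, Pi.add_apply, map_negOnePow_smul, IsCycle.d_inc_succ (hjc _ z'),
          Pi.smul_apply, Pi.smul_apply, d_inc_of_ne w (by lia),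
          negOnePow_smul_negOnePow_smul, hw, map_sub, Pi.sub_apply, Pi.sub_apply,
          add_sub_cancel]
      have hx' := D.d_mem_fil hmem
      rw [add_sub_cancel_right] at hx'
      have hsub : (x : D.Total) - D.d (D.inc (p + 1) q (j (p + 1) z') +
          (p : ℤ).negOnePow • D.inc p (q + 1) w) ∈ D.fil p (p + q) :=
        sub_mem x.2.1 (D.mem_fil_of_column hx' fun i k hi => by
          rw [hd i k (by lia), D.inc_of_ne _ (by lia)])
      refine ⟨_, ⟨D.mem_fil_of_column hsub ?_, ?_⟩, _, ⟨hmem, ?_⟩, (sub_add_cancel _ _).symm⟩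
      · intro i k hi
        rw [Pi.sub_apply, Pi.sub_apply, hd i k (by lia)]
        by_cases hik : i = p ∧ k = q
        · obtain ⟨rfl, rfl⟩ := hik
          rw [inc_self, sub_self]
        · rw [D.inc_of_ne _ hik, x.2.1 i k (by lia), sub_zero]
      · change D.d (_ - D.d _) ∈ D.fil _ _
        rw [map_sub, D.d_d, sub_zero]
        have h := x.2.2
        rwa [show (p : ℤ) - 1 - (2 - 1) = p - 2 by ring]
      · change D.d _ ∈ D.fil _ _
        rw [add_sub_cancel_right]
        exact D.mem_fil_of_column hx' fun i k hi => by
          rw [hd i k (by lia), D.inc_of_ne _ (by lia)]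

/-! ### The homology of the total complex. -/

variable (D)

/-- The part of degree `n` of an element of the total complex. -/
def degreePart (n : ℕ) (x : D.Total) : D.Total := fun i j => if i + j = n then x i j else 0

variable {D}

lemma degreePart_mem_fil (n : ℕ) (x : D.Total) : D.degreePart n x ∈ D.fil n n := by
  intro i j hij
  rw [degreePart, if_neg (by lia)]

/-- The differential is homogeneous of degree -1. This makes a preimage homogeneous when the element
it hits is, which is needed because `Total` has no degree restriction. -/
lemma d_degreePart (n : ℕ) (x : D.Total) (h : ∀ i j, i + j + 1 ≠ n → D.d x i j = 0) :
    D.d (D.degreePart n x) = D.d x := by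
  ext i j
  by_cases hij : i + j + 1 = n
  · rw [d_apply, d_apply, degreePart, degreePart, if_pos (by lia), if_pos (by lia)]
  · rw [h i j hij, d_apply, degreePart, degreePart, if_neg (by lia), if_neg (by lia),
      map_zero, map_zero, smul_zero, add_zero]

section Augmentation

variable {W : ChainComplex (ModuleCat.{u} K) ℕ} (ε : ∀ q, D.X 0 q →ₗ[K] W.X q)
  (hex : ∀ p q x, D.h p q x = 0 → ∃ y, D.h (p + 1) q y = x)
  (hε : ∀ q x, ε q x = 0 ↔ ∃ y, D.h 0 q y = x)
  (hεs : ∀ q, Function.Surjective (ε q))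
  (hεv : ∀ q x, ε q (D.v 0 q x) = W.d (q + 1) q (ε (q + 1) x))

include hex hε in
/-- The kernel of the augmentation is acyclic. -/
lemma exists_d_eq {z : D.Total} (hz : D.d z = 0) (hz0 : ∀ q, ε q (z 0 q) = 0) :
    ∃ y, D.d y = z ∧ ∀ q, y 0 q = 0 := by
  -- The preimage y is built column by column, starting from column 0 equal to zero. `P p` says
  -- that, given column p of y, the equation for d y = z in column p can be solved for column p + 1.
  let P : ∀ p, (∀ q, D.X p q) → Prop := fun p y => ∀ q, ∃ y' : D.X (p + 1) q,
    D.h p q y' + (p : ℤ).negOnePow • D.v p q (y (q + 1)) = z p q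
  have h0 : P 0 (fun _ => 0) := fun q => by
    obtain ⟨y', hy'⟩ := (hε q _).1 (hz0 q)
    exact ⟨y', by rw [map_zero, smul_zero, add_zero, hy']⟩
  have hs : ∀ p (y : ∀ q, D.X p q), P p y → ∃ y' : ∀ q, D.X (p + 1) q, P (p + 1) y' ∧
      ∀ q, D.h p q (y' q) + (p : ℤ).negOnePow • D.v p q (y (q + 1)) = z p q := by
    intro p y hy
    choose y' hy' using hy
    refine ⟨y', fun q => ?_, hy'⟩
    -- By d z = 0 and the equation already solved in column p, the horizontal differential kills the
    -- required value; exactness of the row then provides column p + 2.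
    obtain ⟨y'', hy''⟩ := hex p q (z (p + 1) q -
      ((p + 1 : ℕ) : ℤ).negOnePow • D.v (p + 1) q (y' (q + 1))) (by
        have h1 := congrFun (congrFun hz p) q
        rw [d_apply, ← hy' (q + 1), map_add, map_negOnePow_smul, D.v_v, smul_zero, add_zero] at h1
        rw [map_sub, map_negOnePow_smul, D.h_v, Nat.cast_add, Nat.cast_one, Int.negOnePow_succ,
          Units.neg_smul, sub_neg_eq_add]
        exact h1)
    exact ⟨y'', by rw [hy'', sub_add_cancel]⟩
  let Y : ∀ p, {y : ∀ q, D.X p q // P p y} := fun p => Nat.rec ⟨fun _ => 0, h0⟩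
    (fun p y => ⟨(hs p y.1 y.2).choose, (hs p y.1 y.2).choose_spec.1⟩) p
  refine ⟨fun p => (Y p).1, ?_, fun q => rfl⟩
  ext p q
  exact (hs p (Y p).1 (Y p).2).choose_spec.2 q

include hex hε hεs hεv in
/-- If the rows of a double complex are resolutions of the terms of a complex, then the total
complex computes the homology of this complex. -/
theorem nonempty_homology_iso_cycles (n : ℕ) : Nonempty (W.homology n ≅
    ModuleCat.of K (↥(D.filtered.cycles n n) ⧸ ((D.fil (n + 1) (n + 1)).map D.d).submoduleOf
      (D.filtered.cycles n n))) := by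
  have hεh : ∀ q x, ε q (D.h 0 q x) = 0 := fun q x => (hε q _).2 ⟨x, rfl⟩
  have hεd : ∀ (x : D.Total) q, ε q (D.d x 0 q) = W.d (q + 1) q (ε (q + 1) (x 0 (q + 1))) := by
    intro x q
    rw [d_apply, map_add, hεh, map_negOnePow_smul, hεv, zero_add, Nat.cast_zero,
      Int.negOnePow_zero, one_smul]
  refine ShortComplex.nonempty_homology_iso_quotient (W.sc n) (ε n ∘ₗ
    (LinearMap.proj (R := K) (φ := fun q => D.X 0 q) n ∘ₗ
      LinearMap.proj (R := K) (φ := fun p => ∀ q, D.X p q) 0) ∘ₗ Submodule.subtype _) _ ?_ ?_ ?_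
  · rintro ⟨x, hx, hdx⟩
    change W.d n _ (ε n (x 0 n)) = 0
    obtain - | n := n
    · exact W.d_next_zero _
    · rw [W.d_next_succ_eq_zero_iff, ← hεd]
      rw [show D.d x = 0 from hdx]
      exact map_zero _
  · intro w hw
    obtain ⟨x, rfl⟩ := hεs n w
    change W.d n _ (ε n x) = 0 at hw
    have hmem : D.inc 0 n x ∈ D.fil n n := D.inc_mem_fil 0 n x (by lia) (by lia)
    have h1 : ∀ q, ε q (D.d (D.inc 0 n x) 0 q) = 0 := by
      intro q
      rw [hεd]
      by_cases hq : q + 1 = n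
      · subst hq
        rw [W.d_next_succ_eq_zero_iff] at hw
        rw [inc_self, hw]
      · rw [D.inc_of_ne x (by lia), map_zero, map_zero]
    -- The lift x of the cycle w need not be a cycle of the total complex, but its differential lies
    -- in the kernel of the augmentation. The correcting y has zero column 0, so subtracting it does
    -- not change the augmentation.
    obtain ⟨y, hy, hy0⟩ := exists_d_eq ε hex hε (D.d_d _) h1
    have hyd : D.d (D.degreePart n y) = D.d (D.inc 0 n x) :=
      (d_degreePart n y fun i j hij => by rw [hy, D.d_mem_fil hmem i j (by lia)]).trans hy
    refine ⟨⟨D.inc 0 n x - D.degreePart n y, sub_mem hmem (degreePart_mem_fil n y), ?_⟩, 0, ?_⟩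
    · change D.d (_ - _) = 0
      rw [map_sub, hyd, sub_self]
    · rw [map_zero, add_zero]
      refine congrArg (ε n) (?_ : x = (D.inc 0 n x - D.degreePart n y) 0 n)
      rw [Pi.sub_apply, Pi.sub_apply, inc_self, degreePart, if_pos (zero_add n), hy0, sub_zero]
  · intro x
    refine Iff.trans ?_ (W.exists_d_prev_iff n (ε n ((x : D.Total) 0 n))).symm
    constructor
    · rintro ⟨y, hy, hyx⟩
      refine ⟨ε (n + 1) (y 0 (n + 1)), ?_⟩
      rw [← hεd, hyx]; rfl
    · rintro ⟨w, hw⟩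
      obtain ⟨w, rfl⟩ := hεs _ w
      -- Subtracting the total differential of a lift of w leaves a cycle in the kernel of the
      -- augmentation, which is a boundary by acyclicity.
      have h1 : ∀ q, ε q (((x : D.Total) - D.d (D.inc 0 (n + 1) w)) 0 q) = 0 := by
        intro q
        rw [Pi.sub_apply, Pi.sub_apply, map_sub, hεd]
        by_cases hq : q = n
        · subst hq
          rw [inc_self, hw, sub_self]
        · rw [D.inc_of_ne w (by lia), x.2.1 0 q (by lia), map_zero, map_zero, map_zero, sub_zero]
      obtain ⟨y, hy, -⟩ := exists_d_eq ε hex hε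
        (by rw [map_sub, D.d_d, sub_zero]; exact x.2.2) h1
      have hd : D.d (y + D.inc 0 (n + 1) w) = x := by rw [map_add, hy, sub_add_cancel]
      refine ⟨D.degreePart (n + 1) (y + D.inc 0 (n + 1) w), ?_, ?_⟩
      · exact_mod_cast degreePart_mem_fil (n + 1) _
      · exact (d_degreePart (n + 1) _ fun i j hij => by rw [hd, x.2.1 i j (by lia)]).trans hd

end Augmentation

end DoubleComplex

/-! ### A functorial projective resolution over an algebra over a field -/

namespace FreeCover

open Limits

open scoped ModuleCat

variable (K : Type u) {R : Type u} [Field K] [Ring R] [Algebra K R]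

variable (R) in
/-- The functor `V ↦ R ⊗ V`. -/
def cover : ModuleCat.{u} R ⥤ ModuleCat.{u} R where
  obj V := ModuleCat.of R (R ⊗[K] V)
  map f := ModuleCat.ofHom (LinearMap.baseChange R (f.hom.restrictScalars K))
  map_id _ := ModuleCat.hom_ext (LinearMap.baseChange_id)
  map_comp _ _ := ModuleCat.hom_ext (TensorProduct.AlgebraTensorModule.ext fun _ _ => rfl)

/-- The surjection `R ⊗ V → V`. -/
def counit (V : ModuleCat.{u} R) : (cover K R).obj V →ₗ[R] V :=
  TensorProduct.AlgebraTensorModule.lift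
    { toFun := fun r => Module.toModuleEnd K V r
      map_add' := map_add _
      map_smul' := fun r s => map_mul (Module.toModuleEnd K V) r s }

lemma counit_surjective (V : ModuleCat.{u} R) : Function.Surjective (counit K V) :=
  fun x => ⟨(1 : R) ⊗ₜ[K] x, one_smul R x⟩

lemma counit_naturality {V W : ModuleCat.{u} R} (f : V ⟶ W) (z : (cover K R).obj V) :
    counit K W (((cover K R).map f).hom z) = f.hom (counit K V z) := by
  refine LinearMap.congr_fun (f := counit K W ∘ₗ ((cover K R).map f).hom)
    (g := f.hom ∘ₗ counit K V) (TensorProduct.AlgebraTensorModule.ext fun r x => ?_) z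
  exact (map_smul f.hom r x).symm

instance : (cover K R).Additive where
  map_add {_ _ f g} := ModuleCat.hom_ext (LinearMap.baseChange_add
    (f.hom.restrictScalars K) (g.hom.restrictScalars K))

/-- V is free over the field K, so R ⊗ V is free over R. -/
instance (V : ModuleCat.{u} R) : Projective ((cover K R).obj V) :=
  ModuleCat.projective_of_categoryTheory_projective (ModuleCat.of R (R ⊗[K] V))

lemma shortExact_map_cover {S : ShortComplex (ModuleCat.{u} R)} (hS : S.ShortExact) :
    (S.map (cover K R)).ShortExact := by
  have hex : Function.Exact (S.f.hom.restrictScalars K) (S.g.hom.restrictScalars K) :=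
    (ShortComplex.ShortExact.moduleCat_exact_iff_function_exact S).1 hS.exact
  refine ModuleCat.shortComplex_shortExact _ ?_ ?_ ?_
  · exact Module.Flat.lTensor_exact (R := K) R hex
  · exact Module.Flat.lTensor_preserves_injective_linearMap (R := K) (M := R)
      (S.f.hom.restrictScalars K) hS.moduleCat_injective_f
  · exact LinearMap.lTensor_surjective R (g := S.g.hom.restrictScalars K) hS.moduleCat_surjective_g

variable (R)

/-- The kernel of `R ⊗ V → V` as a functor. -/
def syzygy : ModuleCat.{u} R ⥤ ModuleCat.{u} R where
  obj V := ModuleCat.of R (LinearMap.ker (counit K V))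
  map f := ModuleCat.ofHom (((cover K R).map f).hom.restrict fun z hz => by
    rw [LinearMap.mem_ker, counit_naturality, hz, map_zero])
  map_id V := ModuleCat.hom_ext (LinearMap.ext fun z => Subtype.ext (by
    change ((cover K R).map (𝟙 V)).hom z.1 = z.1
    rw [CategoryTheory.Functor.map_id]; rfl))
  map_comp f g := ModuleCat.hom_ext (LinearMap.ext fun z => Subtype.ext (by
    change ((cover K R).map (f ≫ g)).hom z.1 = ((cover K R).map g).hom (((cover K R).map f).hom z.1)
    rw [Functor.map_comp]; rfl))

variable {R}

instance : (syzygy K R).Additive where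
  map_add {V W f g} := ModuleCat.hom_ext (LinearMap.ext fun z => Subtype.ext (by
    change ((cover K R).map (f + g)).hom z.1 =
      ((cover K R).map f).hom z.1 + ((cover K R).map g).hom z.1
    rw [Functor.map_add]; rfl))

/-- This is the nine lemma for the surjections R ⊗ V → V: the functor V ↦ R ⊗ V and the identity are
exact, hence so is the kernel. -/
lemma shortExact_map_syzygy {S : ShortComplex (ModuleCat.{u} R)} (hS : S.ShortExact) :
    (S.map (syzygy K R)).ShortExact := by
  have hS' := shortExact_map_cover K hS
  have hex := (ShortComplex.ShortExact.moduleCat_exact_iff_function_exact _).1 hS.exact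
  have hex' := (ShortComplex.ShortExact.moduleCat_exact_iff_function_exact _).1 hS'.exact
  have hinj := hS.moduleCat_injective_f
  refine ModuleCat.shortComplex_shortExact _ ?_ ?_ ?_
  · rintro (⟨y, hy⟩ : LinearMap.ker (counit K S.X₂))
    constructor
    · intro h
      obtain ⟨x, hx⟩ := (hex' y).1 (congrArg Subtype.val h)
      refine ⟨(⟨x, hinj ?_⟩ : LinearMap.ker (counit K S.X₁)), Subtype.ext hx⟩
      refine (counit_naturality K S.f x).symm.trans ?_
      rw [map_zero]
      exact (congrArg (counit K S.X₂) hx).trans hy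
    · rintro ⟨x, hx⟩
      exact Subtype.ext ((hex' y).2 ⟨x.1, congrArg Subtype.val hx⟩)
  · intro x x' h
    exact Subtype.ext (hS'.moduleCat_injective_f (congrArg Subtype.val h))
  · rintro (⟨z, hz⟩ : LinearMap.ker (counit K S.X₃))
    obtain ⟨y, hy⟩ : ∃ y : (cover K R).obj S.X₂, ((cover K R).map S.g).hom y = z :=
      hS'.moduleCat_surjective_g z
    have h1 : S.g.hom (counit K S.X₂ y) = 0 := by
      rw [← counit_naturality, hy]
      exact hz
    -- The lift y need not lie in the kernel of the counit, but its counit comes from `S.X₁`;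
    -- lifting that element to the cover of `S.X₁` gives the correction, which vanishes in the cover
    -- of `S.X₃`.
    obtain ⟨x, hx⟩ := (hex _).1 h1
    obtain ⟨x, rfl⟩ := counit_surjective K S.X₁ x
    refine ⟨(⟨y - ((cover K R).map S.f).hom x, ?_⟩ : LinearMap.ker (counit K S.X₂)), Subtype.ext ?_⟩
    · refine (map_sub (counit K S.X₂) _ _).trans ?_
      rw [counit_naturality, sub_eq_zero]
      exact hx.symm
    · change ((cover K R).map S.g).hom (y - ((cover K R).map S.f).hom x) = z
      rw [map_sub, sub_eq_iff_eq_add]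
      have h2 : ((cover K R).map S.g).hom (((cover K R).map S.f).hom x) = 0 := (hex' _).2 ⟨x, rfl⟩
      rw [h2, add_zero, hy]

variable (R)

/-- The iterated syzygies. -/
def syzygies : ℕ → (ModuleCat.{u} R ⥤ ModuleCat.{u} R)
  | 0 => 𝟭 _
  | p + 1 => syzygies p ⋙ syzygy K R

variable {R}

instance additive_syzygies : ∀ p, (syzygies K R p).Additive
  | 0 => inferInstanceAs (𝟭 _ : ModuleCat.{u} R ⥤ _).Additive
  | p + 1 =>
    have := additive_syzygies p
    inferInstanceAs (syzygies K R p ⋙ syzygy K R).Additive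

lemma shortExact_map_comp {C D E : Type*} [Category* C] [Category* D] [Category* E] [Preadditive C]
    [Preadditive D] [Preadditive E] (F : C ⥤ D) (G : D ⥤ E) [F.Additive] [G.Additive]
    (hF : ∀ S : ShortComplex C, S.ShortExact → (S.map F).ShortExact)
    (hG : ∀ S : ShortComplex D, S.ShortExact → (S.map G).ShortExact)
    (S : ShortComplex C) (hS : S.ShortExact) : (S.map (F ⋙ G)).ShortExact :=
  hG _ (hF S hS)

lemma shortExact_map_syzygies (p : ℕ) (S : ShortComplex (ModuleCat.{u} R)) (hS : S.ShortExact) :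
    (S.map (syzygies K R p)).ShortExact := by
  induction p generalizing S with
  | zero => exact hS
  | succ p ih =>
    exact shortExact_map_comp (syzygies K R p) (syzygy K R) ih
      (fun _ => shortExact_map_syzygy K) S hS

/-! ### Splicing the syzygies into a resolution. -/

variable (R)

/-- The composition `R ⊗ ΩV → ΩV → R ⊗ V`, where `ΩV` is the kernel of `R ⊗ V → V`. -/
def connecting : syzygy K R ⋙ cover K R ⟶ cover K R where
  app V := ModuleCat.ofHom
    ((LinearMap.ker (counit K V)).subtype ∘ₗ counit K ((syzygy K R).obj V))
  naturality _ _ f := ModuleCat.hom_ext (LinearMap.ext fun z =>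
    congrArg Subtype.val (counit_naturality K ((syzygy K R).map f) z))

variable {R}

lemma connecting_comp_counit (V : ModuleCat.{u} R) :
    (connecting K R).app V ≫ ModuleCat.ofHom (counit K V) = 0 :=
  ModuleCat.hom_ext (LinearMap.ext fun z => (counit K ((syzygy K R).obj V) z : LinearMap.ker _).2)

lemma exact_connecting_counit (V : ModuleCat.{u} R) :
    (ShortComplex.mk _ _ (connecting_comp_counit K V)).Exact := by
  rw [ShortComplex.moduleCat_exact_iff]
  intro x hx
  obtain ⟨y, hy⟩ := counit_surjective K ((syzygy K R).obj V) (⟨x, hx⟩ : LinearMap.ker (counit K V))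
  exact ⟨y, congrArg Subtype.val hy⟩

lemma connecting_comp_connecting (V : ModuleCat.{u} R) :
    (connecting K R).app ((syzygy K R).obj V) ≫ (connecting K R).app V = 0 :=
  ModuleCat.hom_ext (LinearMap.ext fun z => congrArg Subtype.val (congrArg (fun f => f.hom z)
    (connecting_comp_counit K ((syzygy K R).obj V))))

/-- The inclusion ΩV → R ⊗ V is injective, so the kernel of the connecting map is that of the counit
of ΩV. -/
lemma exact_connecting_connecting (V : ModuleCat.{u} R) :
    (ShortComplex.mk _ _ (connecting_comp_connecting K V)).Exact := by
  rw [ShortComplex.moduleCat_exact_iff]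
  intro x hx
  exact (ShortComplex.moduleCat_exact_iff _).1 (exact_connecting_counit K ((syzygy K R).obj V)) x
    (Subtype.ext hx)

/-- The complex `⋯ → R ⊗ Ω²V → R ⊗ ΩV → R ⊗ V`. -/
def complex (V : ModuleCat.{u} R) : ChainComplex (ModuleCat.{u} R) ℕ :=
  ChainComplex.of (fun p => (cover K R).obj ((syzygies K R p).obj V))
    (fun p => (connecting K R).app ((syzygies K R p).obj V))
    (fun p => connecting_comp_connecting K ((syzygies K R p).obj V))

lemma complex_d (V : ModuleCat.{u} R) (p : ℕ) :
    (complex K V).d (p + 1) p = (connecting K R).app ((syzygies K R p).obj V) :=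
  ChainComplex.of_d (fun p => (cover K R).obj ((syzygies K R p).obj V))
    (fun p => (connecting K R).app ((syzygies K R p).obj V)) p

lemma complex_exactAt_succ (V : ModuleCat.{u} R) (p : ℕ) : (complex K V).ExactAt (p + 1) := by
  rw [HomologicalComplex.exactAt_iff' _ (p + 2) (p + 1) p (by simp) (by simp)]
  have h := exact_connecting_connecting K ((syzygies K R p).obj V)
  rw [ShortComplex.moduleCat_exact_iff] at h ⊢
  intro x hx
  change (complex K V).d (p + 1) p x = 0 at hx
  rw [complex_d] at hx
  obtain ⟨y, hy⟩ := h x hx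
  refine ⟨y, ?_⟩
  change (complex K V).d (p + 1 + 1) (p + 1) y = x
  rw [complex_d]
  exact hy

/-- The augmentation of `complex`. -/
def augmentation (V : ModuleCat.{u} R) : complex K V ⟶ (ChainComplex.single₀ _).obj V :=
  (ChainComplex.toSingle₀Equiv _ _).symm ⟨ModuleCat.ofHom (counit K V), by
    rw [complex_d]
    exact connecting_comp_counit K V⟩

lemma augmentation_f_zero (V : ModuleCat.{u} R) :
    (augmentation K V).f 0 = ModuleCat.ofHom (counit K V) :=
  ChainComplex.toSingle₀Equiv_symm_apply_f_zero _ _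

/-- The projective resolution `⋯ → R ⊗ Ω²V → R ⊗ ΩV → R ⊗ V → V`. -/
def resolution (V : ModuleCat.{u} R) : ProjectiveResolution V where
  complex := complex K V
  projective p := inferInstanceAs (Projective ((cover K R).obj _))
  π := augmentation K V
  quasiIso := ⟨fun n => by
    cases n
    -- In degree 0 the quasi-isomorphism condition is exactness of R ⊗ ΩV → R ⊗ V → V together with
    -- surjectivity of the last map; in higher degrees it is exactness of the complex.
    · rw [ChainComplex.quasiIsoAt₀_iff, ShortComplex.quasiIso_iff_of_zeros']
      · refine (ShortComplex.exact_and_epi_g_iff_of_iso ?_).2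
          ⟨exact_connecting_counit K V, (ModuleCat.epi_iff_surjective _).2 (counit_surjective K V)⟩
        exact ShortComplex.isoMk (Iso.refl _) (Iso.refl _) (Iso.refl _)
          ((Category.id_comp _).trans ((Category.comp_id _).trans (complex_d K V 0)).symm)
          ((Category.id_comp _).trans
            ((augmentation_f_zero K V).symm.trans (Category.comp_id _).symm))
      all_goals rfl
    · rw [quasiIsoAt_iff_exactAt']
      · apply complex_exactAt_succ
      · apply ChainComplex.exactAt_succ_single_obj⟩

end FreeCover

/-! ### The spectral sequence of a complex of acyclic modules -/

namespace FreeCover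

open scoped ModuleCat

variable {K R : Type u} [Field K] [Ring R] [Algebra K R]
  (F : ModuleCat.{u} R ⥤ ModuleCat.{u} K) [F.Additive]

variable (K) in
/-- The functors `V ↦ F (R ⊗ ΩᵖV)`. -/
abbrev derivedTerm (p : ℕ) : ModuleCat.{u} R ⥤ ModuleCat.{u} K :=
  syzygies K R p ⋙ cover K R ⋙ F

/-- Before F is applied, the sequence is short exact with projective last term, hence split, and
every additive functor preserves split sequences. No exactness of F is used. -/
lemma shortExact_map_derivedTerm (p : ℕ) (S : ShortComplex (ModuleCat.{u} R))
    (hS : S.ShortExact) : (S.map (derivedTerm K F p)).ShortExact := by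
  have h : ((S.map (syzygies K R p)).map (cover K R)).ShortExact :=
    shortExact_map_cover K (shortExact_map_syzygies K p S hS)
  have : Projective ((S.map (syzygies K R p)).map (cover K R)).X₃ :=
    inferInstanceAs (Projective ((cover K R).obj _))
  exact (h.splittingOfProjective.map F).shortExact

lemma exact_map_derivedTerm (p : ℕ) (S : ShortComplex (ModuleCat.{u} R)) (hS : S.Exact) :
    (S.map (derivedTerm K F p)).Exact :=
  ((derivedTerm K F p).exact_tfae.out 0 1 rfl rfl).1 (shortExact_map_derivedTerm F p) S hS

lemma injective_map_derivedTerm (p : ℕ) {V W : ModuleCat.{u} R} (f : V ⟶ W) [Mono f] :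
    Function.Injective ((derivedTerm K F p).map f) := by
  have h := ((derivedTerm K F p).exact_tfae.out 0 3).1 (shortExact_map_derivedTerm F p)
  have := h.1
  exact (ModuleCat.mono_iff_injective _).1 inferInstance

lemma surjective_map_derivedTerm (p : ℕ) {V W : ModuleCat.{u} R} (f : V ⟶ W) [Epi f] :
    Function.Surjective ((derivedTerm K F p).map f) := by
  have h := ((derivedTerm K F p).exact_tfae.out 0 3).1 (shortExact_map_derivedTerm F p)
  have := h.2
  exact (ModuleCat.epi_iff_surjective _).1 inferInstance

variable (K) in
/-- The natural maps `F (R ⊗ Ωᵖ⁺¹V) → F (R ⊗ ΩᵖV)`. -/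
def derivedD (p : ℕ) : derivedTerm K F (p + 1) ⟶ derivedTerm K F p :=
  Functor.whiskerLeft (syzygies K R p) (Functor.whiskerRight (connecting K R) F)

lemma derivedD_app (p : ℕ) (V : ModuleCat.{u} R) :
    (derivedD K F p).app V = F.map ((connecting K R).app ((syzygies K R p).obj V)) := rfl

lemma derivedD_comp (p : ℕ) (V : ModuleCat.{u} R) :
    (derivedD K F (p + 1)).app V ≫ (derivedD K F p).app V = 0 := by
  rw [derivedD_app, derivedD_app]
  refine (F.map_comp _ _).symm.trans ?_
  have h := connecting_comp_connecting K ((syzygies K R p).obj V)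
  exact (congrArg F.map h).trans (F.map_zero _ _)

variable (C : ChainComplex (ModuleCat.{u} R) ℕ)

variable (K) in
/-- The double complex of the `F (R ⊗ Ωᵖ C_q)`. -/
def doubleComplex : DoubleComplex K where
  X p q := (derivedTerm K F p).obj (C.X q)
  h p q := ((derivedD K F p).app (C.X q)).hom
  v p q := ((derivedTerm K F p).map (C.d (q + 1) q)).hom
  h_h p q x := congrArg (fun f => f.hom x) (derivedD_comp F p (C.X q))
  v_v p q x := by
    have h : (derivedTerm K F p).map (C.d (q + 1 + 1) (q + 1)) ≫
        (derivedTerm K F p).map (C.d (q + 1) q) = 0 := by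
      rw [← Functor.map_comp, C.d_comp_d, Functor.map_zero]
    exact congrArg (fun f => f.hom x) h
  h_v p q x := congrArg (fun f => f.hom x) ((derivedD K F p).naturality (C.d (q + 1) q))

lemma exact_iff_hom {A B D : ModuleCat.{u} K} {f : A ⟶ B} {g : B ⟶ D} (w : f ≫ g = 0) :
    (ShortComplex.mk f g w).Exact ↔ ∀ x, g.hom x = 0 ↔ ∃ y, f.hom y = x := by
  rw [ShortComplex.moduleCat_exact_iff]
  refine forall_congr' fun x => ⟨fun h => ⟨h, ?_⟩, fun h => h.1⟩
  rintro ⟨y, rfl⟩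
  exact congrArg (fun f => f.hom y) w

/-- An exact functor preserves the kernel defining the cycles. In row 0 every element is a cycle on
both sides, `iCycles` being an isomorphism there. -/
lemma isCycle_iff (p q : ℕ) (x : (derivedTerm K F p).obj (C.X q)) :
    (∃ z, ((derivedTerm K F p).map (C.iCycles q)).hom z = x) ↔
      (doubleComplex K F C).IsCycle p q x := by
  obtain - | q := q
  · have : IsIso (C.iCycles 0) := C.isIso_iCycles 0 _ rfl (by simp)
    refine ⟨fun _ => trivial, fun _ => ?_⟩
    exact (ModuleCat.epi_iff_surjective _).1
      (inferInstance : Epi ((derivedTerm K F p).map (C.iCycles 0))) x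
  · have h : (ShortComplex.mk (C.iCycles (q + 1)) (C.d (q + 1) q) (by simp)).Exact :=
      ShortComplex.exact_of_f_is_kernel _ (C.cyclesIsKernel (q + 1) q (by simp))
    exact ((exact_iff_hom _).1 (exact_map_derivedTerm F p _ h) x).symm

/-- An exact functor preserves the cokernel defining the homology, and keeps the inclusion of cycles
injective. -/
lemma map_homologyπ_eq_zero_iff (p q : ℕ) (z : (derivedTerm K F p).obj (C.cycles q)) :
    ((derivedTerm K F p).map (C.homologyπ q)).hom z = 0 ↔
      ∃ w, ((derivedTerm K F p).map (C.d (q + 1) q)).hom w =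
        ((derivedTerm K F p).map (C.iCycles q)).hom z := by
  have h : (ShortComplex.mk (C.toCycles (q + 1) q) (C.homologyπ q) (by simp)).Exact :=
    ShortComplex.exact_of_g_is_cokernel _ (C.homologyIsCokernel (q + 1) q (by simp))
  have hi : ∀ w, ((derivedTerm K F p).map (C.d (q + 1) q)).hom w =
      ((derivedTerm K F p).map (C.iCycles q)).hom
        (((derivedTerm K F p).map (C.toCycles (q + 1) q)).hom w) := by
    intro w
    rw [← C.toCycles_i (q + 1) q, Functor.map_comp]; rfl
  rw [(exact_iff_hom _).1 (exact_map_derivedTerm F p _ h) z]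
  refine exists_congr fun w => ?_
  rw [hi]
  exact (injective_map_derivedTerm F p (C.iCycles q)).eq_iff.symm

/-- Column p is an exact functor applied to C, so its homology is that functor at H_q(C). As p
varies, these modules form F applied to the functorial resolution of H_q(C), whose homology is the
derived functor. -/
theorem nonempty_E_iso (p q : ℕ) : Nonempty
    (ModuleCat.of K ((doubleComplex K F C).filtered.E 2 p (p + q)) ≅
      (F.leftDerived p).obj (C.homology q)) := by
  have h := DoubleComplex.nonempty_homology_iso_E (D := doubleComplex K F C) (q := q)
    (fun p => (derivedTerm K F p).obj (C.cycles q))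
    (fun p => ((derivedTerm K F p).map (C.iCycles q)).hom)
    (fun p => injective_map_derivedTerm F p (C.iCycles q))
    (fun p x => isCycle_iff F C p q x)
    ((F.mapHomologicalComplex _).obj (complex K (C.homology q)))
    (fun p => ((derivedTerm K F p).map (C.homologyπ q)).hom)
    (fun p => surjective_map_derivedTerm F p (C.homologyπ q))
    (fun p z => map_homologyπ_eq_zero_iff F C p q z)
    (fun p z z' h => by
      have h1 : ∀ {V W : ModuleCat.{u} R} (f : V ⟶ W) (z : (derivedTerm K F (p + 1)).obj V),
          ((derivedD K F p).app W).hom (((derivedTerm K F (p + 1)).map f).hom z) =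
            ((derivedTerm K F p).map f).hom (((derivedD K F p).app V).hom z) :=
        fun f z => congrArg (fun f => f.hom z) ((derivedD K F p).naturality f)
      have h2 : ((derivedD K F p).app (C.cycles q)).hom z = z' := by
        refine injective_map_derivedTerm F p (C.iCycles q) ?_
        exact (h1 _ z).symm.trans h
      rw [← h2]
      refine Eq.trans ?_ (h1 (C.homologyπ q) z)
      change (F.map ((complex K (C.homology q)).d (p + 1) p)).hom _ = _
      rw [complex_d]; rfl) p
  exact ⟨h.some.symm ≪≫ ((resolution K (C.homology q)).isoLeftDerivedObj F p).symm⟩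

/-- For a complex `C` of `F`-acyclic modules, where `F` is right exact, there is a spectral
sequence from the derived functors of `F` at the homology of `C` to the homology of `F C`. -/
theorem exists_spectralSequence
    (hF : ∀ S : ShortComplex (ModuleCat.{u} R), S.Exact → Epi S.g →
      (S.map F).Exact ∧ Epi (S.map F).g)
    (hC : ∀ p q, Limits.IsZero ((F.leftDerived (p + 1)).obj (C.X q)))
    (H : ℕ → ModuleCat.{u} K)
    (hH : ∀ n, Nonempty (((F.mapHomologicalComplex _).obj C).homology n ≅ H n)) :
    ∃ E : FirstQuadrantHomologySS K,
      (∀ p q : ℕ, Nonempty ((E.page 2 le_rfl).X (p, q) ≅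
        (F.leftDerived p).obj (C.homology q))) ∧ E.ConvergesTo H := by
  have hcyc := fun n => DoubleComplex.nonempty_homology_iso_cycles (D := doubleComplex K F C)
    (W := (F.mapHomologicalComplex _).obj C)
    (fun q => (F.map (ModuleCat.ofHom (counit K (C.X q)))).hom)
    -- Row q is F applied to a projective resolution of C_q, so its exactness in positive degrees is
    -- the F-acyclicity of C_q.
    (fun p q x hx => by
      have h := (((resolution K (C.X q)).isoLeftDerivedObj F (p + 1)).isZero_iff).1 (hC p q)
      have h' := (HomologicalComplex.exactAt_iff_isZero_homology _ _).2 h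
      rw [HomologicalComplex.exactAt_iff' _ (p + 2) (p + 1) p (by simp) (by simp),
        ShortComplex.moduleCat_exact_iff] at h'
      have hd : ∀ p, F.map ((complex K (C.X q)).d (p + 1) p) = (derivedD K F p).app (C.X q) :=
        fun p => by rw [complex_d]; rfl
      obtain ⟨y, hy⟩ := h' x ((congrArg (fun f => f.hom x) (hd p)).trans hx)
      exact ⟨y, (congrArg (fun f => f.hom y) (hd (p + 1))).symm.trans hy⟩)
    -- At the augmented end of the row, exactness is right exactness of F.
    (fun q => by
      have h := (hF _ (exact_connecting_counit K (C.X q))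
        ((ModuleCat.epi_iff_surjective _).2 (counit_surjective K (C.X q)))).1
      exact (exact_iff_hom _).1 h)
    (fun q => (ModuleCat.epi_iff_surjective _).1 (hF _ (exact_connecting_counit K (C.X q))
        ((ModuleCat.epi_iff_surjective _).2 (counit_surjective K (C.X q)))).2)
    (fun q x => by
      have h : (cover K R).map (C.d (q + 1) q) ≫ ModuleCat.ofHom (counit K (C.X q)) =
          ModuleCat.ofHom (counit K (C.X (q + 1))) ≫ C.d (q + 1) q :=
        ModuleCat.hom_ext (LinearMap.ext (counit_naturality K (C.d (q + 1) q)))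
      exact congrArg (fun f => f.hom x)
        ((F.map_comp _ _).symm.trans ((congrArg F.map h).trans (F.map_comp _ _)))) n
  let e := fun n => ((hcyc n).some.symm ≪≫ (hH n).some).toLinearEquiv
  refine ⟨(doubleComplex K F C).filtered.spectralSequence, fun p q => nonempty_E_iso F C p q,
    FilteredDifferential.convergesTo _ H (fun n => (e n).toLinearMap ∘ₗ Submodule.mkQ _)
      (fun n => (e n).surjective.comp (Submodule.mkQ_surjective _)) (fun n x => ?_)⟩
  rw [LinearMap.comp_apply]
  exact (LinearEquiv.map_eq_zero_iff (e n)).trans (Submodule.Quotient.mk_eq_zero _)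

end FreeCover

/-! ### Balanced tensor products -/

namespace BalancedTensor

variable {K R : Type u} [CommRing K] [Ring R] {X : Type u} [AddCommGroup X] [Module K X]
  [Module Rᵐᵒᵖ X] [SMulCommClass K Rᵐᵒᵖ X] {Y : Type u} [AddCommGroup Y] [Module R Y]

lemma smul_mk (k : K) (x : X) (y : Y) : k • mk K R x y = mk K R (k • x) y := rfl

/-- The additive map out of a tensor product given by a balanced biadditive map. -/
def liftAdd {P : Type*} [AddCommGroup P] (f : X →+ Y →+ P)
    (h : ∀ x (r : R) y, f (op r • x) y = f x (r • y)) : BalancedTensor K R X Y →+ P :=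
  QuotientAddGroup.lift (balancedRel K R X Y).toAddSubgroup
    (TensorProduct.liftAddHom f fun n x y => by rw [map_zsmul, map_zsmul]; rfl) (by
      intro z hz
      -- The relations are a K-span but the map is only additive, so the induction has to carry all
      -- K-multiples; a multiple of a relation is again a relation because the two actions on X
      -- commute.
      suffices ∀ k : K, TensorProduct.liftAddHom f
          (fun n x y => by rw [map_zsmul, map_zsmul]; rfl) (k • z) = 0 by
        have h1 := this 1
        rwa [one_smul] at h1
      induction hz using Submodule.span_induction with
      | mem z hz =>
        obtain ⟨x, r, y, rfl⟩ := hz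
        intro k
        rw [smul_sub, TensorProduct.smul_tmul', TensorProduct.smul_tmul', map_sub,
          TensorProduct.liftAddHom_tmul, TensorProduct.liftAddHom_tmul, smul_comm, h, sub_self]
      | zero => intro k; rw [smul_zero, map_zero]
      | add z w _ _ hz hw => intro k; rw [smul_add, map_add, hz, hw, add_zero]
      | smul k' z _ hz => intro k; rw [smul_smul]; exact hz _)

/-- The linear map out of a tensor product given by a balanced biadditive map. -/
def lift {P : Type*} [AddCommGroup P] [Module K P] (f : X →+ Y →+ P)
    (h : ∀ x (r : R) y, f (op r • x) y = f x (r • y)) (hK : ∀ (k : K) x y, f (k • x) y = k • f x y) :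
    BalancedTensor K R X Y →ₗ[K] P :=
  { liftAdd f h with
    map_smul' := fun k z => by
      induction z using BalancedTensor.induction with
      | hmk x y => exact hK k x y
      | hadd z w hz hw =>
        rw [smul_add]
        refine (map_add (liftAdd (K := K) f h) _ _).trans ?_
        refine Eq.trans ?_ (congrArg (k • ·) (map_add (liftAdd (K := K) f h) z w)).symm
        exact (congrArg₂ (· + ·) hz hw).trans (smul_add _ _ _).symm }

variable (K X) in
/-- The functor `X ⊗_R -` is right exact. -/
theorem rightExact_tensorFunctor (S : ShortComplex (ModuleCat.{u} R)) (hS : S.Exact)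
    (hg : Epi S.g) : (S.map (tensorFunctor K R X)).Exact ∧ Epi (S.map (tensorFunctor K R X)).g := by
  have hgs : Function.Surjective S.g := (ModuleCat.epi_iff_surjective _).1 hg
  constructor
  · rw [ShortComplex.moduleCat_exact_iff]
    intro z hz
    obtain ⟨z, rfl⟩ := Submodule.Quotient.mk_surjective _ z
    let G : X ⊗[ℤ] S.X₂ →ₗ[K] X ⊗[ℤ] S.X₃ :=
      TensorProduct.AlgebraTensorModule.map LinearMap.id S.g.hom.toAddMonoidHom.toIntLinearMap
    have hG : G z ∈ balancedRel K R X S.X₃ := (Submodule.Quotient.mk_eq_zero _).1 hz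
    -- Relations lift along the surjection `S.g`. Hence z can be changed by a relation so that it
    -- dies already in the tensor product over ℤ, where right exactness is known.
    have hle : balancedRel K R X S.X₃ ≤ (balancedRel K R X S.X₂).map G := by
      rw [balancedRel, Submodule.span_le]
      rintro _ ⟨x, r, y, rfl⟩
      obtain ⟨y, rfl⟩ := hgs y
      refine ⟨_, Submodule.subset_span ⟨x, r, y, rfl⟩, ?_⟩
      rw [map_sub]
      change (op r • x) ⊗ₜ[ℤ] S.g.hom y - x ⊗ₜ[ℤ] S.g.hom (r • y) = _
      rw [map_smul]
    obtain ⟨w, hw, hwz⟩ := hle hG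
    have hex : Function.Exact S.f.hom.toAddMonoidHom.toIntLinearMap
        S.g.hom.toAddMonoidHom.toIntLinearMap :=
      (ShortComplex.ShortExact.moduleCat_exact_iff_function_exact S).1 hS
    obtain ⟨v, hv⟩ := (lTensor_exact X hex hgs (z - w)).1 (by
      change G (z - w) = 0
      rw [map_sub, hwz, sub_self])
    refine ⟨Submodule.Quotient.mk v, ?_⟩
    refine (Submodule.Quotient.eq _).2 ?_
    change LinearMap.lTensor X _ v - z ∈ _
    rw [hv, sub_sub_cancel_left]
    exact neg_mem hw
  · refine (ModuleCat.epi_iff_surjective _).2 fun z => ?_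
    induction z using BalancedTensor.induction with
    | hmk x y =>
      obtain ⟨y, rfl⟩ := hgs y
      exact ⟨mk K R x y, rfl⟩
    | hadd z w hz hw =>
      obtain ⟨z, rfl⟩ := hz
      obtain ⟨w, rfl⟩ := hw
      exact ⟨z + w, map_add _ _ _⟩

end BalancedTensor

/-! ### The composition of the functors -/

namespace BalancedTensor

open InverseMonoid

variable {K S : Type u} [CommRing K] [InverseMonoid S]

lemma op_algebraMap_smul (k : K) (u : KE K S) :
    op (algebraMap K (MonoidAlgebra K S) k) • u = k • u := by
  rw [trivial_op_smul_def]
  exact LinearMap.congr_fun ((trivialAction K S).commutes k) u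

lemma op_of_smul_single' (s : S) (e : Idem S) (k : K) :
    op (MonoidAlgebra.of K S s) • (Finsupp.single e k : KE K S) =
      Finsupp.single ⟨s⁻¹ * e.1 * s, conj_idem s e.2⟩ k := by
  rw [trivial_op_smul_def]
  simp [trivialAction]

variable {Z : Type u} [AddCommGroup Z] [Module (MonoidAlgebra K S) Z]

/-- In KE(S) one has 1·e = e⁻¹ 1 e = e, so KE(S) is a cyclic right KS-module generated by 1. -/
lemma mk_single_idem (e : Idem S) (z : Z) :
    mk K (MonoidAlgebra K S) (Finsupp.single e 1 : KE K S) z =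
      mk K _ (Finsupp.single ⟨1, mul_one 1⟩ 1) (MonoidAlgebra.of K S e.1 • z) := by
  rw [← mk_smul, op_of_smul_single]
  congr 3
  refine Subtype.ext ?_
  change _ = e.1⁻¹ * 1 * e.1
  rw [inv_of_idem e.2, mul_one, e.2]

lemma exists_eq_mk_one (t : BalancedTensor K (MonoidAlgebra K S) (KE K S) Z) :
    ∃ z, t = mk K _ (Finsupp.single ⟨1, mul_one 1⟩ 1) z := by
  induction t using BalancedTensor.induction with
  | hadd z w hz hw =>
    obtain ⟨z, rfl⟩ := hz
    obtain ⟨w, rfl⟩ := hw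
    exact ⟨z + w, (mk_add K _ _ _ _).symm⟩
  | hmk u z =>
    induction u using Finsupp.induction_linear with
    | zero => exact ⟨0, by rw [zero_mk, mk_zero]⟩
    | add u v hu hv =>
      obtain ⟨z, hz⟩ := hu
      obtain ⟨w, hw⟩ := hv
      exact ⟨z + w, by rw [add_mk, hz, hw, mk_add]⟩
    | single e k =>
      have h : (Finsupp.single e k : KE K S) = k • Finsupp.single e 1 := by
        rw [Finsupp.smul_single, smul_eq_mul, mul_one]
      exact ⟨_, by rw [h, ← op_algebraMap_smul, mk_smul, mk_single_idem]⟩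

variable [Module K Z] {T : Type u} [AddCommGroup T] [Module K T]

lemma linearCombination_of_smul (f : Idem S → Z →ₗ[K] T)
    (hf : ∀ e s z, f e (MonoidAlgebra.of K S s • z) = f ⟨s⁻¹ * e.1 * s, conj_idem s e.2⟩ z)
    (u : KE K S) (s : S) (z : Z) :
    Finsupp.linearCombination K f (op (MonoidAlgebra.of K S s) • u) z =
      Finsupp.linearCombination K f u (MonoidAlgebra.of K S s • z) := by
  induction u using Finsupp.induction_linear with
  | zero => rw [smul_zero, map_zero]; rfl
  | add u v hu hv =>
    rw [smul_add, map_add, map_add, LinearMap.add_apply, LinearMap.add_apply, hu, hv]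
  | single e k =>
    rw [op_of_smul_single', Finsupp.linearCombination_single, Finsupp.linearCombination_single,
      LinearMap.smul_apply, LinearMap.smul_apply, hf]

lemma linearCombination_smul (hZ : ∀ (k : K) (z : Z), algebraMap K (MonoidAlgebra K S) k • z = k • z)
    (f : Idem S → Z →ₗ[K] T)
    (hf : ∀ e s z, f e (MonoidAlgebra.of K S s • z) = f ⟨s⁻¹ * e.1 * s, conj_idem s e.2⟩ z)
    (u : KE K S) (r : MonoidAlgebra K S) (z : Z) :
    Finsupp.linearCombination K f (op r • u) z = Finsupp.linearCombination K f u (r • z) := by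
  induction r using MonoidAlgebra.induction_on generalizing u with
  | of s => exact linearCombination_of_smul f hf u s z
  | add r r' h h' =>
    rw [MulOpposite.op_add, add_smul, add_smul, map_add, map_add, LinearMap.add_apply, h, h']
  | smul k r h =>
    have h1 : op (k • r) • u = op r • k • u := by
      rw [Algebra.smul_def, MulOpposite.op_mul, mul_smul, op_algebraMap_smul]
    have h2 : (k • r) • z = k • r • z := by
      rw [Algebra.smul_def, mul_smul, hZ]
    rw [h1, h, h2, map_smul (Finsupp.linearCombination K f) k u, LinearMap.smul_apply]
    exact (map_smul (Finsupp.linearCombination K f u) k (r • z)).symm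

/-- The linear map `e ⊗ z ↦ f e z` on `KE(S) ⊗_{KS} Z`. -/
def liftKE (hZ : ∀ (k : K) (z : Z), algebraMap K (MonoidAlgebra K S) k • z = k • z)
    (f : Idem S → Z →ₗ[K] T)
    (hf : ∀ e s z, f e (MonoidAlgebra.of K S s • z) = f ⟨s⁻¹ * e.1 * s, conj_idem s e.2⟩ z) :
    BalancedTensor K (MonoidAlgebra K S) (KE K S) Z →ₗ[K] T :=
  lift ((LinearMap.toAddMonoidHom').comp (Finsupp.linearCombination K f).toAddMonoidHom)
    (linearCombination_smul hZ f hf)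
    (fun k u z => LinearMap.congr_fun (map_smul (Finsupp.linearCombination K f) k u) z)

lemma liftKE_mk (hZ : ∀ (k : K) (z : Z), algebraMap K (MonoidAlgebra K S) k • z = k • z)
    (f : Idem S → Z →ₗ[K] T)
    (hf : ∀ e s z, f e (MonoidAlgebra.of K S s • z) = f ⟨s⁻¹ * e.1 * s, conj_idem s e.2⟩ z)
    (e : Idem S) (z : Z) :
    liftKE hZ f hf (mk K _ (Finsupp.single e 1) z) = f e z := by
  change Finsupp.linearCombination K f (Finsupp.single e 1) z = _
  rw [Finsupp.linearCombination_single, one_smul]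

end BalancedTensor

namespace UnitalAction

open InverseMonoid

variable {K A S : Type u} [CommRing K] [Ring A] [Algebra K A] [InverseMonoid S]
  (α : UnitalAction K A S)

lemma toCrossed_δ_eq {s t : S} (h : NatLE s t) (a : A) (hs : α.unit s * a = a)
    (ht : α.unit t * a = a) : α.toCrossed (α.δ s a hs) = α.toCrossed (α.δ t a ht) := by
  refine Ideal.Quotient.eq.2 ?_
  rw [TwoSidedIdeal.mem_asIdeal]
  exact TwoSidedIdeal.subset_span ⟨s, t, a, hs, ht, h, rfl⟩

/-- Since e ≤ 1, the relations of the crossed product identify 1_e δ_e with 1_e δ_1. This is the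
point through which the defining ideal enters the comparison. -/
lemma Γ_idem (e : Idem S) : α.Γ e.1 = α.ι (α.unit e.1) :=
  α.toCrossed_δ_eq ⟨e.1, e.2, (mul_one _).symm⟩ _ (α.unit_idem _)
    (by rw [α.unit_one, one_mul])

lemma toCrossed_δ (s : S) (a : A) (h : α.unit s * a = a) :
    α.toCrossed (α.δ s a h) = α.ι a * α.Γ s := by
  refine (congrArg α.toCrossed (Subtype.ext ?_)).trans (map_mul α.toCrossed
    (α.δ 1 a (by rw [α.unit_one, one_mul])) (α.δ s (α.unit s) (α.unit_idem s)))
  refine Eq.trans ?_ (α.lmul_single 1 s a (α.unit s)).symm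
  rw [act_unit, one_mul, ← unit_central, h]
  rfl

/-- The crossed product is generated by the elements `a δ_s`. -/
lemma crossed_induction {p : α.CrossedProduct → Prop} (b : α.CrossedProduct)
    (zero : p 0) (add : ∀ x y, p x → p y → p (x + y))
    (single : ∀ (a : A) (s : S), α.unit s * a = a → p (α.ι a * α.Γ s)) : p b := by
  classical
  obtain ⟨⟨f, hf⟩, rfl⟩ := Ideal.Quotient.mk_surjective b
  -- Induction on the support keeps every partial sum inside `lSubmodule`, which linear induction on
  -- arbitrary functions would not.
  have key : ∀ (t : Finset S) (f : S →₀ A) (hf : f ∈ α.lSubmodule), f.support = t →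
      p (α.toCrossed (⟨f, hf⟩ : α.L)) := by
    intro t
    induction t using Finset.induction_on with
    | empty =>
      intro f hf ht
      obtain rfl := Finsupp.support_eq_empty.1 ht
      have h : α.toCrossed (0 : α.L) = 0 := map_zero _
      exact h ▸ zero
    | insert s t hs ih =>
      intro f hf ht
      have h1 : f.erase s ∈ α.lSubmodule := by
        intro t
        by_cases h : t = s
        · rw [h, Finsupp.erase_same, mul_zero]
        · rw [Finsupp.erase_ne h, hf t]
      have h2 : (⟨f, hf⟩ : α.L) =
          α.δ s (f s) (hf s) + (show α.L from ⟨f.erase s, h1⟩) :=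
        Subtype.ext (Finsupp.single_add_erase s f).symm
      rw [h2, map_add, toCrossed_δ]
      refine add _ _ (single _ _ (hf s)) (ih _ _ ?_)
      rw [Finsupp.support_erase, ht, Finset.erase_insert hs]
  exact key _ f hf rfl

/-! ### The comparison map to the tensor product over the crossed product. -/

variable (M : ModuleCat.{u} (Env K α.CrossedProduct))

/-- The map `a ⊗ x ↦ Γ e ι a ⊗ x` from `A ⊗_{A^e} M` to `B ⊗_{B^e} M`, `B` the crossed product. -/
def compAux (e : Idem S) :
    α.F₁Obj M →ₗ[K] BalancedTensor K (Env K α.CrossedProduct) α.CrossedProduct M :=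
  BalancedTensor.map (LinearMap.mulLeft K (α.Γ e.1) ∘ₗ α.ι.toLinearMap) (AddMonoidHom.id M)
    (fun x r y => by
      -- `Γ e` is the image of the central element 1_e, so it commutes with the image of A.
      have key : α.Γ e.1 * α.ι (op r • x) = op (α.envMap r) • (α.Γ e.1 * α.ι x) := by
        induction r using TensorProduct.induction_on with
        | zero =>
          have h1 : op (0 : Env K A) • x = 0 := zero_smul (Env K A)ᵐᵒᵖ x
          rw [h1, map_zero, map_zero, mul_zero]
          exact (zero_smul (Env K α.CrossedProduct)ᵐᵒᵖ (α.Γ e.1 * α.ι x)).symm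
        | add r r' h h' =>
          rw [MulOpposite.op_add, add_smul, map_add, mul_add, h, h', map_add, MulOpposite.op_add,
            add_smul]
        | tmul a b =>
          obtain ⟨b, rfl⟩ := op_surjective b
          have h1 : α.envMap (a ⊗ₜ op b) = α.ι a ⊗ₜ op (α.ι b) := rfl
          rw [h1, op_tmul_smul, op_tmul_smul, Γ_idem, ← map_mul, ← map_mul, ← map_mul, ← map_mul,
            ← mul_assoc, ← mul_assoc, unit_central, mul_assoc b]
      change BalancedTensor.mk K _ (α.Γ e.1 * α.ι (op r • x)) y =
        BalancedTensor.mk K _ (α.Γ e.1 * α.ι x) (α.envMap r • (show M from y))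
      rw [key]
      exact BalancedTensor.mk_smul K _ _ _ _)

lemma compAux_mk (e : Idem S) (a : A) (x : α.restrict M) :
    α.compAux M e (BalancedTensor.mk K (Env K A) a x) =
      BalancedTensor.mk K (Env K α.CrossedProduct) (α.Γ e.1 * α.ι a) (show M from x) := rfl

/-- Moving `Γ s` ⊗ `Γ s⁻¹` across the tensor sign turns `Γ e` ι(s·a) into `Γ s⁻¹` `Γ e` ι(s·a) `Γ
s`, which equals `Γ (s⁻¹ e s)` ι(a). -/
lemma compAux_of_smul (e : Idem S) (s : S) (z : α.F₁Obj M) :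
    α.compAux M e (MonoidAlgebra.of K S s • z) =
      α.compAux M ⟨s⁻¹ * e.1 * s, conj_idem s e.2⟩ z := by
  induction z using BalancedTensor.induction with
  | hadd z w hz hw => rw [smul_add, map_add, map_add, hz, hw]
  | hmk a x =>
    have h : op (α.Γ s ⊗ₜ[K] op (α.Γ s⁻¹)) • (α.Γ e.1 * α.ι (α.act s a)) =
        α.Γ (s⁻¹ * e.1 * s) * α.ι a := by
      rw [op_tmul_smul, map_mul, map_mul, mul_assoc, mul_assoc (α.Γ e.1), ← α.Γ_mul_ι s a]
      simp only [mul_assoc]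
    rw [of_smul_mk]
    exact (BalancedTensor.mk_smul K _ _ _ _).symm.trans
      (congrArg (fun b => BalancedTensor.mk K _ b (show M from x)) h)

lemma algebraMap_smul_F₁Obj (k : K) (z : α.F₁Obj M) :
    algebraMap K (MonoidAlgebra K S) k • z = k • z := by
  rw [diag_smul_def, AlgHom.commutes]
  rfl

/-- The map `e ⊗ (a ⊗ x) ↦ Γ e ι a ⊗ x` from `KE(S) ⊗_{KS} (A ⊗_{A^e} M)` to `B ⊗_{B^e} M`,
`B` the crossed product. -/
def compHom : BalancedTensor K (MonoidAlgebra K S) (KE K S) (α.F₁Obj M) →ₗ[K]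
    BalancedTensor K (Env K α.CrossedProduct) α.CrossedProduct M :=
  BalancedTensor.liftKE (α.algebraMap_smul_F₁Obj M) (α.compAux M) (α.compAux_of_smul M)

lemma compHom_mk (z : α.F₁Obj M) :
    α.compHom M (BalancedTensor.mk K _ (Finsupp.single ⟨1, mul_one 1⟩ 1) z) =
      α.compAux M ⟨1, mul_one 1⟩ z := BalancedTensor.liftKE_mk _ _ _ _ _

/-! ### The inverse of the comparison map. -/

/-- The additive map `x ↦ 1 ⊗ (1 ⊗ x)`. -/
def compUnit : M →+ BalancedTensor K (MonoidAlgebra K S) (KE K S) (α.F₁Obj M) :=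
  AddMonoidHom.mk' (fun x => BalancedTensor.mk K _ (Finsupp.single ⟨1, mul_one 1⟩ 1)
    (BalancedTensor.mk K (Env K A) (1 : A) (show α.restrict M from x))) fun _ _ =>
    (congrArg _ (BalancedTensor.mk_add K _ _ _ _)).trans (BalancedTensor.mk_add K _ _ _ _)

lemma compUnit_apply (x : M) : α.compUnit M x =
    BalancedTensor.mk K _ (Finsupp.single ⟨1, mul_one 1⟩ 1)
      (BalancedTensor.mk K (Env K A) (1 : A) (show α.restrict M from x)) := rfl

lemma ι_unit_mul_Γ (s : S) : α.ι (α.unit s) * α.Γ s = α.Γ s := by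
  rw [← act_one, ← Γ_mul_ι, map_one, mul_one]

lemma mk_one_left (a : A) (x : M) :
    BalancedTensor.mk K (Env K A) (1 : A)
      (show α.restrict M from (α.ι a ⊗ₜ[K] op (1 : α.CrossedProduct)) • x) =
      BalancedTensor.mk K (Env K A) a (show α.restrict M from x) := by
  have h : α.envMap (a ⊗ₜ op 1) = α.ι a ⊗ₜ[K] op (1 : α.CrossedProduct) := by
    change α.ι a ⊗ₜ op (α.ι 1) = _
    rw [map_one]
  have h1 := BalancedTensor.mk_smul K (Env K A) (1 : A) (a ⊗ₜ[K] op (1 : A))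
    (show α.restrict M from x)
  rw [op_tmul_smul, one_mul, one_mul] at h1
  rw [h1, ← h]
  rfl

lemma mk_one_right (a : A) (x : M) :
    BalancedTensor.mk K (Env K A) (1 : A)
      (show α.restrict M from ((1 : α.CrossedProduct) ⊗ₜ[K] op (α.ι a)) • x) =
      BalancedTensor.mk K (Env K A) a (show α.restrict M from x) := by
  have h : α.envMap (1 ⊗ₜ op a) = (1 : α.CrossedProduct) ⊗ₜ[K] op (α.ι a) := by
    change α.ι 1 ⊗ₜ op (α.ι a) = _
    rw [map_one]
  have h1 := BalancedTensor.mk_smul K (Env K A) (1 : A) ((1 : A) ⊗ₜ[K] op a)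
    (show α.restrict M from x)
  rw [op_tmul_smul, mul_one, mul_one] at h1
  rw [h1, ← h]
  rfl

lemma of_smul_mk_one (s : S) (x : M) : MonoidAlgebra.of K S s •
    (BalancedTensor.mk K (Env K A) (1 : A) (show α.restrict M from x) : α.F₁Obj M) =
      BalancedTensor.mk K (Env K A) (1 : A) (show α.restrict M from α.conj s • x) := by
  rw [of_smul_mk, act_one]
  refine (α.mk_one_left M (α.unit s) (α.conj s • x)).symm.trans ?_
  have h : (α.ι (α.unit s) ⊗ₜ[K] op (1 : α.CrossedProduct)) * α.conj s = α.conj s := by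
    change (α.ι (α.unit s) ⊗ₜ[K] op (1 : α.CrossedProduct)) * (α.Γ s ⊗ₜ op (α.Γ s⁻¹)) = _
    rw [Algebra.TensorProduct.tmul_mul_tmul, ι_unit_mul_Γ, ← op_mul, mul_one]
    rfl
  rw [← mul_smul, h]

lemma compUnit_ι (a : A) (x : M) :
    α.compUnit M ((α.ι a ⊗ₜ[K] op (1 : α.CrossedProduct)) • x) =
      α.compUnit M (((1 : α.CrossedProduct) ⊗ₜ[K] op (α.ι a)) • x) := by
  rw [compUnit_apply, compUnit_apply, mk_one_left, mk_one_right]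

lemma compUnit_idem {e : S} (he : e * e = e) (x : M) :
    α.compUnit M ((α.Γ e ⊗ₜ[K] op (1 : α.CrossedProduct)) • x) =
      α.compUnit M (((1 : α.CrossedProduct) ⊗ₜ[K] op (α.Γ e)) • x) := by
  rw [α.Γ_idem ⟨e, he⟩, compUnit_ι]

/-- Both s and s⁻¹s send the generator 1 of KE(S) to s⁻¹s. -/
lemma compUnit_conj (s : S) (x : M) :
    α.compUnit M (α.conj s • x) = α.compUnit M (α.conj (s⁻¹ * s) • x) := by
  rw [compUnit_apply, compUnit_apply, ← of_smul_mk_one, ← of_smul_mk_one,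
    ← BalancedTensor.mk_single_idem ⟨s⁻¹ * s, inv_mul_idem s⟩, ← BalancedTensor.mk_smul, op_of_smul_single]
  congr 4
  exact mul_one _

/-- Applying `compUnit_conj` to x `Γ s` identifies `Γ s` x `Γ (s s⁻¹)` with `Γ (s⁻¹ s)` x `Γ s`. The
idempotents come from A and may be moved to the other side, where `Γ s` absorbs them. -/
lemma compUnit_Γ (s : S) (x : M) :
    α.compUnit M ((α.Γ s ⊗ₜ[K] op (1 : α.CrossedProduct)) • x) =
      α.compUnit M (((1 : α.CrossedProduct) ⊗ₜ[K] op (α.Γ s)) • x) := by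
  have h := α.compUnit_conj M s (((1 : α.CrossedProduct) ⊗ₜ[K] op (α.Γ s)) • x)
  have h1 : α.conj s * ((1 : α.CrossedProduct) ⊗ₜ[K] op (α.Γ s)) =
      ((1 : α.CrossedProduct) ⊗ₜ[K] op (α.Γ (s * s⁻¹))) *
        (α.Γ s ⊗ₜ[K] op (1 : α.CrossedProduct)) := by
    change (α.Γ s ⊗ₜ op (α.Γ s⁻¹)) * _ = _
    rw [Algebra.TensorProduct.tmul_mul_tmul, Algebra.TensorProduct.tmul_mul_tmul, ← op_mul,
      ← op_mul, map_mul, mul_one, one_mul, one_mul]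
  have h2 : α.conj (s⁻¹ * s) * ((1 : α.CrossedProduct) ⊗ₜ[K] op (α.Γ s)) =
      (α.Γ (s⁻¹ * s) ⊗ₜ[K] op (1 : α.CrossedProduct)) *
        ((1 : α.CrossedProduct) ⊗ₜ[K] op (α.Γ s)) := by
    change (α.Γ (s⁻¹ * s) ⊗ₜ op (α.Γ (s⁻¹ * s)⁻¹)) * _ = _
    rw [Algebra.TensorProduct.tmul_mul_tmul, Algebra.TensorProduct.tmul_mul_tmul, ← op_mul,
      ← op_mul, inv_of_idem (inv_mul_idem s), ← map_mul, ← mul_assoc, mul_inv_mul_self, mul_one,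
      mul_one]
  rw [← mul_smul, ← mul_smul, h1, h2, mul_smul, mul_smul,
    ← α.compUnit_idem M (mul_inv_idem s), α.compUnit_idem M (inv_mul_idem s), ← mul_smul,
    ← mul_smul, Algebra.TensorProduct.tmul_mul_tmul, Algebra.TensorProduct.tmul_mul_tmul,
    ← op_mul, ← op_mul, ← map_mul, ← map_mul, ← mul_assoc, mul_inv_mul_self] at h
  rwa [mul_one] at h

/-- The trace property for the image of A and for all `Γ s` extends to products and sums. It makes
`compUnit` factor through M modulo commutators with the whole crossed product. -/
lemma compUnit_comm (b : α.CrossedProduct) (x : M) :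
    α.compUnit M ((b ⊗ₜ[K] op (1 : α.CrossedProduct)) • x) =
      α.compUnit M (((1 : α.CrossedProduct) ⊗ₜ[K] op b) • x) := by
  induction b using α.crossed_induction generalizing x with
  | zero => rw [op_zero, TensorProduct.zero_tmul, TensorProduct.tmul_zero]
  | add b c hb hc =>
    rw [MulOpposite.op_add, TensorProduct.add_tmul, TensorProduct.tmul_add, add_smul, add_smul,
      map_add, map_add, hb, hc]
  | single a s h =>
    have h1 : ((α.ι a * α.Γ s) ⊗ₜ[K] op (1 : α.CrossedProduct)) =
        (α.ι a ⊗ₜ[K] op (1 : α.CrossedProduct)) * (α.Γ s ⊗ₜ[K] op (1 : α.CrossedProduct)) := by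
      rw [Algebra.TensorProduct.tmul_mul_tmul, ← op_mul, mul_one]
    have h2 : ((1 : α.CrossedProduct) ⊗ₜ[K] op (α.ι a * α.Γ s)) =
        ((1 : α.CrossedProduct) ⊗ₜ[K] op (α.Γ s)) * ((1 : α.CrossedProduct) ⊗ₜ[K] op (α.ι a)) := by
      rw [Algebra.TensorProduct.tmul_mul_tmul, ← op_mul, mul_one]
    have h3 : ((1 : α.CrossedProduct) ⊗ₜ[K] op (α.ι a)) * (α.Γ s ⊗ₜ[K] op (1 : α.CrossedProduct)) =
        (α.Γ s ⊗ₜ[K] op (1 : α.CrossedProduct)) * ((1 : α.CrossedProduct) ⊗ₜ[K] op (α.ι a)) := by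
      rw [Algebra.TensorProduct.tmul_mul_tmul, Algebra.TensorProduct.tmul_mul_tmul, ← op_mul,
        ← op_mul, mul_one, one_mul, mul_one, one_mul]
    rw [h1, h2, mul_smul, compUnit_ι, ← mul_smul, h3, mul_smul, compUnit_Γ, mul_smul]

lemma compUnit_mul (b c d : α.CrossedProduct) (x : M) :
    α.compUnit M (((d * b * c) ⊗ₜ[K] op (1 : α.CrossedProduct)) • x) =
      α.compUnit M ((b ⊗ₜ[K] op (1 : α.CrossedProduct)) • (c ⊗ₜ[K] op d) • x) := by
  have h1 : (d * b * c) ⊗ₜ[K] op (1 : α.CrossedProduct) =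
      (d ⊗ₜ[K] op (1 : α.CrossedProduct)) * ((b * c) ⊗ₜ[K] op (1 : α.CrossedProduct)) := by
    rw [Algebra.TensorProduct.tmul_mul_tmul, ← op_mul, mul_one, mul_assoc]
  have h2 : ((1 : α.CrossedProduct) ⊗ₜ[K] op d) *
      ((b * c) ⊗ₜ[K] op (1 : α.CrossedProduct)) =
      (b ⊗ₜ[K] op (1 : α.CrossedProduct)) * (c ⊗ₜ[K] op d) := by
    rw [Algebra.TensorProduct.tmul_mul_tmul, Algebra.TensorProduct.tmul_mul_tmul, ← op_mul,
      ← op_mul, one_mul, one_mul, mul_one]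
  rw [smul_smul, ← h2, h1, mul_smul, mul_smul, compUnit_comm]

lemma compUnit_op_smul (b : α.CrossedProduct) (r : Env K α.CrossedProduct) (x : M) :
    α.compUnit M (((op r • b) ⊗ₜ[K] op (1 : α.CrossedProduct)) • x) =
      α.compUnit M ((b ⊗ₜ[K] op (1 : α.CrossedProduct)) • r • x) := by
  induction r using TensorProduct.induction_on with
  | zero =>
    have h : op (0 : Env K α.CrossedProduct) • b = 0 :=
      zero_smul (Env K α.CrossedProduct)ᵐᵒᵖ b
    have h1 : (0 : Env K α.CrossedProduct) • x = 0 := zero_smul (Env K α.CrossedProduct) x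
    rw [h, TensorProduct.zero_tmul, h1, smul_zero]
  | add r r' h h' =>
    have h1 : op (r + r') • b = op r • b + op r' • b := add_smul (op r) (op r') b
    have h2 : (r + r') • x = r • x + r' • x := add_smul r r' x
    rw [h1, h2, TensorProduct.add_tmul, add_smul, map_add, h, h', smul_add, map_add]
  | tmul c d =>
    obtain ⟨d, rfl⟩ := op_surjective d
    rw [op_tmul_smul]
    exact α.compUnit_mul M b c d x

/-- The additive map `b ⊗ x ↦ 1 ⊗ (1 ⊗ b x)`. -/
def compInv : BalancedTensor K (Env K α.CrossedProduct) α.CrossedProduct M →+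
    BalancedTensor K (MonoidAlgebra K S) (KE K S) (α.F₁Obj M) :=
  BalancedTensor.liftAdd (AddMonoidHom.mk' (fun b => (α.compUnit M).comp
      (DistribSMul.toAddMonoidHom M (b ⊗ₜ[K] op (1 : α.CrossedProduct) : Env K α.CrossedProduct)))
      fun b c => AddMonoidHom.ext fun x => by
        change α.compUnit M (((b + c) ⊗ₜ[K] op (1 : α.CrossedProduct)) • x) =
          α.compUnit M ((b ⊗ₜ[K] op (1 : α.CrossedProduct)) • x) +
          α.compUnit M ((c ⊗ₜ[K] op (1 : α.CrossedProduct)) • x)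
        rw [TensorProduct.add_tmul, add_smul, map_add])
    (α.compUnit_op_smul M)

lemma compInv_mk (b : α.CrossedProduct) (x : M) :
    α.compInv M (BalancedTensor.mk K _ b x) =
      α.compUnit M ((b ⊗ₜ[K] op (1 : α.CrossedProduct)) • x) := rfl

lemma compHom_compInv (z : BalancedTensor K (Env K α.CrossedProduct) α.CrossedProduct M) :
    α.compHom M (α.compInv M z) = z := by
  induction z using BalancedTensor.induction with
  | hadd z w hz hw => rw [map_add, map_add, hz, hw]
  | hmk b x =>
    rw [compInv_mk, compUnit_apply, compHom_mk]
    refine (α.compAux_mk M _ _ _).trans ?_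
    rw [map_one, map_one, one_mul]
    refine (BalancedTensor.mk_smul K _ _ _ _).symm.trans ?_
    rw [op_tmul_smul, one_mul, one_mul]

/-- Every element of the source of the comparison has the form 1 ⊗ z, and a ⊗ x = 1 ⊗ ax in F₁. -/
lemma compInv_surjective : Function.Surjective (α.compInv M) := by
  intro z
  obtain ⟨w, rfl⟩ := BalancedTensor.exists_eq_mk_one z
  rw [← AddMonoidHom.mem_range]
  induction w using BalancedTensor.induction with
  | hadd z w hz hw => rw [BalancedTensor.mk_add]; exact add_mem hz hw
  | hmk a x =>
    refine ⟨BalancedTensor.mk K _ (α.ι a) (show M from x), ?_⟩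
    rw [compInv_mk, compUnit_apply, mk_one_left]

/-- A left inverse of a surjective map is bijective, so the other composite needs no computation. -/
lemma compHom_bijective : Function.Bijective (α.compHom M) := by
  have h : Function.LeftInverse (α.compHom M) (α.compInv M) := α.compHom_compInv M
  refine ⟨fun z w hzw => ?_, h.surjective⟩
  obtain ⟨z, rfl⟩ := α.compInv_surjective M z
  obtain ⟨w, rfl⟩ := α.compInv_surjective M w
  rw [h, h] at hzw
  rw [hzw]

lemma compAux_naturality {M N : ModuleCat.{u} (Env K α.CrossedProduct)} (f : M ⟶ N) (e : Idem S)
    (z : α.F₁Obj M) : α.compAux N e (α.F₁Map f z) =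
      ((tensorFunctor K (Env K α.CrossedProduct) α.CrossedProduct).map f).hom
        (α.compAux M e z) := by
  induction z using BalancedTensor.induction with
  | hmk a x => rfl
  | hadd z w hz hw =>
    rw [map_add, map_add, map_add, hz, hw]
    exact (map_add _ _ _).symm

lemma compHom_naturality {M N : ModuleCat.{u} (Env K α.CrossedProduct)} (f : M ⟶ N)
    (z : BalancedTensor K (MonoidAlgebra K S) (KE K S) (α.F₁Obj M)) :
    α.compHom N (((tensorFunctor K (MonoidAlgebra K S) (KE K S)).map (α.F₁.map f)).hom z) =
      ((tensorFunctor K (Env K α.CrossedProduct) α.CrossedProduct).map f).hom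
        (α.compHom M z) := by
  obtain ⟨w, rfl⟩ := BalancedTensor.exists_eq_mk_one z
  refine (α.compHom_mk N (α.F₁Map f w)).trans ((α.compAux_naturality f _ w).trans ?_)
  rw [compHom_mk]

/-- The functor `B ⊗_{B^e} -`, for `B` the crossed product, is the composition of
`F₁ = A ⊗_{A^e} -` and `KE(S) ⊗_{KS} -`. -/
def compIso : α.F₁ ⋙ tensorFunctor K (MonoidAlgebra K S) (KE K S) ≅
    tensorFunctor K (Env K α.CrossedProduct) α.CrossedProduct :=
  NatIso.ofComponents
    (fun M => (LinearEquiv.ofBijective (α.compHom M) (α.compHom_bijective M)).toModuleIso)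
    (fun f => ModuleCat.hom_ext (LinearMap.ext fun z => α.compHom_naturality f z))

end UnitalAction

/-! ### Von Neumann regular rings -/

/-- A commutative ring in which every element `r` has the form `r x r` has only flat modules. -/
theorem Module.Flat.of_forall_exists_mul_mul_self {R : Type*} [CommRing R]
    (hR : ∀ r : R, ∃ x, r * x * r = r) (M : Type*) [AddCommGroup M] [Module R M] :
    Module.Flat R M := by
  rw [Module.Flat.iff_lTensor_injective]
  intro I hI
  -- From r = r x r the ideal satisfies I = I². Being finitely generated, it is then generated by an
  -- idempotent e, and multiplication by e is a retraction of its inclusion.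
  have hII : IsIdempotentElem I := by
    refine le_antisymm Ideal.mul_le_left fun r hr => ?_
    obtain ⟨x, hx⟩ := hR r
    rw [← hx]
    exact Ideal.mul_mem_mul (I.mul_mem_right x hr) hr
  obtain ⟨e, he, rfl⟩ := (Ideal.isIdempotentElem_iff_of_fg I hI).1 hII
  let g : R →ₗ[R] (R ∙ e : Ideal R) := LinearMap.toSpanSingleton R _ ⟨e, Ideal.mem_span_singleton_self e⟩
  have h : g ∘ₗ (R ∙ e : Ideal R).subtype = LinearMap.id := by
    refine LinearMap.ext fun ⟨r, hr⟩ => Subtype.ext ?_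
    obtain ⟨c, rfl⟩ := Ideal.mem_span_singleton'.1 hr
    change c * e * e = c * e
    rw [mul_assoc, he.eq]
  have h1 : g.lTensor M ∘ₗ (R ∙ e : Ideal R).subtype.lTensor M = LinearMap.id := by
    rw [← LinearMap.lTensor_comp, h, LinearMap.lTensor_id]
  exact Function.LeftInverse.injective (LinearMap.congr_fun h1)

namespace InverseMonoid

variable {K S : Type u} [Field K] [InverseMonoid S]

instance : CommMonoid (Idem S) where
  mul e f := ⟨e.1 * f.1, idem_mul_idem e.2 f.2⟩
  one := ⟨1, mul_one 1⟩
  mul_assoc e f g := Subtype.ext (mul_assoc e.1 f.1 g.1)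
  one_mul e := Subtype.ext (one_mul e.1)
  mul_one e := Subtype.ext (mul_one e.1)
  mul_comm e f := Subtype.ext (idem_comm e.2 f.2)

variable (S) in
/-- The inclusion of the idempotents. -/
def idemVal : Idem S →* S where
  toFun := Subtype.val
  map_one' := rfl
  map_mul' _ _ := rfl

lemma idem_mul_self (e : Idem S) : e * e = e := Subtype.ext e.2

/-- Each new idempotent ε splits the ring as a product, on whose factors the element differs from a
shorter one by constants. The induction therefore has to allow an arbitrary added constant. -/
lemma exists_mul_mul_self (r : MonoidAlgebra K (Idem S)) : ∃ x, r * x * r = r := by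
  suffices ∀ c : K, ∃ x, (r + algebraMap K _ c) * x * (r + algebraMap K _ c) =
      r + algebraMap K _ c by
    have h := this 0
    rwa [map_zero, add_zero] at h
  induction r using MonoidAlgebra.induction with
  | zero =>
    intro c
    refine ⟨algebraMap K _ c⁻¹, ?_⟩
    rw [zero_add, ← map_mul, ← map_mul]
    congr 1
    rcases eq_or_ne c 0 with rfl | hc
    · simp
    · rw [mul_inv_cancel₀ hc, one_mul]
  | single_add e k r _ _ ih =>
    intro c
    obtain ⟨x, hx⟩ := ih (c + k)
    obtain ⟨y, hy⟩ := ih c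
    have he : (MonoidAlgebra.of K (Idem S) e) * (MonoidAlgebra.of K (Idem S) e) =
        MonoidAlgebra.of K (Idem S) e := by rw [← map_mul, idem_mul_self]
    have hk : MonoidAlgebra.single e k =
        algebraMap K (MonoidAlgebra K (Idem S)) k * MonoidAlgebra.of K (Idem S) e := by
      rw [← Algebra.smul_def]
      simp
    generalize MonoidAlgebra.of K (Idem S) e = ε at he hk
    refine ⟨x * ε + y * (1 - ε), ?_⟩
    rw [map_add] at hx
    rw [hk]
    generalize algebraMap K (MonoidAlgebra K (Idem S)) k = κ at *
    generalize algebraMap K (MonoidAlgebra K (Idem S)) c = γ at *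
    -- On the factor of ε the element is r + (γ + κ), with quasi-inverse x; on the factor of 1 - ε
    -- it is r + γ, with quasi-inverse y.
    have h1 : κ * ε + r + γ = (r + (γ + κ)) * ε + (r + γ) * (1 - ε) := by ring
    have h2 : ε * (1 - ε) = 0 := by rw [mul_sub, mul_one, he, sub_self]
    have h3 : (1 - ε) * (1 - ε) = 1 - ε := by rw [sub_mul, one_mul, h2, sub_zero]
    rw [h1]
    generalize r + (γ + κ) = p at *
    generalize r + γ = q at *
    generalize 1 - ε = ε' at *
    linear_combination ε * hx + ε' * hy + (p * x * p * ε + p * x * p) * he +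
      (q * y * q * ε' + q * y * q) * h3 + (p ^ 2 * y * ε + 2 * p * q * x * ε + 2 * p * q * y * ε' + q ^ 2 * x * ε') * h2

instance flat (M : Type*) [AddCommGroup M] [Module (MonoidAlgebra K (Idem S)) M] :
    Module.Flat (MonoidAlgebra K (Idem S)) M :=
  Module.Flat.of_forall_exists_mul_mul_self exists_mul_mul_self M

/-! ### Induced modules -/

variable (K S) in
/-- The inclusion of `K[E(S)]` into `K[S]`. -/
def idemAlg : MonoidAlgebra K (Idem S) →ₐ[K] MonoidAlgebra K S :=
  MonoidAlgebra.lift K _ (Idem S) ((MonoidAlgebra.of K S).comp (idemVal S))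

lemma idemAlg_of (e : Idem S) :
    idemAlg K S (MonoidAlgebra.of K (Idem S) e) = MonoidAlgebra.of K S e.1 := by
  rw [idemAlg, MonoidAlgebra.lift_of]; rfl

/-- The action of the commutative algebra `K[E(S)]` on `K[S]` by right multiplication. -/
instance idemModule : Module (MonoidAlgebra K (Idem S)) (MonoidAlgebra K S) where
  smul c w := w * idemAlg K S c
  one_smul w := by change w * _ = w; rw [map_one, mul_one]
  mul_smul c d w := by
    change w * _ = w * _ * _
    rw [mul_comm c d, map_mul, mul_assoc]
  smul_zero c := zero_mul _
  smul_add _ _ _ := add_mul _ _ _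
  add_smul c d w := by change w * _ = w * _ + w * _; rw [map_add, mul_add]
  zero_smul w := by change w * _ = 0; rw [map_zero, mul_zero]

instance : SMulCommClass (MonoidAlgebra K (Idem S)) (MonoidAlgebra K S) (MonoidAlgebra K S) where
  smul_comm c r w := mul_assoc r w (idemAlg K S c)

/-- Restriction of scalars from `K[S]` to `K[E(S)]`. -/
abbrev resIdem (N : ModuleCat.{u} (MonoidAlgebra K S)) :
    ModuleCat.{u} (MonoidAlgebra K (Idem S)) :=
  (ModuleCat.restrictScalars (idemAlg K S).toRingHom).obj N

variable (K S) in
/-- The underlying module of the induced module `K[S] ⊗_{K[E(S)]} U`. -/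
abbrev IndObj (U : ModuleCat.{u} (MonoidAlgebra K (Idem S))) : Type u :=
  MonoidAlgebra K S ⊗[MonoidAlgebra K (Idem S)] U

lemma tmul_idem_smul {U : ModuleCat.{u} (MonoidAlgebra K (Idem S))} (w : MonoidAlgebra K S)
    (c : MonoidAlgebra K (Idem S)) (u : U) :
    (w * idemAlg K S c) ⊗ₜ[MonoidAlgebra K (Idem S)] u = w ⊗ₜ[MonoidAlgebra K (Idem S)] (c • u) :=
  TensorProduct.smul_tmul c w u

lemma indHom_ext {U : ModuleCat.{u} (MonoidAlgebra K (Idem S))} {N : Type*} [AddCommGroup N]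
    [Module (MonoidAlgebra K S) N] {f g : IndObj K S U →ₗ[MonoidAlgebra K S] N}
    (h : ∀ u, f (1 ⊗ₜ u) = g (1 ⊗ₜ u)) : f = g := by
  refine LinearMap.ext fun z => ?_
  induction z using TensorProduct.induction_on with
  | zero => rw [map_zero, map_zero]
  | add z w hz hw => rw [map_add, map_add, hz, hw]
  | tmul w u =>
    have h1 : w ⊗ₜ[MonoidAlgebra K (Idem S)] u =
        w • ((1 : MonoidAlgebra K S) ⊗ₜ[MonoidAlgebra K (Idem S)] u) := by
      rw [TensorProduct.smul_tmul', smul_eq_mul, mul_one]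
    rw [h1, map_smul, map_smul, h]

/-- The homomorphism `w ⊗ u ↦ w • h u`. -/
def indLift {U : ModuleCat.{u} (MonoidAlgebra K (Idem S))}
    {N : ModuleCat.{u} (MonoidAlgebra K S)} (h : U ⟶ resIdem N) :
    IndObj K S U →ₗ[MonoidAlgebra K S] N where
  toFun := TensorProduct.liftAddHom
    (AddMonoidHom.mk' (fun w => (DistribSMul.toAddMonoidHom N w).comp
      h.hom.toAddMonoidHom) fun w w' =>
      AddMonoidHom.ext fun u => add_smul w w' (show N from h.hom u))
    (fun c w u => by
      change (w * idemAlg K S c) • (show N from h.hom u) = w • (show N from h.hom (c • u))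
      rw [mul_smul, h.hom.map_smul]
      rfl)
  map_add' := map_add _
  map_smul' r z := by
    induction z using TensorProduct.induction_on with
    | zero => rw [smul_zero, map_zero]; exact (smul_zero r).symm
    | add z w hz hw => rw [smul_add, map_add, map_add, smul_add, hz, hw]
    | tmul w u => exact mul_smul r w (show N from h.hom u)

/-- The homomorphism of induced modules given by a homomorphism. -/
def indMap {U V : ModuleCat.{u} (MonoidAlgebra K (Idem S))} (f : U ⟶ V) :
    IndObj K S U →ₗ[MonoidAlgebra K S] IndObj K S V where
  toFun := f.hom.lTensor (MonoidAlgebra K S)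
  map_add' := map_add _
  map_smul' r z := by
    induction z using TensorProduct.induction_on with
    | zero => rw [smul_zero, map_zero]; exact (smul_zero r).symm
    | add z w hz hw => rw [smul_add, map_add, map_add, smul_add, hz, hw]
    | tmul w u => rfl

variable (K S) in
/-- The functor `U ↦ K[S] ⊗_{K[E(S)]} U`. -/
def ind : ModuleCat.{u} (MonoidAlgebra K (Idem S)) ⥤ ModuleCat.{u} (MonoidAlgebra K S) where
  obj U := ModuleCat.of _ (IndObj K S U)
  map f := ModuleCat.ofHom (indMap f)
  map_id _ := ModuleCat.hom_ext (indHom_ext fun _ => rfl)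
  map_comp _ _ := ModuleCat.hom_ext (indHom_ext fun _ => rfl)

instance : (ind K S).Additive where
  map_add := ModuleCat.hom_ext (indHom_ext fun _ => TensorProduct.tmul_add _ _ _)

/-- K[S] is flat over K[E(S)], as every module over that von Neumann regular ring is. -/
instance : (ind K S).PreservesHomology := by
  refine ((ind K S).exact_tfae.out 1 2 rfl rfl).1 fun T hT => ?_
  rw [ShortComplex.ShortExact.moduleCat_exact_iff_function_exact] at hT ⊢
  exact Module.Flat.lTensor_exact (MonoidAlgebra K S) hT

/-- Maps out of an induced module are maps into the restricted module, and restriction of scalars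
preserves epimorphisms. -/
instance : (ind K S).PreservesProjectiveObjects where
  projective_obj {U} hU := ⟨fun {N N'} f g hg => by
    let h₀ : U →ₗ[MonoidAlgebra K (Idem S)] resIdem N' :=
      { toFun := fun u => f.hom ((1 : MonoidAlgebra K S) ⊗ₜ u)
        map_add' := fun u v =>
          (congrArg f.hom (TensorProduct.tmul_add _ _ _)).trans (map_add f.hom _ _)
        map_smul' := fun c u => by
          refine Eq.trans ?_ (map_smul f.hom (idemAlg K S c)
            ((1 : MonoidAlgebra K S) ⊗ₜ[MonoidAlgebra K (Idem S)] u))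
          refine congrArg f.hom ?_
          rw [← tmul_idem_smul, one_mul, TensorProduct.smul_tmul', smul_eq_mul, mul_one] }
    let h : U ⟶ resIdem N' := ModuleCat.ofHom (Y := resIdem N') h₀
    let g' := (ModuleCat.restrictScalars (idemAlg K S).toRingHom).map g
    have hg' : Epi g' := (ModuleCat.epi_iff_surjective _).2 ((ModuleCat.epi_iff_surjective g).1 hg)
    have hh : Projective.factorThru h g' ≫ g' = h := Projective.factorThru_comp h g'
    refine ⟨ModuleCat.ofHom (indLift (Projective.factorThru h g')), ?_⟩
    refine ModuleCat.hom_ext (indHom_ext fun u => ?_)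
    refine (congrArg g.hom (one_smul _ _)).trans ?_
    exact congrArg (fun k => k.hom u) hh⟩

end InverseMonoid

/-! ### Acyclicity of induced modules -/

namespace InverseMonoid

variable {K S : Type u} [Field K] [InverseMonoid S]

variable (K S) in
/-- The identification of `KE(S)` with `K[E(S)]`. -/
def idemCoeff : KE K S →ₗ[K] MonoidAlgebra K (Idem S) :=
  Finsupp.linearCombination K (MonoidAlgebra.of K (Idem S))

lemma idemCoeff_single (e : Idem S) (k : K) :
    idemCoeff K S (Finsupp.single e k) = k • MonoidAlgebra.of K (Idem S) e :=
  Finsupp.linearCombination_single _ _ _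

/-- An idempotent f acts on KE(S) by e ↦ f e f = e f, so KE(S) restricted to K[E(S)] is the regular
module. -/
lemma idemCoeff_op_smul (c : MonoidAlgebra K (Idem S)) (x : KE K S) :
    idemCoeff K S (op (idemAlg K S c) • x) = idemCoeff K S x * c := by
  induction c using MonoidAlgebra.induction_on generalizing x with
  | of f =>
    induction x using Finsupp.induction_linear with
    | zero => rw [smul_zero, map_zero, zero_mul]
    | add x y hx hy => rw [smul_add, map_add, map_add, add_mul, hx, hy]
    | single e k =>
      rw [idemAlg_of, BalancedTensor.op_of_smul_single', idemCoeff_single, idemCoeff_single,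
        smul_mul_assoc, ← map_mul]
      congr 2
      refine Subtype.ext ?_
      change f.1⁻¹ * e.1 * f.1 = e.1 * f.1
      rw [inv_of_idem f.2, idem_comm f.2 e.2, mul_assoc, f.2]
  | add c d hc hd => rw [map_add, MulOpposite.op_add, add_smul, map_add, hc, hd, mul_add]
  | smul k c hc =>
    rw [Algebra.smul_def, map_mul, AlgHom.commutes, MulOpposite.op_mul, mul_smul,
      BalancedTensor.op_algebraMap_smul, hc, map_smul, Algebra.smul_def, mul_assoc,
      mul_left_comm]

/-- Restriction of scalars from `K[E(S)]` to `K`. -/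
abbrev resField : ModuleCat.{u} (MonoidAlgebra K (Idem S)) ⥤ ModuleCat.{u} K :=
  ModuleCat.restrictScalars (algebraMap K (MonoidAlgebra K (Idem S)))

variable (U : ModuleCat.{u} (MonoidAlgebra K (Idem S)))

/-- The map `w ⊗ u ↦ (x w) u`. -/
def coindAux (x : KE K S) : IndObj K S U →+ U :=
  TensorProduct.liftAddHom
    (AddMonoidHom.mk' (fun w => (DistribSMul.toAddMonoidHom U (idemCoeff K S (op w • x))))
      fun w w' => AddMonoidHom.ext fun u => by
        change idemCoeff K S (op (w + w') • x) • u =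
          idemCoeff K S (op w • x) • u + idemCoeff K S (op w' • x) • u
        rw [MulOpposite.op_add, add_smul, map_add, add_smul])
    (fun c w u => by
      change idemCoeff K S (op (w * idemAlg K S c) • x) • u = idemCoeff K S (op w • x) • c • u
      rw [MulOpposite.op_mul, mul_smul, idemCoeff_op_smul, mul_smul])

lemma coindAux_tmul (x : KE K S) (w : MonoidAlgebra K S) (u : U) :
    coindAux U x (w ⊗ₜ u) = idemCoeff K S (op w • x) • u := rfl

lemma coindAux_add (x y : KE K S) (z : IndObj K S U) :
    coindAux U (x + y) z = coindAux U x z + coindAux U y z := by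
  induction z using TensorProduct.induction_on with
  | zero => rw [map_zero, map_zero, map_zero, add_zero]
  | add z w hz hw => rw [map_add, map_add, map_add, hz, hw, add_add_add_comm]
  | tmul w u => rw [coindAux_tmul, coindAux_tmul, coindAux_tmul, smul_add, map_add, add_smul]

lemma coindAux_op_smul (x : KE K S) (r : MonoidAlgebra K S) (z : IndObj K S U) :
    coindAux U (op r • x) z = coindAux U x (r • z) := by
  induction z using TensorProduct.induction_on with
  | zero => rw [smul_zero, map_zero, map_zero]
  | add z w hz hw => rw [smul_add, map_add, map_add, hz, hw]
  | tmul w u =>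
    rw [TensorProduct.smul_tmul', coindAux_tmul, coindAux_tmul, smul_eq_mul, MulOpposite.op_mul,
      mul_smul]

lemma coindAux_smul (k : K) (x : KE K S) (z : IndObj K S U) :
    coindAux U (k • x) z = algebraMap K (MonoidAlgebra K (Idem S)) k • coindAux U x z := by
  induction z using TensorProduct.induction_on with
  | zero => rw [map_zero, map_zero, smul_zero]
  | add z w hz hw => rw [map_add, map_add, smul_add, hz, hw]
  | tmul w u =>
    have h : op w • k • x = k • op w • x := (smul_comm k (op w) x).symm
    rw [coindAux_tmul, coindAux_tmul, h, map_smul, Algebra.smul_def, mul_smul]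

/-- The map `x ⊗ (w ⊗ u) ↦ (x w) u`. -/
def coindHom : BalancedTensor K (MonoidAlgebra K S) (KE K S) (IndObj K S U) →ₗ[K]
    (resField.obj U : ModuleCat.{u} K) :=
  BalancedTensor.lift
    (AddMonoidHom.mk' (coindAux U) fun x y => AddMonoidHom.ext (coindAux_add U x y))
    (coindAux_op_smul U) (coindAux_smul U)

lemma coindHom_mk (x : KE K S) (w : MonoidAlgebra K S) (u : U) :
    coindHom U (BalancedTensor.mk K _ x (w ⊗ₜ u)) = idemCoeff K S (op w • x) • u := rfl

lemma coindHom_mk_one (u : U) :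
    coindHom U (BalancedTensor.mk K _ (Finsupp.single ⟨1, mul_one 1⟩ 1) (1 ⊗ₜ u)) = u := by
  rw [coindHom_mk, op_one, one_smul, idemCoeff_single, one_smul]
  exact (congrArg (fun c => c • u) (map_one (MonoidAlgebra.of K (Idem S)))).trans (one_smul _ u)

/-- Since 1·s = 1·(s⁻¹s), the factor s in 1 ⊗ (s ⊗ u) may be replaced by an idempotent, which then
passes into U. -/
lemma exists_eq_mk_one_tmul (t : BalancedTensor K (MonoidAlgebra K S) (KE K S) (IndObj K S U)) :
    ∃ u : U, t = BalancedTensor.mk K _ (Finsupp.single ⟨1, mul_one 1⟩ 1) (1 ⊗ₜ u) := by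
  obtain ⟨z, rfl⟩ := BalancedTensor.exists_eq_mk_one t
  induction z using TensorProduct.induction_on with
  | zero => exact ⟨0, by rw [TensorProduct.tmul_zero]⟩
  | add z w hz hw =>
    obtain ⟨u, hu⟩ := hz
    obtain ⟨v, hv⟩ := hw
    exact ⟨u + v, by rw [BalancedTensor.mk_add, TensorProduct.tmul_add, BalancedTensor.mk_add,
      hu, hv]⟩
  | tmul w u =>
    induction w using MonoidAlgebra.induction_on generalizing u with
    | of s =>
      refine ⟨MonoidAlgebra.of K (Idem S) ⟨s⁻¹ * 1 * s, conj_idem s (mul_one 1)⟩ • u, ?_⟩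
      rw [← tmul_idem_smul, idemAlg_of, one_mul]
      have h : ∀ t : S, MonoidAlgebra.of K S t ⊗ₜ[MonoidAlgebra K (Idem S)] u =
          MonoidAlgebra.of K S t •
            ((1 : MonoidAlgebra K S) ⊗ₜ[MonoidAlgebra K (Idem S)] u) := fun t => by
        rw [TensorProduct.smul_tmul', smul_eq_mul, mul_one]
      rw [h, h, ← BalancedTensor.mk_smul, op_of_smul_single, BalancedTensor.mk_single_idem]
    | add w w' h h' =>
      obtain ⟨v, hv⟩ := h u
      obtain ⟨v', hv'⟩ := h' u
      exact ⟨v + v', by rw [TensorProduct.add_tmul, BalancedTensor.mk_add,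
        TensorProduct.tmul_add, BalancedTensor.mk_add, hv, hv']⟩
    | smul k w h =>
      obtain ⟨v, hv⟩ := h (algebraMap K (MonoidAlgebra K (Idem S)) k • u)
      refine ⟨v, ?_⟩
      rw [← hv, ← tmul_idem_smul, AlgHom.commutes, Algebra.smul_def, Algebra.commutes]

lemma coindHom_bijective : Function.Bijective (coindHom U) := by
  refine ⟨fun t t' h => ?_, fun u => ⟨_, coindHom_mk_one U u⟩⟩
  obtain ⟨u, rfl⟩ := exists_eq_mk_one_tmul U t
  obtain ⟨v, rfl⟩ := exists_eq_mk_one_tmul U t'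
  rw [coindHom_mk_one, coindHom_mk_one] at h
  obtain rfl : u = v := h
  rfl

/-- `KE(S) ⊗_{K[S]} (K[S] ⊗_{K[E(S)]} U)` is naturally isomorphic to `U`. -/
def indCompIso : ind K S ⋙ tensorFunctor K (MonoidAlgebra K S) (KE K S) ≅ resField :=
  NatIso.ofComponents
    (fun U => (LinearEquiv.ofBijective (coindHom U) (coindHom_bijective U)).toModuleIso)
    (fun {U V} f => ModuleCat.hom_ext (LinearMap.ext fun t => by
      obtain ⟨u, rfl⟩ := exists_eq_mk_one_tmul U t
      exact (coindHom_mk_one V (f.hom u)).trans (congrArg f.hom (coindHom_mk_one U u).symm)))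

end InverseMonoid

instance ModuleCat.preservesHomology_restrictScalars {R S : Type u} [Ring R] [Ring S]
    (f : R →+* S) : (ModuleCat.restrictScalars.{u} f).PreservesHomology := by
  refine ((ModuleCat.restrictScalars.{u} f).exact_tfae.out 1 2 rfl rfl).1 fun T hT => ?_
  rw [ShortComplex.ShortExact.moduleCat_exact_iff_function_exact] at hT ⊢
  exact hT

/-- Derived functors in positive degree vanish on the image of an exact functor `G` preserving
projectives if `G ⋙ F` is isomorphic to an exact functor. -/
theorem CategoryTheory.Functor.isZero_leftDerived_obj_of_iso {C D E : Type*} [Category* C]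
    [Abelian C] [EnoughProjectives C] [Category* D] [Abelian D] [EnoughProjectives D]
    [Category* E] [Abelian E] (G : C ⥤ D) [G.Additive] [G.PreservesHomology]
    [G.PreservesProjectiveObjects] (F : D ⥤ E) [F.Additive] {H : C ⥤ E} [H.Additive]
    [H.PreservesHomology] (i : G ⋙ F ≅ H) (U : C) (n : ℕ) :
    Limits.IsZero ((F.leftDerived (n + 1)).obj (G.obj U)) := by
  let Q := ProjectiveResolution.of U
  refine Limits.IsZero.of_iso ?_ ((G.mapProjectiveResolution Q).isoLeftDerivedObj F (n + 1))
  have h : ((H.mapHomologicalComplex _).obj Q.complex).ExactAt (n + 1) :=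
    ShortComplex.Exact.map (Q.complex_exactAt_succ n) H
  have j : (H.mapHomologicalComplex _).obj Q.complex ≅
      (F.mapHomologicalComplex _).obj (G.mapProjectiveResolution Q).complex :=
    ((NatIso.mapHomologicalComplex i _).app Q.complex).symm
  exact (h.of_iso j).isZero_homology

namespace InverseMonoid

variable {K S : Type u} [Field K] [InverseMonoid S]

lemma isZero_tor_ind (U : ModuleCat.{u} (MonoidAlgebra K (Idem S))) (n : ℕ) :
    Limits.IsZero (((tensorFunctor K (MonoidAlgebra K S) (KE K S)).leftDerived (n + 1)).obj
      ((ind K S).obj U)) :=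
  (ind K S).isZero_leftDerived_obj_of_iso _ indCompIso U n

end InverseMonoid

/-! ### Acyclicity of `F₁ P` for `P` projective -/

lemma MonoidAlgebra.map_smul_of_forall {K G M N : Type*} [CommRing K] [Monoid G] [AddCommGroup M]
    [Module (MonoidAlgebra K G) M] [AddCommGroup N] [Module (MonoidAlgebra K G) N] (f : M →+ N)
    (hG : ∀ g x, f (MonoidAlgebra.of K G g • x) = MonoidAlgebra.of K G g • f x)
    (hK : ∀ k x, f (algebraMap K (MonoidAlgebra K G) k • x) =
      algebraMap K (MonoidAlgebra K G) k • f x)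
    (r : MonoidAlgebra K G) (x : M) : f (r • x) = r • f x := by
  induction r using MonoidAlgebra.induction_on with
  | of g => exact hG g x
  | add r s hr hs => rw [add_smul, map_add, hr, hs, add_smul]
  | smul k r hr => rw [Algebra.smul_def, mul_smul, hK, hr, mul_smul]

namespace InverseMonoid

variable {S : Type u} [InverseMonoid S]

lemma inv_inv' (s : S) : s⁻¹⁻¹ = s :=
  (inv_unique s⁻¹ s (inv_mul_inv_self s) (mul_inv_mul_self s)).symm

/-- This rule carries idempotents from the right of s to its left, conjugating them. -/
lemma mul_idem_eq (s : S) {e : S} (he : e * e = e) : s * e = s * e * s⁻¹ * s := by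
  calc s * e = s * (s⁻¹ * s * e) := by rw [← mul_assoc, ← mul_assoc, mul_inv_mul_self]
    _ = s * e * s⁻¹ * s := by rw [idem_comm (inv_mul_idem s) he]; simp only [mul_assoc]

lemma conj_idem' (s : S) {e : S} (he : e * e = e) :
    (s * e * s⁻¹) * (s * e * s⁻¹) = s * e * s⁻¹ := by
  have h := conj_idem s⁻¹ he
  rwa [inv_inv'] at h

end InverseMonoid

namespace UnitalAction

open InverseMonoid

variable {K A S : Type u} [Field K] [Ring A] [Algebra K A] [InverseMonoid S]
  (α : UnitalAction K A S)

lemma act_idem (e : Idem S) (a : A) : α.act e.1 a = α.unit e.1 * a := by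
  have h := α.act_inv_act e.1 a
  rwa [inv_of_idem e.2, act_act, e.2] at h

lemma act_inv_unit_mul (s : S) (a : A) :
    α.unit (s⁻¹ * s) * α.act s⁻¹ a = α.act s⁻¹ (α.unit s * a) := by
  rw [← act_unit, ← act_mul]

lemma act_act_inv (s : S) (a : A) : α.act s (α.act s⁻¹ a) = α.unit s * a := by
  have h := α.act_inv_act s⁻¹ a
  rwa [inv_inv'] at h

lemma Γ_idem_mul_ι (e : Idem S) (a : A) : α.Γ e.1 * α.ι a = α.ι a * α.Γ e.1 := by
  rw [Γ_idem, ← map_mul, ← map_mul, unit_central]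

/-- The inclusion of the monoid algebra of idempotents into the enveloping algebra of the crossed
product, `e ↦ Γ e ⊗ 1`. -/
def idemEnv : MonoidAlgebra K (Idem S) →ₐ[K] Env K α.CrossedProduct :=
  MonoidAlgebra.lift K _ (Idem S)
    (((Algebra.TensorProduct.includeLeft : α.CrossedProduct →ₐ[K] Env K α.CrossedProduct) :
      α.CrossedProduct →* Env K α.CrossedProduct).comp (α.Γ.comp (idemVal S)))

lemma idemEnv_of (e : Idem S) : α.idemEnv (MonoidAlgebra.of K (Idem S) e) =
    α.Γ e.1 ⊗ₜ[K] op (1 : α.CrossedProduct) := by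
  rw [idemEnv, MonoidAlgebra.lift_of]; rfl

/-- A bimodule over the crossed product as a module over the algebra of idempotents. -/
abbrev resEnv (P : ModuleCat.{u} (Env K α.CrossedProduct)) :
    ModuleCat.{u} (MonoidAlgebra K (Idem S)) :=
  (ModuleCat.restrictScalars α.idemEnv.toRingHom).obj P

/-! ### The retraction of the induced module onto F₁ P. -/

variable (P : ModuleCat.{u} (Env K α.CrossedProduct))

/-- The map `x ↦ 1 ⊗ x`. -/
def mkOne : P →+ α.F₁Obj P :=
  AddMonoidHom.mk' (fun x => BalancedTensor.mk K (Env K A) (1 : A) (show α.restrict P from x))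
    (fun _ _ => BalancedTensor.mk_add K _ _ _ _)

lemma mkOne_ι (a : A) (x : P) : α.mkOne P ((α.ι a ⊗ₜ[K] op (1 : α.CrossedProduct)) • x) =
    α.mkOne P (((1 : α.CrossedProduct) ⊗ₜ[K] op (α.ι a)) • x) :=
  (α.mk_one_left P a x).trans (α.mk_one_right P a x).symm

lemma of_smul_mkOne (s : S) (x : P) :
    MonoidAlgebra.of K S s • α.mkOne P x = α.mkOne P (α.conj s • x) := α.of_smul_mk_one P s x

lemma algebraMap_smul_mkOne (k : K) (x : P) : algebraMap K (MonoidAlgebra K S) k • α.mkOne P x =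
    α.mkOne P (algebraMap K (Env K α.CrossedProduct) k • x) := by
  have h : algebraMap K (Env K α.CrossedProduct) k =
      α.ι (algebraMap K A k) ⊗ₜ[K] op (1 : α.CrossedProduct) := by
    rw [AlgHom.commutes]; rfl
  rw [algebraMap_smul_F₁Obj, h]
  refine Eq.trans ?_ (α.mk_one_left P (algebraMap K A k) x).symm
  rw [Algebra.algebraMap_eq_smul_one]
  rfl

/-- Modulo commutators with A, the right factor `Γ e` moves to the left and merges there. So on
classes 1 ⊗ x an idempotent acts through left multiplication alone, which is the action chosen on
`resEnv`. -/
lemma mkOne_conj_idem (e : Idem S) (x : P) : α.mkOne P (α.conj e.1 • x) =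
    α.mkOne P ((α.Γ e.1 ⊗ₜ[K] op (1 : α.CrossedProduct)) • x) := by
  have h : α.conj e.1 = ((1 : α.CrossedProduct) ⊗ₜ[K] op (α.ι (α.unit e.1))) *
      (α.ι (α.unit e.1) ⊗ₜ[K] op (1 : α.CrossedProduct)) := by
    rw [Algebra.TensorProduct.tmul_mul_tmul, ← op_mul, one_mul, ← Γ_idem]
    change α.Γ e.1 ⊗ₜ[K] op (α.Γ e.1⁻¹) = _
    rw [inv_of_idem e.2]
  have h2 : (α.ι (α.unit e.1) ⊗ₜ[K] op (1 : α.CrossedProduct)) *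
      (α.ι (α.unit e.1) ⊗ₜ[K] op (1 : α.CrossedProduct)) =
      α.ι (α.unit e.1) ⊗ₜ[K] op (1 : α.CrossedProduct) := by
    rw [Algebra.TensorProduct.tmul_mul_tmul, ← op_mul, one_mul, ← map_mul, unit_idem]
  rw [h, mul_smul, ← mkOne_ι, smul_smul, h2, Γ_idem]

/-- The map `x ↦ 1 ⊗ x` as a homomorphism of modules over the algebra of idempotents. -/
def unitHom : α.resEnv P →ₗ[MonoidAlgebra K (Idem S)] resIdem (α.F₁.obj P) :=
  let f : α.resEnv P →+ resIdem (α.F₁.obj P) := α.mkOne P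
  { f with
    map_smul' := MonoidAlgebra.map_smul_of_forall f
      (fun e (x : P) => by
        change α.mkOne P (α.idemEnv (MonoidAlgebra.of K (Idem S) e) • x) =
          idemAlg K S (MonoidAlgebra.of K (Idem S) e) • α.mkOne P x
        rw [idemEnv_of, idemAlg_of, of_smul_mkOne, mkOne_conj_idem])
      (fun k (x : P) => by
        change α.mkOne P (α.idemEnv (algebraMap K _ k) • x) =
          idemAlg K S (algebraMap K _ k) • α.mkOne P x
        rw [AlgHom.commutes, AlgHom.commutes, algebraMap_smul_mkOne]) }

/-- The homomorphism `s ⊗ x ↦ s • (1 ⊗ x)`. -/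
def retraction : IndObj K S (α.resEnv P) →ₗ[MonoidAlgebra K S] α.F₁Obj P :=
  indLift (N := α.F₁.obj P) (ModuleCat.ofHom (X := α.resEnv P) (Y := resIdem (α.F₁.obj P)) (α.unitHom P))

/-- The element `w ⊗ x` of the induced module. -/
def indMk (w : MonoidAlgebra K S) (x : P) : IndObj K S (α.resEnv P) :=
  w ⊗ₜ (show α.resEnv P from x)

lemma indMk_add (w : MonoidAlgebra K S) (x y : P) :
    α.indMk P w (x + y) = α.indMk P w x + α.indMk P w y := TensorProduct.tmul_add _ _ _

lemma smul_indMk (r w : MonoidAlgebra K S) (x : P) :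
    r • α.indMk P w x = α.indMk P (r * w) x := rfl

lemma indMk_of_mul (s : S) (e : Idem S) (x : P) : α.indMk P (MonoidAlgebra.of K S (s * e.1)) x =
    α.indMk P (MonoidAlgebra.of K S s) ((α.Γ e.1 ⊗ₜ[K] op (1 : α.CrossedProduct)) • x) := by
  rw [map_mul, ← idemAlg_of, ← idemEnv_of]
  exact tmul_idem_smul _ _ _

lemma indMk_algebraMap (k : K) (w : MonoidAlgebra K S) (x : P) :
    algebraMap K (MonoidAlgebra K S) k • α.indMk P w x =
      α.indMk P w (algebraMap K (Env K α.CrossedProduct) k • x) := by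
  rw [smul_indMk, Algebra.commutes, ← AlgHom.commutes (idemAlg K S),
    ← AlgHom.commutes α.idemEnv]
  exact tmul_idem_smul _ _ _

lemma retraction_indMk (w : MonoidAlgebra K S) (x : P) :
    α.retraction P (α.indMk P w x) = w • α.mkOne P x := rfl

/-! ### Lifting right multiplication to the induced module. -/

/-- The map `a δ_s ↦ (x ↦ s⁻¹ ⊗ (a δ_s) x)` for arbitrary finitely supported functions. -/
def preTensorAux : (S →₀ A) →+ (P →+ IndObj K S (α.resEnv P)) :=
  Finsupp.liftAddHom fun s => AddMonoidHom.mk' (fun a =>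
    AddMonoidHom.mk' (fun x => α.indMk P (MonoidAlgebra.of K S s⁻¹)
      (((α.ι a * α.Γ s) ⊗ₜ[K] op (1 : α.CrossedProduct)) • x))
      fun x y => by rw [smul_add, indMk_add])
      fun a b => AddMonoidHom.ext fun x => by
        change α.indMk P _ (((α.ι (a + b) * α.Γ s) ⊗ₜ[K] op (1 : α.CrossedProduct)) • x) =
          α.indMk P _ (((α.ι a * α.Γ s) ⊗ₜ[K] op (1 : α.CrossedProduct)) • x) +
          α.indMk P _ (((α.ι b * α.Γ s) ⊗ₜ[K] op (1 : α.CrossedProduct)) • x)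
        rw [map_add, add_mul, TensorProduct.add_tmul, add_smul, indMk_add]

lemma preTensorAux_single (s : S) (a : A) (x : P) :
    α.preTensorAux P (Finsupp.single s a) x = α.indMk P (MonoidAlgebra.of K S s⁻¹)
      (((α.ι a * α.Γ s) ⊗ₜ[K] op (1 : α.CrossedProduct)) • x) :=
  DFunLike.congr_fun (Finsupp.liftAddHom_apply_single _ s a) x

lemma left_smul_smul (b c : α.CrossedProduct) (x : P) :
    (b ⊗ₜ[K] op (1 : α.CrossedProduct)) • (c ⊗ₜ[K] op (1 : α.CrossedProduct)) • x =
      ((b * c) ⊗ₜ[K] op (1 : α.CrossedProduct)) • x := by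
  rw [smul_smul, Algebra.TensorProduct.tmul_mul_tmul, ← op_mul, one_mul]

/-- From s = e t one gets s⁻¹ = t⁻¹ e. The idempotent crosses the tensor sign, becomes `Γ e` and is
absorbed by the coefficient a. -/
lemma preTensorAux_single_eq {s t : S} (e : Idem S) (h : s = e.1 * t) (a : A)
    (ha : α.unit e.1 * a = a) :
    α.preTensorAux P (Finsupp.single s a) = α.preTensorAux P (Finsupp.single t a) := by
  refine AddMonoidHom.ext fun x => ?_
  have h1 : s⁻¹ = t⁻¹ * e.1 := by rw [h, mul_inv_rev', inv_of_idem e.2]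
  have h2 : α.Γ e.1 * α.ι a = α.ι a := by rw [Γ_idem, ← map_mul, ha]
  have h3 : α.Γ e.1 * (α.ι a * α.Γ s) = α.ι a * α.Γ t := by
    rw [h, map_mul, ← mul_assoc, h2, ← mul_assoc, ← Γ_idem_mul_ι, h2]
  rw [preTensorAux_single, preTensorAux_single, h1, indMk_of_mul, smul_smul,
    Algebra.TensorProduct.tmul_mul_tmul, ← op_mul, one_mul, h3]

/-- A two-sided multiple of a relation for e t ≤ t is again of the type treated in
`preTensorAux_single_eq`, with idempotent r e r⁻¹. -/
lemma preTensorAux_rel {s t : S} (hst : NatLE s t) (a : A) (hs : α.unit s * a = a)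
    (x y : S →₀ A) : α.preTensorAux P (α.lmul (α.lmul x (Finsupp.single s a)) y) =
      α.preTensorAux P (α.lmul (α.lmul x (Finsupp.single t a)) y) := by
  obtain ⟨e, he, rfl⟩ := hst
  have hea : α.unit e * a = a := by
    have h : α.unit e * α.unit (e * t) = α.unit (e * t) := by
      rw [← act_unit, unit_mul_act]
    rw [← hs, ← mul_assoc, h]
  induction x using Finsupp.induction_linear with
  | zero => simp only [map_zero, LinearMap.zero_apply]
  | add x x' hx hx' =>
    have h : ∀ z, α.lmul (α.lmul (x + x') z) y = α.lmul (α.lmul x z) y + α.lmul (α.lmul x' z) y :=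
      fun z => by rw [map_add, LinearMap.add_apply, map_add, LinearMap.add_apply]
    rw [h, h]
    exact (map_add _ _ _).trans ((congrArg₂ (· + ·) hx hx').trans (map_add _ _ _).symm)
  | single r b =>
    induction y using Finsupp.induction_linear with
    | zero => simp only [map_zero]
    | add y y' hy hy' =>
      have h : ∀ z, α.lmul z (y + y') = α.lmul z y + α.lmul z y' := fun z => map_add _ _ _
      rw [h, h]
      exact (map_add _ _ _).trans ((congrArg₂ (· + ·) hy hy').trans (map_add _ _ _).symm)
    | single q c =>
      rw [lmul_single, lmul_single, lmul_single, lmul_single]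
      -- The two coefficients coincide: e acts as multiplication by 1_e, which a absorbs.
      have h1 : b * α.act r a * α.act (r * (e * t)) c = b * α.act r a * α.act (r * t) c := by
        rw [← act_act, ← act_act, ← act_act, mul_assoc, mul_assoc, ← act_mul, ← act_mul,
          act_idem α ⟨e, he⟩, ← mul_assoc, ← α.unit_central, hea]
      rw [h1]
      refine α.preTensorAux_single_eq P ⟨_, conj_idem' r he⟩ ?_ _ ?_
      · change _ = r * e * r⁻¹ * (r * t * q)
        simp only [← mul_assoc]
        rw [← mul_idem_eq r he]
      · change α.unit (r * e * r⁻¹) * _ = _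
        have h2 : α.unit (r * e * r⁻¹) * α.act r a = α.act r a := by
          have h4 : α.unit (r * e) = α.unit (r * e * r⁻¹) * α.unit r :=
            (congrArg α.unit (mul_idem_eq r he)).trans ((α.act_unit _ _).symm.trans
              (α.act_idem ⟨_, conj_idem' r he⟩ _))
          have h3 : α.unit (r * e * r⁻¹) * α.unit (r * e) = α.unit (r * e) := by
            rw [h4, ← mul_assoc, unit_idem]
          rw [← hea, act_mul, act_unit, ← mul_assoc, h3]
        rw [← mul_assoc, ← mul_assoc, α.unit_central, mul_assoc b, h2]

lemma toCrossed_surjective : Function.Surjective α.toCrossed := Ideal.Quotient.mk_surjective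

/-- The map `α.preTensorAux` restricted to `L(A, θ, S)`. -/
def preTensorL : α.L →+ (P →+ IndObj K S (α.resEnv P)) :=
  (α.preTensorAux P).comp α.lSubmodule.subtype.toAddMonoidHom

lemma ker_toCrossed_le :
    (α.toCrossed : α.L →+ α.CrossedProduct).ker ≤ (α.preTensorL P).ker := by
  intro z hz
  have hz' : z ∈ TwoSidedIdeal.span α.crossedRel :=
    TwoSidedIdeal.mem_asIdeal.1 (Ideal.Quotient.eq_zero_iff_mem.1 hz)
  rw [TwoSidedIdeal.mem_span_iff_mem_addSubgroup_closure] at hz'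
  refine (AddSubgroup.closure_le _).2 ?_ hz'
  rintro _ ⟨_, ⟨x, -, _, ⟨s, t, a, hs, ht, hst, rfl⟩, rfl⟩, y, -, rfl⟩
  change α.preTensorAux P (α.lmul (α.lmul x.1 (Finsupp.single s a - Finsupp.single t a)) y.1) = 0
  rw [map_sub, map_sub, LinearMap.sub_apply, map_sub, α.preTensorAux_rel P hst a hs, sub_self]

/-- The map `a δ_s ↦ (x ↦ s⁻¹ ⊗ (a δ_s) x)`. -/
def preTensor : α.CrossedProduct →+ (P →+ IndObj K S (α.resEnv P)) :=
  AddMonoidHom.liftOfSurjective (α.toCrossed : α.L →+ α.CrossedProduct) α.toCrossed_surjective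
    ⟨α.preTensorL P, α.ker_toCrossed_le P⟩

lemma preTensor_toCrossed (z : α.L) : α.preTensor P (α.toCrossed z) = α.preTensorL P z :=
  AddMonoidHom.liftOfRightInverse_comp_apply _ _ _ _ z

/-- The coefficient need not lie in 1_sA, because `Γ s` absorbs 1_s. -/
lemma preTensor_apply (a : A) (s : S) (x : P) :
    α.preTensor P (α.ι a * α.Γ s) x = α.indMk P (MonoidAlgebra.of K S s⁻¹)
      (((α.ι a * α.Γ s) ⊗ₜ[K] op (1 : α.CrossedProduct)) • x) := by
  have h : α.unit s * (a * α.unit s) = a * α.unit s := by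
    rw [← mul_assoc, α.unit_central, mul_assoc, unit_idem]
  have h1 : α.ι a * α.Γ s = α.ι (a * α.unit s) * α.Γ s := by
    rw [map_mul, mul_assoc, ι_unit_mul_Γ]
  rw [h1, ← α.toCrossed_δ s _ h, preTensor_toCrossed, toCrossed_δ]
  exact α.preTensorAux_single P s _ x

lemma preTensor_zero_apply (x : P) : α.preTensor P 0 x = 0 :=
  DFunLike.congr_fun (AddMonoidHom.map_zero (α.preTensor P)) x

lemma preTensor_add_apply (b c : α.CrossedProduct) (x : P) :
    α.preTensor P (b + c) x = α.preTensor P b x + α.preTensor P c x :=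
  DFunLike.congr_fun (AddMonoidHom.map_add (α.preTensor P) b c) x

lemma preTensor_mul_ι (b : α.CrossedProduct) (a : A) (x : P) :
    α.preTensor P (b * α.ι a) x =
      α.preTensor P b ((α.ι a ⊗ₜ[K] op (1 : α.CrossedProduct)) • x) := by
  induction b using α.crossed_induction with
  | zero => rw [zero_mul, preTensor_zero_apply, preTensor_zero_apply]
  | add b c hb hc => rw [add_mul, preTensor_add_apply, preTensor_add_apply, hb, hc]
  | single c s _ =>
    have h : α.ι c * α.Γ s * α.ι a = α.ι (c * α.act s a) * α.Γ s := by
      rw [mul_assoc, Γ_mul_ι, map_mul, mul_assoc]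
    have h2 := α.left_smul_smul P (α.ι c * α.Γ s) (α.ι a) x
    rw [h] at h2
    rw [h, preTensor_apply, preTensor_apply]
    exact congrArg (α.indMk P _) h2.symm

/-- This gives the S-equivariance of the section. For b = aδ_t both sides live over s t⁻¹, and the
idempotent t s⁻¹s t⁻¹ by which the coefficients differ crosses the tensor sign and is absorbed by s
t⁻¹. -/
lemma preTensor_mul_Γ (b : α.CrossedProduct) (s : S) (x : P) :
    α.preTensor P (b * α.Γ s⁻¹) ((α.Γ s ⊗ₜ[K] op (1 : α.CrossedProduct)) • x) =
      MonoidAlgebra.of K S s • α.preTensor P b x := by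
  induction b using α.crossed_induction with
  | zero => rw [zero_mul, preTensor_zero_apply, preTensor_zero_apply, smul_zero]
  | add b c hb hc => rw [add_mul, preTensor_add_apply, preTensor_add_apply, hb, hc, smul_add]
  | single a t _ =>
    have he := inv_mul_idem s
    have hc : α.Γ (t * (s⁻¹ * s) * t⁻¹) * α.ι a = α.ι a * α.Γ (t * (s⁻¹ * s) * t⁻¹) :=
      α.Γ_idem_mul_ι ⟨_, conj_idem' t he⟩ a
    have h1 : α.ι a * α.Γ (t * s⁻¹) * α.Γ s =
        α.Γ (t * (s⁻¹ * s) * t⁻¹) * (α.ι a * α.Γ t) := by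
      rw [← mul_assoc, hc, mul_assoc, mul_assoc, ← map_mul, ← map_mul]
      exact congrArg (fun u => α.ι a * α.Γ u) ((mul_assoc _ _ _).trans (mul_idem_eq t he))
    have h2 : s * t⁻¹ * (t * (s⁻¹ * s) * t⁻¹) = s * t⁻¹ := by
      calc s * t⁻¹ * (t * (s⁻¹ * s) * t⁻¹) = s * ((t⁻¹ * t) * (s⁻¹ * s)) * t⁻¹ := by
            simp only [mul_assoc]
        _ = (s * s⁻¹ * s) * (t⁻¹ * t * t⁻¹) := by
            rw [idem_comm (inv_mul_idem t) he]; simp only [mul_assoc]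
        _ = s * t⁻¹ := by rw [mul_inv_mul_self, inv_mul_inv_self]
    have h3 := α.indMk_of_mul P (s * t⁻¹) ⟨_, conj_idem' t he⟩
      (((α.ι a * α.Γ t) ⊗ₜ[K] op (1 : α.CrossedProduct)) • x)
    have h4 := α.left_smul_smul P (α.Γ (t * (s⁻¹ * s) * t⁻¹)) (α.ι a * α.Γ t) x
    have h5 := α.left_smul_smul P (α.ι a * α.Γ (t * s⁻¹)) (α.Γ s) x
    rw [h1] at h5
    rw [mul_assoc (α.ι a), ← map_mul α.Γ, preTensor_apply, preTensor_apply, smul_indMk, ← map_mul,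
      mul_inv_rev', inv_inv']
    exact (congrArg (α.indMk P _) (h5.trans h4.symm)).trans
      (h3.symm.trans (congrArg (fun u => α.indMk P (MonoidAlgebra.of K S u) _) h2))

lemma preTensor_algebraMap_smul (b : α.CrossedProduct) (k : K) (x : P) :
    α.preTensor P b (algebraMap K (Env K α.CrossedProduct) k • x) =
      algebraMap K (MonoidAlgebra K S) k • α.preTensor P b x := by
  induction b using α.crossed_induction with
  | zero => rw [preTensor_zero_apply, preTensor_zero_apply, smul_zero]
  | add b c hb hc => rw [preTensor_add_apply, preTensor_add_apply, hb, hc, smul_add]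
  | single a s _ =>
    rw [preTensor_apply, preTensor_apply, indMk_algebraMap, smul_smul, smul_smul,
      Algebra.commutes]

/-- This is the identity 1 ⊗ x(aδ_s) = s⁻¹·(1 ⊗ (aδ_s)x) behind `preTensor`: the product `Γ s⁻¹`
(aδ_s) lies in the image of A, so it moves to the right of x `Γ s`, where it reassembles to aδ_s. -/
lemma conj_inv_smul (s : S) (a : A) (h : α.unit s * a = a) (x : P) :
    α.mkOne P (α.conj s⁻¹ • ((α.ι a * α.Γ s) ⊗ₜ[K] op (1 : α.CrossedProduct)) • x) =
      α.mkOne P (((1 : α.CrossedProduct) ⊗ₜ[K] op (α.ι a * α.Γ s)) • x) := by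
  have h1 : α.Γ s⁻¹ * (α.ι a * α.Γ s) = α.ι (α.act s⁻¹ a) := by
    rw [← mul_assoc, Γ_mul_ι, mul_assoc, ← map_mul, α.Γ_idem ⟨_, inv_mul_idem s⟩, ← map_mul,
      ← unit_central, act_inv_unit_mul, h]
  have h2 : α.conj s⁻¹ * ((α.ι a * α.Γ s) ⊗ₜ[K] op (1 : α.CrossedProduct)) =
      (α.ι (α.act s⁻¹ a) ⊗ₜ[K] op (1 : α.CrossedProduct)) *
        ((1 : α.CrossedProduct) ⊗ₜ[K] op (α.Γ s)) := by
    change (α.Γ s⁻¹ ⊗ₜ[K] op (α.Γ s⁻¹⁻¹)) * _ = _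
    rw [Algebra.TensorProduct.tmul_mul_tmul, Algebra.TensorProduct.tmul_mul_tmul, ← op_mul,
      ← op_mul, inv_inv', h1, one_mul, mul_one, mul_one]
  have h3 : ((1 : α.CrossedProduct) ⊗ₜ[K] op (α.ι (α.act s⁻¹ a))) *
      ((1 : α.CrossedProduct) ⊗ₜ[K] op (α.Γ s)) =
      (1 : α.CrossedProduct) ⊗ₜ[K] op (α.ι a * α.Γ s) := by
    rw [Algebra.TensorProduct.tmul_mul_tmul, ← op_mul, mul_one, Γ_mul_ι, act_act_inv, h]
  rw [smul_smul, h2, mul_smul, mkOne_ι, smul_smul, h3]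

lemma retraction_preTensor (b : α.CrossedProduct) (x : P) :
    α.retraction P (α.preTensor P b x) =
      α.mkOne P (((1 : α.CrossedProduct) ⊗ₜ[K] op b) • x) := by
  induction b using α.crossed_induction with
  | zero =>
    have h : ((1 : α.CrossedProduct) ⊗ₜ[K] op (0 : α.CrossedProduct)) • x = 0 := by
      rw [op_zero, TensorProduct.tmul_zero]
      exact zero_smul (Env K α.CrossedProduct) x
    rw [h, preTensor_zero_apply, (α.retraction P).map_zero, (α.mkOne P).map_zero]
  | add b c hb hc =>
    rw [preTensor_add_apply, (α.retraction P).map_add, hb, hc, MulOpposite.op_add,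
      TensorProduct.tmul_add, ← (α.mkOne P).map_add]
    exact congrArg (α.mkOne P) (add_smul _ _ x).symm
  | single a s h =>
    rw [preTensor_apply, retraction_indMk, of_smul_mkOne, conj_inv_smul _ _ _ _ h]

/-- The map `b ⊗ c ↦ N c (b x)`, where `N = α.preTensor P`. -/
def envTensor (x : P) : Env K α.CrossedProduct →+ IndObj K S (α.resEnv P) :=
  TensorProduct.liftAddHom
    (AddMonoidHom.mk' (fun b =>
      ((α.preTensor P).flip ((b ⊗ₜ[K] op (1 : α.CrossedProduct)) • x)).comp
        (opAddEquiv (α := α.CrossedProduct)).symm.toAddMonoidHom)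
      fun b c => AddMonoidHom.ext fun d => by
        change α.preTensor P (unop d) (((b + c) ⊗ₜ[K] op (1 : α.CrossedProduct)) • x) =
          α.preTensor P (unop d) ((b ⊗ₜ[K] op (1 : α.CrossedProduct)) • x) +
          α.preTensor P (unop d) ((c ⊗ₜ[K] op (1 : α.CrossedProduct)) • x)
        rw [TensorProduct.add_tmul, add_smul, map_add])
    (fun k b d => by
      change α.preTensor P (unop d) (((k • b) ⊗ₜ[K] op (1 : α.CrossedProduct)) • x) =
        α.preTensor P (k • unop d) ((b ⊗ₜ[K] op (1 : α.CrossedProduct)) • x)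
      have h1 : k • unop d = unop d * α.ι (algebraMap K A k) := by
        rw [AlgHom.commutes, ← Algebra.commutes, Algebra.smul_def]
      rw [h1, preTensor_mul_ι, left_smul_smul, AlgHom.commutes, Algebra.smul_def])

/-- The map on the free module on `P` given by the maps `α.envTensor P x`. -/
def freeTensor : (P →₀ Env K α.CrossedProduct) →+ IndObj K S (α.resEnv P) :=
  Finsupp.liftAddHom (α.envTensor P)

lemma freeTensor_single (x : P) (b c : α.CrossedProduct) :
    α.freeTensor P (Finsupp.single x (b ⊗ₜ[K] op c)) =
      α.preTensor P c ((b ⊗ₜ[K] op (1 : α.CrossedProduct)) • x) :=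
  (Finsupp.liftAddHom_apply_single _ x _).trans rfl

lemma free_hom_ext {T : Type*} [AddCommGroup T] {f g : (P →₀ Env K α.CrossedProduct) →+ T}
    (h : ∀ x b c, f (Finsupp.single x (b ⊗ₜ[K] op c)) = g (Finsupp.single x (b ⊗ₜ[K] op c))) :
    f = g := by
  refine AddMonoidHom.ext fun z => ?_
  induction z using Finsupp.induction_linear with
  | zero => rw [map_zero, map_zero]
  | add z w hz hw => rw [map_add, map_add, hz, hw]
  | single x r =>
    induction r using TensorProduct.induction_on with
    | zero => rw [Finsupp.single_zero, map_zero, map_zero]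
    | add r s hr hs => rw [Finsupp.single_add, map_add, map_add, hr, hs]
    | tmul b c => exact h x b (unop c)

/-- On generators this is `preTensor_mul_ι`. It says that commutators with A are killed, as a map
out of A ⊗_{A^e} P requires. -/
lemma freeTensor_ι (a : A) (z : P →₀ Env K α.CrossedProduct) :
    α.freeTensor P ((α.ι a ⊗ₜ[K] op (1 : α.CrossedProduct)) • z) =
      α.freeTensor P (((1 : α.CrossedProduct) ⊗ₜ[K] op (α.ι a)) • z) := by
  refine DFunLike.congr_fun (f := (α.freeTensor P).comp (DistribSMul.toAddMonoidHom _
    (α.ι a ⊗ₜ[K] op (1 : α.CrossedProduct)))) (g := (α.freeTensor P).comp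
    (DistribSMul.toAddMonoidHom _ ((1 : α.CrossedProduct) ⊗ₜ[K] op (α.ι a))))
    (α.free_hom_ext P fun x b c => ?_) z
  change α.freeTensor P ((α.ι a ⊗ₜ[K] op (1 : α.CrossedProduct)) • Finsupp.single x _) =
    α.freeTensor P (((1 : α.CrossedProduct) ⊗ₜ[K] op (α.ι a)) • Finsupp.single x _)
  rw [Finsupp.smul_single, Finsupp.smul_single, smul_eq_mul, smul_eq_mul,
    Algebra.TensorProduct.tmul_mul_tmul, Algebra.TensorProduct.tmul_mul_tmul, ← op_mul, ← op_mul,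
    mul_one, one_mul, freeTensor_single, freeTensor_single, preTensor_mul_ι,
    left_smul_smul]

lemma freeTensor_conj (s : S) (z : P →₀ Env K α.CrossedProduct) :
    α.freeTensor P (α.conj s • z) = MonoidAlgebra.of K S s • α.freeTensor P z := by
  refine DFunLike.congr_fun (f := (α.freeTensor P).comp (DistribSMul.toAddMonoidHom _
    (α.conj s))) (g := (DistribSMul.toAddMonoidHom _ (MonoidAlgebra.of K S s)).comp
    (α.freeTensor P)) (α.free_hom_ext P fun x b c => ?_) z
  change α.freeTensor P ((α.Γ s ⊗ₜ[K] op (α.Γ s⁻¹)) • Finsupp.single x _) =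
    MonoidAlgebra.of K S s • α.freeTensor P (Finsupp.single x _)
  rw [Finsupp.smul_single, smul_eq_mul, Algebra.TensorProduct.tmul_mul_tmul, ← op_mul,
    freeTensor_single, freeTensor_single, ← preTensor_mul_Γ, left_smul_smul]

lemma freeTensor_algebraMap_smul (k : K) (z : P →₀ Env K α.CrossedProduct) :
    α.freeTensor P (algebraMap K (Env K α.CrossedProduct) k • z) =
      algebraMap K (MonoidAlgebra K S) k • α.freeTensor P z := by
  refine DFunLike.congr_fun (f := (α.freeTensor P).comp (DistribSMul.toAddMonoidHom _
    (algebraMap K (Env K α.CrossedProduct) k))) (g := (DistribSMul.toAddMonoidHom _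
    (algebraMap K (MonoidAlgebra K S) k)).comp
    (α.freeTensor P)) (α.free_hom_ext P fun x b c => ?_) z
  change α.freeTensor P (algebraMap K (Env K α.CrossedProduct) k • Finsupp.single x _) =
    algebraMap K (MonoidAlgebra K S) k • α.freeTensor P (Finsupp.single x _)
  have h : algebraMap K (Env K α.CrossedProduct) k =
      algebraMap K α.CrossedProduct k ⊗ₜ[K] op (1 : α.CrossedProduct) := rfl
  have h1 : (algebraMap K α.CrossedProduct k * b) ⊗ₜ[K] op (1 : α.CrossedProduct) =
      algebraMap K (Env K α.CrossedProduct) k * (b ⊗ₜ[K] op (1 : α.CrossedProduct)) := by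
    rw [h, Algebra.TensorProduct.tmul_mul_tmul, ← op_mul, one_mul]
  rw [Finsupp.smul_single, smul_eq_mul, h, Algebra.TensorProduct.tmul_mul_tmul, ← op_mul, mul_one,
    freeTensor_single, freeTensor_single, h1, mul_smul, preTensor_algebraMap_smul]

lemma retraction_freeTensor (z : P →₀ Env K α.CrossedProduct) :
    α.retraction P (α.freeTensor P z) =
      α.mkOne P (Finsupp.linearCombination (Env K α.CrossedProduct) id z) := by
  refine DFunLike.congr_fun (f := (α.retraction P).toAddMonoidHom.comp (α.freeTensor P))
    (g := (α.mkOne P).comp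
      (Finsupp.linearCombination (Env K α.CrossedProduct) (id : P → P)).toAddMonoidHom)
    (α.free_hom_ext P fun x b c => ?_) z
  change α.retraction P (α.freeTensor P (Finsupp.single x _)) =
    α.mkOne P (Finsupp.linearCombination (Env K α.CrossedProduct) id (Finsupp.single x _))
  rw [Finsupp.linearCombination_single, freeTensor_single, retraction_preTensor, smul_smul,
    Algebra.TensorProduct.tmul_mul_tmul, ← op_mul, one_mul, one_mul]
  rfl

/-! ### The section for a projective bimodule. -/

section

variable (τ : P →ₗ[Env K α.CrossedProduct] P →₀ Env K α.CrossedProduct)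

/-- The left factor c on the one side and the right factor c on the other are exchanged by
`freeTensor_ι`, applied after τ, which is a bimodule map. -/
lemma freeTensor_op_tmul_smul (a b c : A) (x : P) :
    α.freeTensor P (τ ((α.ι (op (b ⊗ₜ[K] op c) • a) ⊗ₜ[K] op (1 : α.CrossedProduct)) • x)) =
      α.freeTensor P (τ ((α.ι a ⊗ₜ[K] op (1 : α.CrossedProduct)) •
        α.envMap (b ⊗ₜ[K] op c) • x)) := by
  have h : α.envMap (b ⊗ₜ[K] op c) = α.ι b ⊗ₜ[K] op (α.ι c) := rfl
  have h1 : α.ι (c * a * b) ⊗ₜ[K] op (1 : α.CrossedProduct) =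
      (α.ι c ⊗ₜ[K] op (1 : α.CrossedProduct)) *
        (α.ι (a * b) ⊗ₜ[K] op (1 : α.CrossedProduct)) := by
    rw [Algebra.TensorProduct.tmul_mul_tmul, ← op_mul, one_mul, ← map_mul, mul_assoc]
  have h2 : (α.ι a ⊗ₜ[K] op (1 : α.CrossedProduct)) * (α.ι b ⊗ₜ[K] op (α.ι c)) =
      ((1 : α.CrossedProduct) ⊗ₜ[K] op (α.ι c)) *
        (α.ι (a * b) ⊗ₜ[K] op (1 : α.CrossedProduct)) := by
    rw [Algebra.TensorProduct.tmul_mul_tmul, Algebra.TensorProduct.tmul_mul_tmul, ← op_mul,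
      ← op_mul, one_mul, one_mul, mul_one, map_mul]
  have h3 := mul_smul (α.ι c ⊗ₜ[K] op (1 : α.CrossedProduct))
    (α.ι (a * b) ⊗ₜ[K] op (1 : α.CrossedProduct)) x
  have h4 := mul_smul ((1 : α.CrossedProduct) ⊗ₜ[K] op (α.ι c))
    (α.ι (a * b) ⊗ₜ[K] op (1 : α.CrossedProduct)) x
  have h5 := smul_smul (α.ι a ⊗ₜ[K] op (1 : α.CrossedProduct)) (α.ι b ⊗ₜ[K] op (α.ι c)) x
  rw [op_tmul_smul, h, h1, h3, τ.map_smul, freeTensor_ι, ← τ.map_smul]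
  exact congrArg (fun y => α.freeTensor P (τ y)) (h4.symm.trans ((h2 ▸ h5).symm))

lemma freeTensor_op_smul (a : A) (r : Env K A) (x : P) :
    α.freeTensor P (τ ((α.ι (op r • a) ⊗ₜ[K] op (1 : α.CrossedProduct)) • x)) =
      α.freeTensor P (τ ((α.ι a ⊗ₜ[K] op (1 : α.CrossedProduct)) • α.envMap r • x)) := by
  induction r using TensorProduct.induction_on with
  | zero =>
    have h : op (0 : Env K A) • a = 0 := zero_smul (Env K A)ᵐᵒᵖ a
    have h1 : (0 : Env K α.CrossedProduct) • x = 0 := zero_smul (Env K α.CrossedProduct) x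
    rw [h, map_zero, map_zero, TensorProduct.zero_tmul, h1, smul_zero]
  | add r r' h h' =>
    have h1 : op (r + r') • a = op r • a + op r' • a := add_smul (op r) (op r') a
    have h2 : α.envMap (r + r') • x = α.envMap r • x + α.envMap r' • x :=
      (congrArg (· • x) (map_add α.envMap r r')).trans (add_smul _ _ x)
    have h3 : (α.ι (op (r + r') • a) ⊗ₜ[K] op (1 : α.CrossedProduct)) • x =
        (α.ι (op r • a) ⊗ₜ[K] op (1 : α.CrossedProduct)) • x +
          (α.ι (op r' • a) ⊗ₜ[K] op (1 : α.CrossedProduct)) • x := by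
      rw [h1, map_add α.ι, TensorProduct.add_tmul]
      exact add_smul _ _ x
    have h4 : ∀ y z, α.freeTensor P (τ (y + z)) = α.freeTensor P (τ y) + α.freeTensor P (τ z) :=
      fun y z => (congrArg _ (τ.map_add y z)).trans ((α.freeTensor P).map_add _ _)
    refine (congrArg (fun y => α.freeTensor P (τ y)) h3).trans ((h4 _ _).trans ?_)
    refine (congrArg₂ (· + ·) h h').trans ((h4 _ _).symm.trans ?_)
    refine congrArg (fun y => α.freeTensor P (τ y)) ((smul_add _ _ _).symm.trans ?_)
    exact congrArg _ h2.symm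
  | tmul b c =>
    obtain ⟨c, rfl⟩ := op_surjective c
    exact α.freeTensor_op_tmul_smul P τ a b c x

/-- The additive map `a ⊗ x ↦ Λ (τ (a x))`, where `Λ = α.freeTensor P`. -/
def sectionAux : α.F₁Obj P →+ IndObj K S (α.resEnv P) :=
  BalancedTensor.liftAdd
    (AddMonoidHom.mk' (fun a => (α.freeTensor P).comp (τ.toAddMonoidHom.comp
      (DistribSMul.toAddMonoidHom P
        (α.ι a ⊗ₜ[K] op (1 : α.CrossedProduct) : Env K α.CrossedProduct))))
      fun a b => AddMonoidHom.ext fun (x : P) => by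
        change α.freeTensor P (τ ((α.ι (a + b) ⊗ₜ[K] op (1 : α.CrossedProduct)) • x)) =
          α.freeTensor P (τ ((α.ι a ⊗ₜ[K] op (1 : α.CrossedProduct)) • x)) +
          α.freeTensor P (τ ((α.ι b ⊗ₜ[K] op (1 : α.CrossedProduct)) • x))
        rw [map_add α.ι, TensorProduct.add_tmul, add_smul, map_add, map_add])
    (α.freeTensor_op_smul P τ)

lemma sectionAux_mk (a : A) (x : P) :
    α.sectionAux P τ (BalancedTensor.mk K (Env K A) a (show α.restrict P from x)) =
      α.freeTensor P (τ ((α.ι a ⊗ₜ[K] op (1 : α.CrossedProduct)) • x)) := rfl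

lemma sectionAux_of_smul (s : S) (z : α.F₁Obj P) :
    α.sectionAux P τ (MonoidAlgebra.of K S s • z) =
      MonoidAlgebra.of K S s • α.sectionAux P τ z := by
  induction z using BalancedTensor.induction with
  | hadd z w hz hw => rw [smul_add, map_add, map_add, smul_add, hz, hw]
  | hmk a x =>
    have h : (α.ι (α.act s a) ⊗ₜ[K] op (1 : α.CrossedProduct)) * α.conj s =
        α.conj s * (α.ι a ⊗ₜ[K] op (1 : α.CrossedProduct)) := by
      change _ * (α.Γ s ⊗ₜ[K] op (α.Γ s⁻¹)) = (α.Γ s ⊗ₜ[K] op (α.Γ s⁻¹)) * _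
      rw [Algebra.TensorProduct.tmul_mul_tmul, Algebra.TensorProduct.tmul_mul_tmul, ← op_mul,
        ← op_mul, one_mul, mul_one, Γ_mul_ι]
    rw [of_smul_mk]
    refine (α.sectionAux_mk P τ _ (α.conj s • (show P from x))).trans ?_
    refine Eq.trans ?_ (congrArg _ (α.sectionAux_mk P τ a x)).symm
    have h1 := smul_smul (α.ι (α.act s a) ⊗ₜ[K] op (1 : α.CrossedProduct)) (α.conj s)
      (show P from x)
    have h2 := mul_smul (α.conj s) (α.ι a ⊗ₜ[K] op (1 : α.CrossedProduct)) (show P from x)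
    rw [← freeTensor_conj, ← map_smul]
    exact congrArg (fun y => α.freeTensor P (τ y)) (h1.trans (h ▸ h2))

lemma sectionAux_algebraMap_smul (k : K) (z : α.F₁Obj P) :
    α.sectionAux P τ (algebraMap K (MonoidAlgebra K S) k • z) =
      algebraMap K (MonoidAlgebra K S) k • α.sectionAux P τ z := by
  induction z using BalancedTensor.induction with
  | hadd z w hz hw => rw [smul_add, map_add, map_add, smul_add, hz, hw]
  | hmk a x =>
    have h : α.ι (k • a) ⊗ₜ[K] op (1 : α.CrossedProduct) =
        algebraMap K (Env K α.CrossedProduct) k * (α.ι a ⊗ₜ[K] op (1 : α.CrossedProduct)) := by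
      rw [map_smul, ← Algebra.smul_def, TensorProduct.smul_tmul']
    rw [algebraMap_smul_F₁Obj, BalancedTensor.smul_mk]
    refine (α.sectionAux_mk P τ _ x).trans ?_
    refine Eq.trans ?_ (congrArg _ (α.sectionAux_mk P τ a x)).symm
    have h2 := mul_smul (algebraMap K (Env K α.CrossedProduct) k)
      (α.ι a ⊗ₜ[K] op (1 : α.CrossedProduct)) (show P from x)
    rw [← freeTensor_algebraMap_smul, ← map_smul, h]
    exact congrArg (fun y => α.freeTensor P (τ y)) h2

/-- The homomorphism `a ⊗ x ↦ Λ (τ (a x))`, where `Λ = α.freeTensor P`. -/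
def sectionHom : α.F₁Obj P →ₗ[MonoidAlgebra K S] IndObj K S (α.resEnv P) :=
  { α.sectionAux P τ with
    map_smul' := MonoidAlgebra.map_smul_of_forall (α.sectionAux P τ) (α.sectionAux_of_smul P τ)
      (α.sectionAux_algebraMap_smul P τ) }

lemma retraction_sectionHom
    (hτ : ∀ x, Finsupp.linearCombination (Env K α.CrossedProduct) id (τ x) = x)
    (z : α.F₁Obj P) : α.retraction P (α.sectionHom P τ z) = z := by
  induction z using BalancedTensor.induction with
  | hadd z w hz hw => rw [map_add, map_add, hz, hw]
  | hmk a x =>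
    refine (congrArg (α.retraction P) (α.sectionAux_mk P τ a x)).trans ?_
    rw [retraction_freeTensor, hτ]
    exact α.mk_one_left P a x

end

/-- For a projective bimodule `P` over the crossed product, `F₁ P` is a retract of an induced
module. -/
lemma nonempty_retract_F₁ [hP : Projective P] :
    Nonempty (Retract (α.F₁.obj P) ((ind K S).obj (α.resEnv P))) := by
  have h : Module.Projective (Env K α.CrossedProduct) P := (IsProjective.iff_projective P).2 hP
  -- τ splits the canonical surjection onto P from the free bimodule on its underlying set.
  obtain ⟨τ, hτ⟩ := h.out
  exact ⟨{ i := ModuleCat.ofHom (α.sectionHom P τ)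
           r := ModuleCat.ofHom (α.retraction P)
           retract := ModuleCat.hom_ext (LinearMap.ext (α.retraction_sectionHom P τ hτ)) }⟩

/-- Functors preserve retracts, and a retract of a zero object is zero. -/
lemma isZero_tor_F₁ [Projective P] (n : ℕ) :
    Limits.IsZero (((tensorFunctor K (MonoidAlgebra K S) (KE K S)).leftDerived (n + 1)).obj
      (α.F₁.obj P)) := by
  obtain ⟨r⟩ := α.nonempty_retract_F₁ P
  have h := isZero_tor_ind (K := K) (α.resEnv P) n
  refine (Limits.IsZero.iff_id_eq_zero _).2 ?_
  rw [← (r.map ((tensorFunctor K (MonoidAlgebra K S) (KE K S)).leftDerived (n + 1))).retract]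
  exact (congrArg (· ≫ _) (h.eq_zero_of_tgt _)).trans Limits.zero_comp

end UnitalAction

end

theorem mainTheorem1 {K A S : Type u} [Field K] [Ring A] [Algebra K A] [InverseMonoid S]
    (θ : UnitalAction K A S) (M : ModuleCat.{u} (Env K θ.CrossedProduct)) :
    ∃ E : FirstQuadrantHomologySS K,
      (∀ p q : ℕ, Nonempty ((E.page 2 le_rfl).X (p, q) ≅
        inverseMonoidHomology K S p ((θ.F₁.leftDerived q).obj M))) ∧
      E.ConvergesTo (fun n => hochschildHomology K θ.CrossedProduct n M) := by
  let Q := ProjectiveResolution.of M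
  -- The complex is F₁Q: its terms are acyclic since Q is projective, its homology is (L_qF₁)M, and
  -- KE(S) ⊗ F₁Q ≅ B ⊗_{B^e} Q has the Hochschild homology of M.
  obtain ⟨E, hE, hconv⟩ := FreeCover.exists_spectralSequence
    (tensorFunctor K (MonoidAlgebra K S) (KE K S))
    ((θ.F₁.mapHomologicalComplex _).obj Q.complex)
    (BalancedTensor.rightExact_tensorFunctor K (KE K S))
    (fun p q => θ.isZero_tor_F₁ (Q.complex.X q) p)
    (fun n => hochschildHomology K θ.CrossedProduct n M)
    (fun n => ⟨(HomologicalComplex.homologyFunctor _ _ n).mapIso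
        ((NatIso.mapHomologicalComplex θ.compIso _).app Q.complex) ≪≫
      (Q.isoLeftDerivedObj (tensorFunctor K (Env K θ.CrossedProduct) θ.CrossedProduct) n).symm⟩)
  refine ⟨E, fun p q => ?_, hconv⟩
  obtain ⟨i⟩ := hE p q
  exact ⟨i ≪≫ ((tensorFunctor K (MonoidAlgebra K S) (KE K S)).leftDerived p).mapIso
    (Q.isoLeftDerivedObj θ.F₁ q).symm⟩
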